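/- Let $\mathbb{F}^3=U(3)/(S^1)^3$ be the manifold of flags $\ell\subset p\subset\mathbb{C}^3$; a unitary basis $(u_1,u_2,u_3)$ defines the flag $\ell=\mathbb{C}u_1\subset p=\mathbb{C}u_1\oplus\mathbb{C}u_2$. Let $\mathfrak m\subset\mathfrak u(3)$ be the space of skew-Hermitian matrices with zero diagonal, identified with the tangent space at the standard flag, and write $$\langle a,b,c\rangle=\begin{pmatrix}0&-\bar a&b\\ a&0&-\bar c\\ -\bar b&c&0\end{pmatrix}\in\mathfrak m,\qquad a,b,c\in\mathbb{C}.$$ An almost Hermitian structure $(g,J)$ with Levi-Civita connection $\nabla$ is *nearly Kähler* if $(\nabla_XJ)X=0$ for all $X$, and *strictly* nearly Kähler if moreover $\nabla J\neq0$. An invariant metric $g$ on $\mathbb{F}^3$ is *naturally reductive* if $g([X,Y]^{\mathfrak m},Z)=-g([X,Z]^{\mathfrak m},Y)$ for all $X,Y,Z\in\mathfrak m$, where ${}^{\mathfrak m}$ is the component in $\mathfrak m$ along the diagonal matrices. Let $h$ be the Fubini–Study metric of $\mathbb{C}P^2$ with holomorphic sectional curvature $4$, and let $\mathcal Z\to\mathbb{C}P^2$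 be its twistor space, whose points over $x$ are the $h$-orthogonal, orientation-reversing complex structures $j$ of $T_x\mathbb{C}P^2$. The Levi-Civita connection of $h$ splits $T\mathcal Z$ into horizontal and vertical vectors, the vertical vectors at $j$ being skew-symmetric endomorphisms $A$ of $T_x\mathbb{C}P^2$ that anticommute with $j$. Let $J_-$ be the almost complex structure on $\mathcal Z$ that is the lift of $j$ on horizontal vectors and $A\mapsto -j\circ A$ on vertical vectors, and for $t>0$ let $g_t$ be the metric that is $h$ on horizontal vectors, $-\frac{t}{16}\operatorname{tr}(AB)$ on vertical vectors, and makes the two orthogonal. For $a\in\mathbb{Z}/3$, let $\tau_a:\mathbb{F}^3\to\mathcal Z$ send the flag of $(u_1,u_2,u_3)$ to the point $\mathbb{C}u_a$ with the complex structure $j$ on $T_{\mathbb{C}u_a}\mathbb{C}P^2=\operatorname{Hom}(\mathbb{C}u_a,\mathbb{C}u_{a+1})\oplus\operatorname{Hom}(\mathbb{C}u_a,\mathbb{C}u_{a+2})$ that is $i$ on the first summand and $-i$ on the second. 1. Each $\tau_a$ is a bijection of $\mathbb{F}^3$ onto $\mathcal Z$, so that $\mathbb{F}^3\to\mathbb{C}P^2$,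 $(u_1,u_2,u_3)\mapsto\mathbb{C}u_a$, is a twistor fibration. For $t>0$ the pullback $\tau_a^*(g_t,J_-)$ is nearly Kähler if and only if $t=1$. The three structures $\tau_a^*(g_1,J_-)$, $a=1,2,3$, coincide; the resulting structure $(g,J)$ is $U(3)$-invariant and strictly nearly Kähler. 2. Every $U(3)$-invariant strictly nearly Kähler structure on $\mathbb{F}^3$ is of the form $(cg,J)$ or $(cg,-J)$ with a constant $c>0$. 3. For every $U(3)$-invariant almost Hermitian structure on $\mathbb{F}^3$, the metric is given on $\mathfrak m$ by $$(\langle a,b,c\rangle,\langle a',b',c'\rangle)\mapsto r\operatorname{Re}(a\overline{a'})+s\operatorname{Re}(b\overline{b'})+t\operatorname{Re}(c\overline{c'})$$ for some $r,s,t>0$, and it is naturally reductive if and only if $r=s=t$. The metric $g$ of part 1 is naturally reductive, with $r=s=t=1$, and $J\langle a,b,c\rangle=\langle ia,ib,ic\rangle$. -/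

import Mathlib

open scoped Matrix ContDiff Matrix.Norms.Frobenius

noncomputable section

namespace NearlyKaehler

/-! ### Almost Hermitian geometry of a closed submanifold of a vector space

A closed submanifold of a finite-dimensional real vector space `V` is given by its set of points.
Every smooth function, vector field or tensor field on a closed submanifold is the restriction of
a smooth one on `V`, so these objects are represented by smooth extensions to `V`; only their values
at the points of the submanifold, on vectors tangent to it, are ever used. -/

section Submanifold

variable {V : Type*} [NormedAddCommGroup V] [NormedSpace ℝ V]

/-- The tangent space of the submanifold `S` at `p`: the velocities of smooth curves in `S`
through `p` (for a submanifold they form a linear subspace, so that the span adds nothing). -/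
def tangentSpace (S : Set V) (p : V) : Submodule ℝ V :=
  Submodule.span ℝ {v | ∃ γ : ℝ → V,
    ContDiff ℝ ∞ γ ∧ (∀ t, γ t ∈ S) ∧ γ 0 = p ∧ deriv γ 0 = v}

/-- `X` is (a smooth extension of) a smooth vector field on `S`. -/
def IsVectorField (S : Set V) (X : V → V) : Prop :=
  ContDiff ℝ ∞ X ∧ ∀ p ∈ S, X p ∈ tangentSpace S p

/-- An almost Hermitian structure `(g, J)` on `S`: a Riemannian metric `g` and a `g`-orthogonal
almost complex structure `J`. -/
structure AlmostHermitian (S : Set V) where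
  g : V → V →L[ℝ] V →L[ℝ] ℝ
  J : V → V →L[ℝ] V
  smooth_g : ContDiff ℝ ∞ g
  smooth_J : ContDiff ℝ ∞ J
  g_symm : ∀ p ∈ S, ∀ u ∈ tangentSpace S p, ∀ v ∈ tangentSpace S p, g p u v = g p v u
  g_pos : ∀ p ∈ S, ∀ u ∈ tangentSpace S p, u ≠ 0 → 0 < g p u u
  J_mem : ∀ p ∈ S, ∀ u ∈ tangentSpace S p, J p u ∈ tangentSpace S p
  J_sq : ∀ p ∈ S, ∀ u ∈ tangentSpace S p, J p (J p u) = -u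
  compat : ∀ p ∈ S, ∀ u ∈ tangentSpace S p, ∀ v ∈ tangentSpace S p,
    g p (J p u) (J p v) = g p u v

/-- `D X Y = ∇_X Y` is the Levi-Civita connection of the metric `g` on `S`: a connection on the
tangent bundle of `S` which is torsion-free and preserves `g`. -/
structure IsLeviCivita (S : Set V) (g : V → V →L[ℝ] V →L[ℝ] ℝ)
    (D : (V → V) → (V → V) → V → V) : Prop where
  vectorField : ∀ X Y, IsVectorField S X → IsVectorField S Y → IsVectorField S (D X Y)
  add_left : ∀ X X' Y, IsVectorField S X → IsVectorField S X' → IsVectorField S Y →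
    ∀ p ∈ S, D (X + X') Y p = D X Y p + D X' Y p
  smul_left : ∀ (f : V → ℝ) X Y, ContDiff ℝ ∞ f → IsVectorField S X → IsVectorField S Y →
    ∀ p ∈ S, D (fun q => f q • X q) Y p = f p • D X Y p
  add_right : ∀ X Y Y', IsVectorField S X → IsVectorField S Y → IsVectorField S Y' →
    ∀ p ∈ S, D X (Y + Y') p = D X Y p + D X Y' p
  leibniz : ∀ (f : V → ℝ) X Y, ContDiff ℝ ∞ f → IsVectorField S X → IsVectorField S Y →
    ∀ p ∈ S, D X (fun q => f q • Y q) p = f p • D X Y p + fderiv ℝ f p (X p) • Y p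
  torsion_free : ∀ X Y, IsVectorField S X → IsVectorField S Y →
    ∀ p ∈ S, D X Y p - D Y X p = VectorField.lieBracket ℝ X Y p
  metric : ∀ X Y Z, IsVectorField S X → IsVectorField S Y → IsVectorField S Z →
    ∀ p ∈ S, fderiv ℝ (fun q => g q (Y q) (Z q)) p (X p)
      = g p (D X Y p) (Z p) + g p (Y p) (D X Z p)

namespace AlmostHermitian

variable {S : Set V}

/-- Nearly Kähler: `(∇_X J) X = 0` for all `X`, where `(∇_X J) Y = ∇_X (J Y) - J (∇_X Y)` and `∇`
is the Levi-Civita connection. -/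
def IsNearlyKaehler (A : AlmostHermitian S) : Prop :=
  ∃ D, IsLeviCivita S A.g D ∧ ∀ X, IsVectorField S X →
    ∀ p ∈ S, D X (fun q => A.J q (X q)) p - A.J p (D X X p) = 0

/-- Kähler: `∇ J = 0`. -/
def IsKaehler (A : AlmostHermitian S) : Prop :=
  ∃ D, IsLeviCivita S A.g D ∧ ∀ X Y, IsVectorField S X → IsVectorField S Y →
    ∀ p ∈ S, D X (fun q => A.J q (Y q)) p - A.J p (D X Y p) = 0

/-- Strictly nearly Kähler: nearly Kähler but not Kähler. -/
def IsStrictlyNearlyKaehler (A : AlmostHermitian S) : Prop :=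
  A.IsNearlyKaehler ∧ ¬ A.IsKaehler

/-- `A` and `B` are the same almost Hermitian structure on `S` (as tensor fields on `S`). -/
def Same (A B : AlmostHermitian S) : Prop :=
  ∀ p ∈ S, ∀ u ∈ tangentSpace S p,
    (∀ v ∈ tangentSpace S p, A.g p u v = B.g p u v) ∧ A.J p u = B.J p u

/-- `A` is proportional to `B = (g, J)` or to its opposite: `A = (c g, J)` or `A = (c g, -J)`,
with a constant `c > 0`. -/
def ProportionalUpToSign (A B : AlmostHermitian S) : Prop :=
  (∃ c : ℝ, 0 < c ∧ ∀ p ∈ S, ∀ u ∈ tangentSpace S p, ∀ v ∈ tangentSpace S p,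
    A.g p u v = c * B.g p u v) ∧
  ((∀ p ∈ S, ∀ u ∈ tangentSpace S p, A.J p u = B.J p u) ∨
    (∀ p ∈ S, ∀ u ∈ tangentSpace S p, A.J p u = -B.J p u))

end AlmostHermitian

end Submanifold

/-- Complex `3 × 3` matrices, as a real normed space. -/
abbrev Mat : Type := Matrix (Fin 3) (Fin 3) ℂ

/-- The usual topology of the space of matrices, taken from its (Frobenius) norm. -/
instance instTopologicalSpaceMat : TopologicalSpace Mat :=
  PseudoMetricSpace.toUniformSpace.toTopologicalSpace

/-- The usual uniformity of the space of matrices, taken from its (Frobenius) norm. -/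
instance instUniformSpaceMat : UniformSpace Mat := PseudoMetricSpace.toUniformSpace

/-! ### The flag manifold -/

/-- The space in which the flag manifold is embedded: triples of matrices. -/
abbrev Triple : Type := Fin 3 → Mat

/-- The standard flag: the orthogonal projections onto the three coordinate lines. -/
def baseFlag : Triple := fun k => Matrix.single k k 1

/-- The action of a matrix `u` (unitary, in all uses) on triples, by conjugation. -/
def conjAct (u : Mat) (P : Triple) : Triple := fun k => u * P k * uᴴ

/-- The flag manifold. For a unitary basis `(u₁, u₂, u₃)` of `ℂ³`, i.e. `u` in `U(3)`, the flag
`ℂ u₁ ⊂ ℂ u₁ ⊕ ℂ u₂` is recorded by the orthogonal projections onto the lines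
`ℂ u₁`, `ℂ u₂`, `ℂ u₃`. This is the `U(3)`-orbit of the standard flag, whose stabilizer is the
group of diagonal unitary matrices. -/
def flagManifold : Set Triple :=
  {P | ∃ u ∈ Matrix.unitaryGroup (Fin 3) ℂ, P = conjAct u baseFlag}

/-- Invariance of an almost Hermitian structure under the action of `U(3)`. -/
def IsInvariant (A : AlmostHermitian flagManifold) : Prop :=
  ∀ u ∈ Matrix.unitaryGroup (Fin 3) ℂ, ∀ P ∈ flagManifold,
    ∀ X ∈ tangentSpace flagManifold P,
      (∀ Y ∈ tangentSpace flagManifold P,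
        A.g (conjAct u P) (conjAct u X) (conjAct u Y) = A.g P X Y) ∧
      A.J (conjAct u P) (conjAct u X) = conjAct u (A.J P X)

/-- The elements `⟨a, b, c⟩` of the complement `𝔪` of the diagonal matrices in the Lie algebra
`𝔲(3)` of skew-Hermitian matrices. -/
def isoVec (a b c : ℂ) : Mat :=
  !![0, -star a, b; a, 0, -star c; -star b, c, 0]

/-- The tangent vector at the standard flag defined by a skew-Hermitian matrix `M`, i.e. the
derivative at `t = 0` of `exp (t M) · baseFlag`. On `𝔪` this is the identification of `𝔪` with
the tangent space at the standard flag. -/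
def fundVec (M : Mat) : Triple := fun k => M * baseFlag k - baseFlag k * M

/-- The scalar product `r g_𝔭 + s g_𝔮 + t g_𝔯` on `𝔪`, evaluated on `⟨a, b, c⟩` and
`⟨a', b', c'⟩`. -/
def isoForm (r s t : ℝ) (a b c a' b' c' : ℂ) : ℝ :=
  r * (a * star a').re + s * (b * star b').re + t * (c * star c').re

/-- The scalar product on `𝔪` which represents the metric of `A`. -/
def metricOnIso (A : AlmostHermitian flagManifold) (X Y : Mat) : ℝ :=
  A.g baseFlag (fundVec X) (fundVec Y)

/-- The component in `𝔪` of an element of `𝔲(3)`, along the diagonal matrices. -/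
def isoPart (M : Mat) : Mat := M - Matrix.diagonal M.diag

/-- The metric of `A` is naturally reductive:
`g([X, Y]^𝔪, Z) = -g([X, Z]^𝔪, Y)` for all `X, Y, Z` in `𝔪`. -/
def IsNaturallyReductive (A : AlmostHermitian flagManifold) : Prop :=
  ∀ X ∈ {M | ∃ a b c, M = isoVec a b c}, ∀ Y ∈ {M | ∃ a b c, M = isoVec a b c},
    ∀ Z ∈ {M | ∃ a b c, M = isoVec a b c},
      metricOnIso A (isoPart (X * Y - Y * X)) Z = -metricOnIso A (isoPart (X * Z - Z * X)) Y

/-! ### The complex projective plane and its twistor space -/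

/-- The complex projective plane, embedded in the Hermitian matrices: a line in `ℂ³` is recorded
by the orthogonal projection onto it. -/
def projectivePlane : Set Mat := {P | Pᴴ = P ∧ P * P = P ∧ P.trace = 1}

/-- The Euclidean scalar product on matrices. On the tangent spaces of the projective plane it is
the Fubini-Study metric (with holomorphic sectional curvature `4`). -/
def fsMetric (X Y : Mat) : ℝ := (1 / 2) * (Xᴴ * Y).trace.re

/-- The Hermitian part `X ↦ (X + Xᴴ) / 2`. -/
def hermPart : Mat →L[ℝ] Mat :=
  (1 / 2 : ℝ) • (ContinuousLinearMap.id ℝ Mat +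
    LinearMap.toContinuousLinearMap
      (Matrix.conjTransposeLinearEquiv (Fin 3) (Fin 3) ℝ ℂ).toLinearMap)

/-- The orthogonal projection of the space of matrices onto the tangent space of the projective
plane at `P` (see `mem_tangentSpace_projectivePlane`, `tanProj_mem`, `tanProj_of_mem`,
`fsMetric_tanProj`): `X ↦ P H + H P - 2 P H P`, where `H` is the Hermitian part of `X`. -/
def tanProj (P : Mat) : Mat →L[ℝ] Mat :=
  (ContinuousLinearMap.mulLeftRight ℝ Mat P 1 + ContinuousLinearMap.mulLeftRight ℝ Mat 1 P
    - (2 : ℝ) • ContinuousLinearMap.mulLeftRight ℝ Mat P P).comp hermPart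

theorem hermPart_apply (X : Mat) : hermPart X = (1 / 2 : ℝ) • (X + Xᴴ) := rfl

theorem tanProj_apply (P X : Mat) :
    tanProj P X = P * hermPart X + hermPart X * P - (2 : ℝ) • (P * hermPart X * P) := by
  simp [tanProj]

theorem hermPart_isHermitian (X : Mat) : (hermPart X)ᴴ = hermPart X := by
  simp [hermPart_apply, Matrix.conjTranspose_smul, add_comm]

/-- The tangent space of the projective plane at `P` consists of the Hermitian matrices `X` with
`X P + P X = X`. -/
theorem mem_tangentSpace_projectivePlane {P : Mat} (hP : P ∈ projectivePlane) (X : Mat) :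
    X ∈ tangentSpace projectivePlane P ↔ Xᴴ = X ∧ X * P + P * X = X := by
  obtain ⟨hP1, hP2, hP3⟩ := hP
  constructor
  · intro hX
    induction hX using Submodule.span_induction with
    | mem v hv =>
      obtain ⟨γ, hγ, hS, h0, hd⟩ := hv
      have hdiff : HasDerivAt γ v 0 := by
        rw [← hd]; exact (hγ.differentiable (by simp) 0).hasDerivAt
      constructor
      · have h1 := ((LinearMap.toContinuousLinearMap
          (Matrix.conjTransposeLinearEquiv (Fin 3) (Fin 3) ℝ ℂ).toLinearMap).hasFDerivAt
            (x := γ 0)).comp_hasDerivAt 0 hdiff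
        have h2 : (fun t => (γ t)ᴴ) = γ := funext fun t => (hS t).1
        have h3 : HasDerivAt (fun t => (γ t)ᴴ) vᴴ 0 := h1
        rw [h2] at h3
        exact h3.unique hdiff
      · have h1 := hdiff.mul hdiff
        have h2 : (γ * γ) = γ := funext fun t => (hS t).2.1
        rw [h2, h0] at h1
        exact h1.unique hdiff
    | zero => simp
    | add x y _ _ hx hy =>
      refine ⟨by rw [Matrix.conjTranspose_add, hx.1, hy.1], ?_⟩
      nth_rewrite 3 [← hx.2]; nth_rewrite 3 [← hy.2]
      noncomm_ring
    | smul c x _ hx =>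
      refine ⟨by rw [Matrix.conjTranspose_smul, hx.1]; simp, ?_⟩
      rw [smul_mul_assoc, mul_smul_comm, ← smul_add, hx.2]
  · rintro ⟨hX1, hX2⟩
    have hPXP : P * X * P = 0 := by
      have h := congrArg (P * ·) hX2
      simp only [mul_add, ← mul_assoc, hP2] at h
      simpa using h
    set A : Mat := X * P - P * X with hA
    have hAs : Aᴴ = -A := by
      simp [hA, Matrix.conjTranspose_mul, hX1, hP1]
    refine Submodule.subset_span ⟨fun t => NormedSpace.exp (t • A) * P * NormedSpace.exp ((-t) • A),
      ?_, ?_, ?_, ?_⟩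
    · have h : ContDiff ℝ ∞ (NormedSpace.exp : Mat → Mat) :=
        contDiff_iff_contDiffAt.2 fun x => (NormedSpace.exp_analytic (𝕂 := ℝ) x).contDiffAt
      fun_prop
    · intro t
      have hi : NormedSpace.exp ((-t) • A) * NormedSpace.exp (t • A) = 1 := by
        have h := NormedSpace.exp_add_of_commute (𝔸 := Mat)
          (((Commute.refl A).smul_left (-t)).smul_right t)
        rw [← h]
        simp
      have hs : ∀ t : ℝ, (NormedSpace.exp (t • A))ᴴ = NormedSpace.exp ((-t) • A) := by
        intro t
        refine (Matrix.exp_conjTranspose (t • A)).symm.trans ?_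
        rw [Matrix.conjTranspose_smul, hAs, star_trivial, smul_neg, neg_smul]
        rfl
      refine ⟨?_, ?_, ?_⟩
      · simp only [Matrix.conjTranspose_mul, hs, hP1, neg_neg, mul_assoc]
      · calc _ = NormedSpace.exp (t • A) * P * (NormedSpace.exp ((-t) • A) * NormedSpace.exp (t • A))
              * P * NormedSpace.exp ((-t) • A) := by noncomm_ring
          _ = _ := by rw [hi, mul_one, mul_assoc _ P P, hP2]
      · rw [Matrix.trace_mul_comm, ← mul_assoc, hi, one_mul, hP3]
    · simp
    · have h1 : HasDerivAt (fun t : ℝ => NormedSpace.exp (t • A)) A 0 := by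
        simpa using hasDerivAt_exp_smul_const (𝕂 := ℝ) A (0 : ℝ)
      have h2 : HasDerivAt (fun t : ℝ => NormedSpace.exp ((-t) • A)) (-A) 0 := by
        have := hasDerivAt_exp_smul_const (𝕂 := ℝ) (-A) (0 : ℝ)
        simpa using this
      have h3 := (h1.mul_const P).mul h2
      refine h3.deriv.trans ?_
      simp only [zero_smul, neg_zero, NormedSpace.exp_zero, mul_one, one_mul, hA]
      calc _ = X * (P * P) + (P * P) * X - (2 : ℤ) • (P * X * P) := by noncomm_ring
        _ = X := by rw [hP2, hPXP, smul_zero, sub_zero, hX2]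

theorem tanProj_mem {P : Mat} (hP : P ∈ projectivePlane) (X : Mat) :
    tanProj P X ∈ tangentSpace projectivePlane P := by
  rw [mem_tangentSpace_projectivePlane hP, tanProj_apply]
  have hH := hermPart_isHermitian X
  set H := hermPart X
  obtain ⟨hP1, hP2, -⟩ := hP
  constructor
  · simp only [Matrix.conjTranspose_sub, Matrix.conjTranspose_add, Matrix.conjTranspose_mul,
      Matrix.conjTranspose_smul, hH, hP1, star_trivial, mul_assoc]
    abel
  · have h1 : P * (P * H) = P * H := by rw [← mul_assoc, hP2]
    have h2 : P * (P * (H * P)) = P * (H * P) := by rw [← mul_assoc, hP2]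
    simp only [mul_add, add_mul, mul_sub, sub_mul, mul_assoc, hP2, h1, h2, two_smul]
    abel

theorem tanProj_of_mem {P : Mat} (hP : P ∈ projectivePlane) {X : Mat}
    (hX : X ∈ tangentSpace projectivePlane P) : tanProj P X = X := by
  rw [mem_tangentSpace_projectivePlane hP] at hX
  obtain ⟨hX1, hX2⟩ := hX
  have hPXP : P * X * P = 0 := by
    have h := congrArg (P * ·) hX2
    simp only [mul_add, ← mul_assoc, hP.2.1] at h
    simpa using h
  have hH : hermPart X = X := by
    rw [hermPart_apply, hX1, ← two_smul ℝ X, smul_smul]; norm_num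
  rw [tanProj_apply, hH, hPXP, smul_zero, sub_zero, add_comm, hX2]

/-- `tanProj P` is self-adjoint, hence it is the orthogonal projection onto its range. -/
theorem fsMetric_tanProj {P : Mat} (hP : P ∈ projectivePlane) (X Y : Mat) :
    fsMetric (tanProj P X) Y = fsMetric X (tanProj P Y) := by
  have key : ∀ A B : Mat, (Aᴴ * hermPart B).trace.re = ((hermPart A)ᴴ * hermPart B).trace.re := by
    intro A B
    have h : ((Aᴴ)ᴴ * hermPart B).trace.re = (Aᴴ * hermPart B).trace.re := by
      have := congrArg Complex.re (Matrix.trace_conjTranspose (Aᴴ * hermPart B))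
      rw [Matrix.conjTranspose_mul, hermPart_isHermitian, Matrix.trace_mul_comm] at this
      simpa using this
    rw [hermPart_apply A]
    simp only [Matrix.conjTranspose_smul, Matrix.conjTranspose_add, star_trivial, smul_mul_assoc,
      add_mul, Matrix.trace_smul, Matrix.trace_add, Complex.smul_re, Complex.add_re, h]
    simp; try ring
  have key2 : ∀ A B : Mat, Aᴴ = A → Bᴴ = B → fsMetric (P * A + A * P - (2 : ℝ) • (P * A * P)) B
      = fsMetric A (P * B + B * P - (2 : ℝ) • (P * B * P)) := by
    intro A B hA hB
    have e1 : (P * (A * B)).trace = (A * (B * P)).trace := by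
      rw [Matrix.trace_mul_comm, mul_assoc]
    have e2 : (P * (A * (P * B))).trace = (A * (P * (B * P))).trace := by
      rw [Matrix.trace_mul_comm]; simp only [mul_assoc]
    simp only [fsMetric, Matrix.conjTranspose_sub, Matrix.conjTranspose_add,
      Matrix.conjTranspose_mul, Matrix.conjTranspose_smul, hA, hP.1, star_trivial, mul_assoc,
      add_mul, sub_mul, mul_add, mul_sub, smul_mul_assoc, mul_smul_comm, Matrix.trace_add,
      Matrix.trace_sub, Matrix.trace_smul, e1, e2]
  have key3 : ∀ A B : Mat, fsMetric A B = fsMetric B A := by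
    intro A B
    have := congrArg Complex.re (Matrix.trace_conjTranspose (Aᴴ * B))
    simp only [Matrix.conjTranspose_mul, Matrix.conjTranspose_conjTranspose] at this
    simp [fsMetric, this]
  have key4 : ∀ A B : Mat, Bᴴ = B → fsMetric A B = fsMetric (hermPart A) B := by
    intro A B hB
    have h : hermPart B = B := by
      rw [hermPart_apply, hB, ← two_smul ℝ B, smul_smul]; norm_num
    have := key A B
    rw [h] at this
    simp [fsMetric, this]
  have hT : ∀ A, (tanProj P A)ᴴ = tanProj P A := fun A =>
    ((mem_tangentSpace_projectivePlane hP _).1 (tanProj_mem hP A)).1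
  rw [key3, key4 Y _ (hT X), key4 X _ (hT Y), key3, tanProj_apply, tanProj_apply,
    key2 _ _ (hermPart_isHermitian X) (hermPart_isHermitian Y)]

theorem fsMetric_comm (A B : Mat) : fsMetric A B = fsMetric B A := by
  have := congrArg Complex.re (Matrix.trace_conjTranspose (Aᴴ * B))
  simp only [Matrix.conjTranspose_mul, Matrix.conjTranspose_conjTranspose] at this
  simp [fsMetric, this]

theorem contDiff_tanProj : ContDiff ℝ ∞ tanProj := by
  unfold tanProj
  fun_prop

/-- Two smooth functions which agree on `S` have the same derivatives along `S`. -/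
theorem fderiv_eq_of_eqOn {V W : Type*} [NormedAddCommGroup V] [NormedSpace ℝ V]
    [NormedAddCommGroup W] [NormedSpace ℝ W] {S : Set V} {f g : V → W} {p v : V}
    (hf : DifferentiableAt ℝ f p) (hg : DifferentiableAt ℝ g p) (h : Set.EqOn f g S)
    (hv : v ∈ tangentSpace S p) : fderiv ℝ f p v = fderiv ℝ g p v := by
  induction hv using Submodule.span_induction with
  | mem v hv =>
    obtain ⟨γ, hγ, hS, h0, hd⟩ := hv
    have hdiff : HasDerivAt γ v 0 := by
      rw [← hd]; exact (hγ.differentiable (by simp) 0).hasDerivAt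
    subst h0
    have h1 := hf.hasFDerivAt.comp_hasDerivAt 0 hdiff
    have h2 := hg.hasFDerivAt.comp_hasDerivAt 0 hdiff
    have h3 : f ∘ γ = g ∘ γ := funext fun t => h (hS t)
    rw [h3] at h1
    exact h1.unique h2
  | zero => simp
  | add x y _ _ hx hy => simp [hx, hy]
  | smul c x _ hx => simp [hx]

/-- The Levi-Civita connection of the Fubini-Study metric is the tangential part of the derivative
in the ambient Euclidean space. -/
theorem isLeviCivita_projectivePlane (g : Mat → Mat →L[ℝ] Mat →L[ℝ] ℝ)
    (hg : ∀ P X Y, g P X Y = fsMetric X Y) :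
    IsLeviCivita projectivePlane g (fun X Y P => tanProj P (fderiv ℝ Y P (X P))) := by
  have hd : ∀ {X : Mat → Mat}, IsVectorField projectivePlane X → ∀ P, DifferentiableAt ℝ X P :=
    fun hX P => (hX.1.differentiable (by simp)) P
  refine ⟨?_, ?_, ?_, ?_, ?_, ?_, ?_⟩
  · intro X Y hX hY
    refine ⟨?_, fun P hP => tanProj_mem hP _⟩
    have h1 := hX.1
    have h2 : ContDiff ℝ ∞ (fderiv ℝ Y) := hY.1.fderiv_right (by simp)
    have h3 := contDiff_tanProj
    fun_prop
  · intro X X' Y _ _ _ P _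
    simp
  · intro f X Y _ _ _ P _
    simp
  · intro X Y Y' _ hY hY' P _
    simp [fderiv_add (hd hY P) (hd hY' P)]
  · intro f X Y hf hX hY P hP
    have hf' : DifferentiableAt ℝ f P := hf.differentiable (by simp) P
    simp [fderiv_fun_smul hf' (hd hY P), tanProj_of_mem hP (hY.2 P hP)]
  · intro X Y hX hY P hP
    rw [← map_sub]
    refine tanProj_of_mem hP ?_
    rw [mem_tangentSpace_projectivePlane hP]
    have hs : ∀ X Y : Mat → Mat, IsVectorField projectivePlane X → IsVectorField projectivePlane Y →
        (fderiv ℝ Y P (X P))ᴴ = fderiv ℝ Y P (X P) := by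
      intro X Y hX hY
      have h := fderiv_eq_of_eqOn (f := fun Q => hermPart (Y Q)) (g := Y) (p := P)
        (hermPart.differentiableAt.comp P (hd hY P)) (hd hY P)
        (fun Q hQ => by
          have := ((mem_tangentSpace_projectivePlane hQ _).1 (hY.2 Q hQ)).1
          simp only [hermPart_apply, this]
          rw [← two_smul ℝ (Y Q), smul_smul]; norm_num) (hX.2 P hP)
      have h2 : fderiv ℝ (fun Q => hermPart (Y Q)) P = hermPart.comp (fderiv ℝ Y P) :=
        (hermPart.hasFDerivAt.comp P (hd hY P).hasFDerivAt).fderiv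
      rw [h2] at h
      rw [← h]
      exact hermPart_isHermitian _
    have hl : ∀ X Y : Mat → Mat, IsVectorField projectivePlane X → IsVectorField projectivePlane Y →
        fderiv ℝ Y P (X P) * P + Y P * X P + (P * fderiv ℝ Y P (X P) + X P * Y P)
          = fderiv ℝ Y P (X P) := by
      intro X Y hX hY
      have hYd := hd hY P
      have h := fderiv_eq_of_eqOn (f := fun Q => Y Q * Q + Q * Y Q) (g := Y) (p := P)
        (by fun_prop) hYd
        (fun Q hQ => ((mem_tangentSpace_projectivePlane hQ _).1 (hY.2 Q hQ)).2) (hX.2 P hP)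
      have h2 := ((hYd.hasFDerivAt.mul' (hasFDerivAt_id P)).add
        ((hasFDerivAt_id P).mul' hYd.hasFDerivAt)).fderiv
      have h3 := congrArg (fun L : Mat →L[ℝ] Mat => L (X P)) h2
      refine Eq.trans ?_ h
      refine Eq.trans ?_ h3.symm
      simp
      abel
    refine ⟨?_, ?_⟩
    · rw [Matrix.conjTranspose_sub, hs X Y hX hY, hs Y X hY hX]
    · nth_rewrite 3 [← hl X Y hX hY]
      nth_rewrite 3 [← hl Y X hY hX]
      noncomm_ring
  · intro X Y Z hX hY hZ P hP
    have hgc : g = fun _ => g 0 := by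
      funext Q; ext A B; rw [hg, hg]
    rw [hg, hg, fsMetric_tanProj hP, fsMetric_comm (Y P), fsMetric_tanProj hP,
      tanProj_of_mem hP (hY.2 P hP), tanProj_of_mem hP (hZ.2 P hP), fsMetric_comm _ (Y P),
      ← hg 0, ← hg 0, hgc]
    have h := ((g 0).hasFDerivAt_of_bilinear (hd hY P).hasFDerivAt (hd hZ P).hasFDerivAt).fderiv
    rw [h]
    simp [add_comm]

/-- The complex structure of the tangent space `Hom(ℓ, ℓ^⊥)` of the projective plane at the
line `ℓ = im P`. -/
def fsComplex (P X : Mat) : Mat := Complex.I • (X * P - P * X)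

/-- The Kähler form `ω(X, Y) = h(I X, Y)` of the projective plane. -/
def fsForm (P X Y : Mat) : ℝ := fsMetric (fsComplex P X) Y

/-- The volume form `(1/2) ω ∧ ω` of the projective plane, which gives its orientation as a
complex surface. -/
def fsVolume (P X₁ X₂ X₃ X₄ : Mat) : ℝ :=
  fsForm P X₁ X₂ * fsForm P X₃ X₄ - fsForm P X₁ X₃ * fsForm P X₂ X₄
    + fsForm P X₁ X₄ * fsForm P X₂ X₃

/-- The twistor space of the projective plane with its Fubini-Study metric: pairs `(P, j)` where
`P` is a point and `j` is a complex structure on the tangent space at `P` which is orthogonal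
and reverses the orientation (so that the plane is self-dual for its complex orientation). Here
`j` is extended by zero to the orthogonal complement of the tangent space. -/
def twistorSpace : Set (Mat × (Mat →L[ℝ] Mat)) :=
  {z | z.1 ∈ projectivePlane ∧
    (∀ X, z.2 (tanProj z.1 X) = z.2 X) ∧
    (∀ X ∈ tangentSpace projectivePlane z.1, z.2 X ∈ tangentSpace projectivePlane z.1) ∧
    (∀ X ∈ tangentSpace projectivePlane z.1, z.2 (z.2 X) = -X) ∧
    (∀ X ∈ tangentSpace projectivePlane z.1, ∀ Y ∈ tangentSpace projectivePlane z.1,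
      fsMetric (z.2 X) (z.2 Y) = fsMetric X Y) ∧
    (∀ X ∈ tangentSpace projectivePlane z.1, ∀ Y ∈ tangentSpace projectivePlane z.1,
      LinearIndependent ℝ ![X, z.2 X, Y, z.2 Y] → fsVolume z.1 X (z.2 X) Y (z.2 Y) < 0)}

/-- The vertical part of a vector `ζ = (Ṗ, j̇)` tangent to the twistor space at `z = (P, j)`: the
covariant derivative of `j` in the direction `ζ` for the Levi-Civita connection of the projective
plane. This connection is the tangential part of the derivative in the ambient Euclidean space
(see `isLeviCivita_projectivePlane`), so
the covariant derivative is the endomorphism `X ↦ (j̇ X)^tan` of the tangent space (extended by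
zero). The horizontal vectors are those with vertical part zero. -/
def vertPart (z ζ : Mat × (Mat →L[ℝ] Mat)) : Mat →L[ℝ] Mat :=
  (tanProj z.1).comp (ζ.2.comp (tanProj z.1))

/-- The twistor metric with parameter `t`: the pullback `h(π_* ζ, π_* ξ)` of the Fubini-Study metric
plus `t` times the metric `-(1/16) tr (A B)` on vertical vectors, which are skew-symmetric
endomorphisms `A`, `B` of the tangent space of the plane. -/
def twistorMetric (t : ℝ) (z ζ ξ : Mat × (Mat →L[ℝ] Mat)) : ℝ :=
  fsMetric ζ.1 ξ.1 + t * (-(1 / 16) *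
    LinearMap.trace ℝ Mat ((vertPart z ζ).comp (vertPart z ξ)).toLinearMap)

/-- `ζ' = J₋ ζ` for the (non-integrable) almost complex structure `J₋` of the twistor space at
`z = (P, j)`: it lifts `j` on horizontal vectors, and it is `A ↦ -j ∘ A` on vertical vectors. -/
def IsTwistorJMinus (z ζ ζ' : Mat × (Mat →L[ℝ] Mat)) : Prop :=
  ζ'.1 = z.2 ζ.1 ∧ vertPart z ζ' = -(z.2.comp (vertPart z ζ))

/-! ### The three twistor fibrations of the flag manifold -/

/-- The identification of the flag manifold with the twistor space over the projection
`π_a : P ↦ ℂ u_a`. The tangent space at `ℂ u_a` is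
`Hom(ℂ u_a, ℂ u_{a+1}) ⊕ Hom(ℂ u_a, ℂ u_{a+2})` (indices modulo `3`), and the
complex structure `j` is multiplication by `i` on the first summand and by `-i` on the second. In
terms of Hermitian matrices `X`, with `P_b X P_a` the component in `Hom(ℂ u_a, ℂ u_b)`, this is
`j X = i P_{a+1} X P_a - i P_a X P_{a+1} - i P_{a+2} X P_a + i P_a X P_{a+2}`, extended by zero
to the orthogonal complement of the tangent space. -/
def twistorMap (a : Fin 3) (P : Triple) : Mat × (Mat →L[ℝ] Mat) :=
  (P a,
    (ContinuousLinearMap.mulLeftRight ℝ Mat (Complex.I • P (a + 1)) (P a)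
      - ContinuousLinearMap.mulLeftRight ℝ Mat (Complex.I • P a) (P (a + 1))
      - ContinuousLinearMap.mulLeftRight ℝ Mat (Complex.I • P (a + 2)) (P a)
      + ContinuousLinearMap.mulLeftRight ℝ Mat (Complex.I • P a) (P (a + 2))).comp hermPart)

/-- `A = (g, J)` is the almost Hermitian structure of the flag manifold obtained from the structure
`(g_t, J₋)` of the twistor space by pullback along `twistorMap a`. -/
def IsTwistorStructure (a : Fin 3) (t : ℝ) (A : AlmostHermitian flagManifold) : Prop :=
  ∀ P ∈ flagManifold, ∀ X ∈ tangentSpace flagManifold P,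
    (∀ Y ∈ tangentSpace flagManifold P, A.g P X Y =
      twistorMetric t (twistorMap a P)
        (fderiv ℝ (twistorMap a) P X) (fderiv ℝ (twistorMap a) P Y)) ∧
    IsTwistorJMinus (twistorMap a P)
      (fderiv ℝ (twistorMap a) P X) (fderiv ℝ (twistorMap a) P (A.J P X))

end NearlyKaehler

end

noncomputable section

namespace NearlyKaehler

/-! ### The action of the unitary group on flags -/

/-! A flag is stored as its three orthogonal projections, so the flag manifold is a single
`U(3)`-orbit in a vector space and all constructions commute with `conjAct`. Pointwise claims thus
reduce to the standard flag, where the tangent vectors are the `isoTan a b c`.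

Invariant structures: the diagonal torus acts on the three coordinates of 𝔪 by pairwise inequivalent
characters. Hence an invariant metric is diagonal with weights r, s, t, and an invariant J
multiplies each coordinate by i or -i, with signs e (`exists_isoForm`, `exists_signs`). The metric
is the restriction of the constant form `gform lam`, where lam 0 + lam 1 = r, lam 0 + lam 2 = s, lam
1 + lam 2 = t. Its Levi-Civita connection is therefore the ambient derivative followed by the
`gform`-orthogonal projection (`isLeviCivita_levi`, `IsLeviCivita.unique`), and ∇J comes from
differentiating the explicit extension `tanOp` of J (`tri_dtanOp`). Put κ₀ = lam 0 (e 0 + e 1), κ₁ =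
lam 1 (e 0 + e 2), κ₂ = lam 2 (e 1 + e 2). Nearly Kähler means κ₀ = κ₁ = κ₂; Kähler means that all
three vanish. With mixed signs two of them vanish, so nearly Kähler already gives Kähler; with equal
signs the condition says that lam is constant, that is r = s = t. Natural reductivity is read off
from one bracket formula.

Twistor fibrations: j = iK, where K = P (a+1) - P (a+2) is a trace-free Hermitian involution of the
orthogonal complement of the line. The vertical part of the derivative of `twistorMap a` is given by
the skew-Hermitian matrix `vertMat`. A trace computation turns the pullback of g_t into weight 1 on
the two summands containing the index a and t on the third (`twistorMetric_eq_gform`), while J₋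
pulls back to multiplication by i for every a and t (`flagNK_isTwistorJMinus`). So nearly Kähler
forces 1 - t/2 = t/2.

Bijectivity: P a and K determine the flag. Conversely, an orthogonal complex structure of ℂ² that
reverses orientation is i times a trace-free Hermitian involution
(`exists_of_orientation_reversing`), whose eigenlines complete the given line to a flag. -/

theorem unitary_star_mul {u : Mat} (hu : u ∈ Matrix.unitaryGroup (Fin 3) ℂ) : uᴴ * u = 1 :=
  Matrix.mem_unitaryGroup_iff'.1 hu

theorem unitary_mul_star {u : Mat} (hu : u ∈ Matrix.unitaryGroup (Fin 3) ℂ) : u * uᴴ = 1 :=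
  Matrix.mem_unitaryGroup_iff.1 hu

theorem unitary_conjTranspose_mem {u : Mat} (hu : u ∈ Matrix.unitaryGroup (Fin 3) ℂ) :
    uᴴ ∈ Matrix.unitaryGroup (Fin 3) ℂ :=
  Matrix.mem_unitaryGroup_iff.2 (by
    rw [Matrix.star_eq_conjTranspose, Matrix.conjTranspose_conjTranspose]
    exact unitary_star_mul hu)

/-- Conjugation by a matrix, as a linear map on matrices. -/
def conj (u : Mat) : Mat →ₗ[ℝ] Mat where
  toFun X := u * X * uᴴ
  map_add' X Y := by rw [mul_add, add_mul]
  map_smul' c X := by simp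

theorem conj_apply (u X : Mat) : conj u X = u * X * uᴴ := rfl

theorem conj_smul (u : Mat) (c : ℂ) (X : Mat) : conj u (c • X) = c • conj u X := by
  simp [conj_apply]

theorem conj_mul {u : Mat} (hu : u ∈ Matrix.unitaryGroup (Fin 3) ℂ) (X Y : Mat) :
    conj u (X * Y) = conj u X * conj u Y := by
  simp only [conj_apply]
  calc _ = u * X * 1 * Y * uᴴ := by noncomm_ring
    _ = _ := by rw [← unitary_star_mul hu]; noncomm_ring

theorem conj_one {u : Mat} (hu : u ∈ Matrix.unitaryGroup (Fin 3) ℂ) : conj u 1 = 1 := by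
  rw [conj_apply, mul_one, unitary_mul_star hu]

theorem conj_conjTranspose (u X : Mat) : conj u Xᴴ = (conj u X)ᴴ := by
  simp [conj_apply, Matrix.conjTranspose_mul, mul_assoc]

theorem trace_conj {u : Mat} (hu : u ∈ Matrix.unitaryGroup (Fin 3) ℂ) (X : Mat) :
    (conj u X).trace = X.trace := by
  rw [conj_apply, Matrix.trace_mul_comm, ← mul_assoc, unitary_star_mul hu, one_mul]

theorem hermPart_conj (u X : Mat) : hermPart (conj u X) = conj u (hermPart X) := by
  rw [hermPart_apply, hermPart_apply, map_smul, map_add, conj_conjTranspose]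

theorem fsMetric_conj {u : Mat} (hu : u ∈ Matrix.unitaryGroup (Fin 3) ℂ) (X Y : Mat) :
    fsMetric (conj u X) (conj u Y) = fsMetric X Y := by
  rw [fsMetric, fsMetric, ← conj_conjTranspose, ← conj_mul hu, trace_conj hu]

/-- `conjAct u` as a linear map. -/
def conjActLin (u : Mat) : Triple →L[ℝ] Triple :=
  LinearMap.toContinuousLinearMap (LinearMap.pi fun k => (conj u).comp (LinearMap.proj k))

theorem conjActLin_apply (u : Mat) (X : Triple) : conjActLin u X = conjAct u X := rfl

theorem conjAct_apply (u : Mat) (X : Triple) (k : Fin 3) : conjAct u X k = conj u (X k) := rfl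

theorem conjAct_conjAct (u v : Mat) (X : Triple) :
    conjAct u (conjAct v X) = conjAct (u * v) X := by
  funext k
  simp [conjAct, Matrix.conjTranspose_mul, mul_assoc]

theorem conjAct_one (X : Triple) : conjAct 1 X = X := by
  funext k; simp [conjAct]

theorem conjAct_conjTranspose_conjAct {u : Mat} (hu : u ∈ Matrix.unitaryGroup (Fin 3) ℂ)
    (X : Triple) : conjAct uᴴ (conjAct u X) = X := by
  rw [conjAct_conjAct, unitary_star_mul hu, conjAct_one]

theorem conjAct_conjAct_conjTranspose {u : Mat} (hu : u ∈ Matrix.unitaryGroup (Fin 3) ℂ)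
    (X : Triple) : conjAct u (conjAct uᴴ X) = X := by
  rw [conjAct_conjAct, unitary_mul_star hu, conjAct_one]

theorem conjAct_mem_flagManifold {u : Mat} (hu : u ∈ Matrix.unitaryGroup (Fin 3) ℂ) {P : Triple}
    (hP : P ∈ flagManifold) : conjAct u P ∈ flagManifold := by
  obtain ⟨v, hv, rfl⟩ := hP
  exact ⟨u * v, mul_mem hu hv, conjAct_conjAct u v _⟩

theorem baseFlag_mem : baseFlag ∈ flagManifold := ⟨1, one_mem _, (conjAct_one _).symm⟩

theorem conjAct_baseFlag_mem {u : Mat} (hu : u ∈ Matrix.unitaryGroup (Fin 3) ℂ) :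
    conjAct u baseFlag ∈ flagManifold := ⟨u, hu, rfl⟩

theorem baseFlag_mul (k l : Fin 3) :
    baseFlag k * baseFlag l = if k = l then baseFlag k else 0 := by
  split_ifs with h
  · subst h; simp [baseFlag]
  · simp [baseFlag, h]

theorem mul_baseFlag_apply (A : Mat) (k i j : Fin 3) :
    (A * baseFlag k) i j = if j = k then A i k else 0 := by
  split_ifs with h
  · subst h; simp [baseFlag]
  · simp [baseFlag, h]

theorem baseFlag_mul_apply (A : Mat) (k i j : Fin 3) :
    (baseFlag k * A) i j = if i = k then A k j else 0 := by
  split_ifs with h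
  · subst h; simp [baseFlag]
  · simp [baseFlag, h]

theorem triple_ext {X Y : Triple} (h0 : X 0 = Y 0) (h1 : X 1 = Y 1) (h2 : X 2 = Y 2) : X = Y := by
  funext k
  revert k
  simp [Fin.forall_fin_succ, h0, h1, h2]

theorem flag_isHermitian {P : Triple} (hP : P ∈ flagManifold) (k : Fin 3) : (P k)ᴴ = P k := by
  obtain ⟨u, -, rfl⟩ := hP
  rw [conjAct_apply, ← conj_conjTranspose]
  simp [baseFlag]

theorem flag_mul {P : Triple} (hP : P ∈ flagManifold) (k l : Fin 3) :
    P k * P l = if k = l then P k else 0 := by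
  obtain ⟨u, hu, rfl⟩ := hP
  rw [conjAct_apply, conjAct_apply, ← conj_mul hu, baseFlag_mul]
  split_ifs <;> simp

theorem flag_trace {P : Triple} (hP : P ∈ flagManifold) (k : Fin 3) : (P k).trace = 1 := by
  obtain ⟨u, hu, rfl⟩ := hP
  rw [conjAct_apply, trace_conj hu]
  simp [baseFlag]

theorem flag_mem_projectivePlane {P : Triple} (hP : P ∈ flagManifold) (k : Fin 3) :
    P k ∈ projectivePlane :=
  ⟨flag_isHermitian hP k, by rw [flag_mul hP, if_pos rfl], flag_trace hP k⟩

theorem flag_sum {P : Triple} (hP : P ∈ flagManifold) : P 0 + P 1 + P 2 = 1 := by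
  obtain ⟨u, hu, rfl⟩ := hP
  simp only [conjAct_apply, ← map_add]
  rw [← conj_one hu]
  congr 1
  ext i j
  fin_cases i <;> fin_cases j <;> simp [baseFlag]

/-! ### Tangent vectors of the flag manifold -/

/-- `conjAct u` is linear and preserves the flag manifold, so it maps curves to curves and
velocities to velocities. -/
theorem conjAct_mem_tangentSpace {u : Mat} (hu : u ∈ Matrix.unitaryGroup (Fin 3) ℂ) {P X : Triple}
    (hX : X ∈ tangentSpace flagManifold P) :
    conjAct u X ∈ tangentSpace flagManifold (conjAct u P) := by
  induction hX using Submodule.span_induction with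
  | mem v hv =>
    obtain ⟨γ, hγ, hS, h0, hd⟩ := hv
    refine Submodule.subset_span ⟨fun t => conjActLin u (γ t), (conjActLin u).contDiff.comp hγ,
      fun t => conjAct_mem_flagManifold hu (hS t), by simp only [h0, conjActLin_apply], ?_⟩
    have hdiff : HasDerivAt γ v 0 := by
      rw [← hd]; exact (hγ.differentiable (by simp) 0).hasDerivAt
    exact ((conjActLin u).hasFDerivAt.comp_hasDerivAt 0 hdiff).deriv
  | zero => rw [← conjActLin_apply u 0, map_zero]; exact zero_mem _
  | add x y _ _ hx hy => rw [← conjActLin_apply u (x + y), map_add]; exact add_mem hx hy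
  | smul c x _ hx =>
    rw [← conjActLin_apply u (c • x), map_smul]; exact Submodule.smul_mem _ _ hx

/-- Differentiate the identities Pₖ* = Pₖ and Pₖ Pₗ = δₖₗ Pₖ along a curve. The results are linear
in the velocity, hence pass to the span. -/
theorem tangentSpace_flag_equations {P X : Triple} (hX : X ∈ tangentSpace flagManifold P) :
    (∀ k, (X k)ᴴ = X k) ∧ ∀ k l, X k * P l + P k * X l = if k = l then X k else 0 := by
  induction hX using Submodule.span_induction with
  | mem v hv =>
    obtain ⟨γ, hγ, hS, h0, hd⟩ := hv
    have hdiff : HasDerivAt γ v 0 := by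
      rw [← hd]; exact (hγ.differentiable (by simp) 0).hasDerivAt
    have hk : ∀ k, HasDerivAt (fun t => γ t k) (v k) 0 := hasDerivAt_pi.1 hdiff
    constructor
    · intro k
      have h1 := ((LinearMap.toContinuousLinearMap
          (Matrix.conjTransposeLinearEquiv (Fin 3) (Fin 3) ℝ ℂ).toLinearMap).hasFDerivAt
            (x := γ 0 k)).comp_hasDerivAt 0 (hk k)
      have h3 : HasDerivAt (fun t => (γ t k)ᴴ) (v k)ᴴ 0 := h1
      simp only [flag_isHermitian (hS _)] at h3
      exact h3.unique (hk k)
    · intro k l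
      have h1 := (hk k).mul (hk l)
      have h2 : (fun t => γ t k) * (fun t => γ t l) = fun t => if k = l then γ t k else 0 :=
        funext fun t => flag_mul (hS t) k l
      rw [h2, h0] at h1
      refine h1.unique ?_
      split_ifs
      · exact hk k
      · exact hasDerivAt_const _ _
  | zero => simp
  | add x y _ _ hx hy =>
    refine ⟨fun k => by simp [hx.1, hy.1], fun k l => ?_⟩
    have h := congrArg₂ (· + ·) (hx.2 k l) (hy.2 k l)
    simp only [Pi.add_apply, add_mul, mul_add]
    refine Eq.trans (by abel) (h.trans ?_)
    split_ifs <;> simp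
  | smul c x _ hx =>
    refine ⟨fun k => by simp [hx.1], fun k l => ?_⟩
    have h := congrArg (c • ·) (hx.2 k l)
    simp only [Pi.smul_apply, smul_mul_assoc, mul_smul_comm, ← smul_add] at h ⊢
    rw [h]
    split_ifs <;> simp

/-- `fundVec` as a linear map. -/
def fundVecLin : Mat →ₗ[ℝ] Triple where
  toFun := fundVec
  map_add' X Y := by funext k; simp [fundVec, add_mul, mul_add]; abel
  map_smul' c X := by funext k; simp [fundVec, smul_sub]

/-- The tangent vector at the standard flag which corresponds to `⟨a, b, c⟩`. -/
def isoTan (a b c : ℂ) : Triple := fundVec (isoVec a b c)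

theorem fundVec_apply (M : Mat) (k i j : Fin 3) :
    fundVec M k i j = (if j = k then M i k else 0) - (if i = k then M k j else 0) := by
  rw [fundVec, Matrix.sub_apply, mul_baseFlag_apply, baseFlag_mul_apply]

theorem isoTan_zero (a b c : ℂ) :
    isoTan a b c 0 = !![0, star a, -b; a, 0, 0; -star b, 0, 0] := by
  ext i j
  fin_cases i <;> fin_cases j <;>
    simp [isoTan, fundVec_apply, isoVec]

theorem isoTan_one (a b c : ℂ) :
    isoTan a b c 1 = !![0, -star a, 0; -a, 0, star c; 0, c, 0] := by
  ext i j
  fin_cases i <;> fin_cases j <;>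
    simp [isoTan, fundVec_apply, isoVec]

theorem isoTan_two (a b c : ℂ) :
    isoTan a b c 2 = !![0, 0, b; 0, 0, -star c; star b, -c, 0] := by
  ext i j
  fin_cases i <;> fin_cases j <;>
    simp [isoTan, fundVec_apply, isoVec]

theorem isoVec_conjTranspose (a b c : ℂ) : (isoVec a b c)ᴴ = -isoVec a b c := by
  ext i j
  fin_cases i <;> fin_cases j <;> simp [isoVec]

theorem exp_smul_mem_unitaryGroup {A : Mat} (hA : Aᴴ = -A) (t : ℝ) :
    NormedSpace.exp (t • A) ∈ Matrix.unitaryGroup (Fin 3) ℂ ∧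
      (NormedSpace.exp (t • A))ᴴ = NormedSpace.exp ((-t) • A) := by
  have hs : (NormedSpace.exp (t • A))ᴴ = NormedSpace.exp ((-t) • A) := by
    refine (Matrix.exp_conjTranspose (t • A)).symm.trans ?_
    rw [Matrix.conjTranspose_smul, hA, star_trivial, smul_neg, neg_smul]
    rfl
  refine ⟨Matrix.mem_unitaryGroup_iff'.2 ?_, hs⟩
  rw [Matrix.star_eq_conjTranspose, hs]
  have h := NormedSpace.exp_add_of_commute (𝔸 := Mat)
    (((Commute.refl A).smul_left (-t)).smul_right t)
  rw [← h]
  simp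

/-- The velocity of the orbit of the one-parameter group exp (t A), which is unitary because A is
skew-Hermitian. -/
theorem fundVec_mem_tangentSpace {A : Mat} (hA : Aᴴ = -A) :
    fundVec A ∈ tangentSpace flagManifold baseFlag := by
  refine Submodule.subset_span
    ⟨fun t k => NormedSpace.exp (t • A) * baseFlag k * NormedSpace.exp ((-t) • A), ?_, ?_, ?_, ?_⟩
  · have h : ContDiff ℝ ∞ (NormedSpace.exp : Mat → Mat) :=
      contDiff_iff_contDiffAt.2 fun x => (NormedSpace.exp_analytic (𝕂 := ℝ) x).contDiffAt
    rw [contDiff_pi]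
    intro k
    fun_prop
  · intro t
    obtain ⟨h1, h2⟩ := exp_smul_mem_unitaryGroup hA t
    refine ⟨_, h1, funext fun k => ?_⟩
    rw [conjAct_apply, conj_apply, h2]
  · funext k
    simp
  · refine HasDerivAt.deriv (hasDerivAt_pi.2 fun k => ?_)
    have h1 : HasDerivAt (fun t : ℝ => NormedSpace.exp (t • A)) A 0 := by
      simpa using hasDerivAt_exp_smul_const (𝕂 := ℝ) A (0 : ℝ)
    have h2 : HasDerivAt (fun t : ℝ => NormedSpace.exp ((-t) • A)) (-A) 0 := by
      have := hasDerivAt_exp_smul_const (𝕂 := ℝ) (-A) (0 : ℝ)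
      simpa using this
    have h3 := (h1.mul_const (baseFlag k)).mul h2
    refine h3.congr_deriv ?_
    simp only [zero_smul, neg_zero, NormedSpace.exp_zero, mul_one, one_mul, fundVec]
    noncomm_ring

theorem isoTan_mem (a b c : ℂ) : isoTan a b c ∈ tangentSpace flagManifold baseFlag :=
  fundVec_mem_tangentSpace (isoVec_conjTranspose a b c)

/-- The solutions of the tangency equations at the standard flag. -/
theorem exists_isoTan_of_equations {X : Triple} (h1 : ∀ k, (X k)ᴴ = X k)
    (h2 : ∀ k l, X k * baseFlag l + baseFlag k * X l = if k = l then X k else 0) :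
    ∃ a b c, X = isoTan a b c := by
  have hH : ∀ k i j, star (X k j i) = X k i j := fun k i j => congrFun₂ (h1 k) i j
  have hE : ∀ k l i j, (X k * baseFlag l + baseFlag k * X l) i j
      = (if k = l then X k else 0 : Mat) i j := fun k l i j => congrFun₂ (h2 k l) i j
  have hE' : ∀ k l i j, (if j = l then X k i l else 0) + (if i = k then X l k j else 0)
      = if k = l then X k i j else 0 := by
    intro k l i j
    have h := hE k l i j
    rw [Matrix.add_apply, mul_baseFlag_apply, baseFlag_mul_apply] at h
    rw [h]
    split_ifs <;> rfl
  have hd : ∀ k i j, i ≠ k → j ≠ k → X k i j = 0 := by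
    intro k i j hi hj
    simpa [hi, hj] using (hE' k k i j).symm
  have hkk : ∀ k, X k k k = 0 := by
    intro k
    simpa using hE' k k k k
  have hkl : ∀ k l, k ≠ l → X l k l = -X k k l := by
    intro k l h
    have := hE' k l k l
    simp only [if_true, if_neg h] at this
    linear_combination this
  -- For i ≠ j the entry (i, j) of the j-th component of `fundVec M` is M i j, so column j of M has
  -- to be column j of X j; `hkk` gives it zero diagonal.
  have hX : X = fundVec (Matrix.of fun i j => X j i j) := by
    funext k
    ext i j
    rw [fundVec_apply]
    simp only [Matrix.of_apply]
    rcases eq_or_ne j k with rfl | hj <;> rcases eq_or_ne i j with rfl | hi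
    · simp [hkk]
    · simp [hi]
    · simp [hj, hd _ _ _ hj hj]
    · rcases eq_or_ne i k with rfl | hk
      · simp [hj, hkl _ _ hi]
      · simp [hj, hk, hd _ _ _ hk hj]
  refine ⟨X 0 1 0, X 2 0 2, X 1 2 1, hX.trans (congrArg fundVec ?_)⟩
  have hs : ∀ i j, i ≠ j → X j i j = -star (X i j i) := by
    intro i j h
    rw [hkl i j h, hH]
  ext i j
  fin_cases i <;> fin_cases j
  · exact hkk 0
  · exact hs 0 1 (by decide)
  · rfl
  · rfl
  · exact hkk 1
  · exact hs 1 2 (by decide)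
  · exact hs 2 0 (by decide)
  · rfl
  · exact hkk 2

theorem mem_tangentSpace_baseFlag {X : Triple} :
    X ∈ tangentSpace flagManifold baseFlag ↔ ∃ a b c, X = isoTan a b c := by
  constructor
  · intro hX
    obtain ⟨h1, h2⟩ := tangentSpace_flag_equations hX
    exact exists_isoTan_of_equations h1 h2
  · rintro ⟨a, b, c, rfl⟩
    exact isoTan_mem a b c

theorem mem_tangentSpace_conjAct {u : Mat} (hu : u ∈ Matrix.unitaryGroup (Fin 3) ℂ) {X : Triple} :
    X ∈ tangentSpace flagManifold (conjAct u baseFlag) ↔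
      ∃ a b c, X = conjAct u (isoTan a b c) := by
  constructor
  · intro hX
    have h := conjAct_mem_tangentSpace (unitary_conjTranspose_mem hu) hX
    rw [conjAct_conjTranspose_conjAct hu, mem_tangentSpace_baseFlag] at h
    obtain ⟨a, b, c, h⟩ := h
    exact ⟨a, b, c, by rw [← h, conjAct_conjAct_conjTranspose hu]⟩
  · rintro ⟨a, b, c, rfl⟩
    exact conjAct_mem_tangentSpace hu (isoTan_mem a b c)

/-- The linearized equations cut out exactly the tangent space. This gives a test of tangency that
needs no curve, used below for Lie brackets. -/
theorem mem_tangentSpace_iff_equations {P X : Triple} (hP : P ∈ flagManifold) :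
    X ∈ tangentSpace flagManifold P ↔
      (∀ k, (X k)ᴴ = X k) ∧ ∀ k l, X k * P l + P k * X l = if k = l then X k else 0 := by
  refine ⟨tangentSpace_flag_equations, fun ⟨h1, h2⟩ => ?_⟩
  obtain ⟨u, hu, rfl⟩ := hP
  rw [mem_tangentSpace_conjAct hu]
  have hu' := unitary_conjTranspose_mem hu
  obtain ⟨a, b, c, h⟩ := exists_isoTan_of_equations (X := conjAct uᴴ X)
    (fun k => by rw [conjAct_apply, ← conj_conjTranspose, h1])
    (fun k l => by
      have h := congrArg (conj uᴴ) (h2 k l)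
      rw [map_add, conj_mul hu', conj_mul hu', ← conjAct_apply uᴴ (conjAct u baseFlag) l,
        ← conjAct_apply uᴴ (conjAct u baseFlag) k, conjAct_conjTranspose_conjAct hu] at h
      rw [conjAct_apply, conjAct_apply, h]
      split_ifs <;> simp)
  exact ⟨a, b, c, by rw [← h, conjAct_conjAct_conjTranspose hu]⟩

/-! ### Tangential operators -/

/-- The building block of the tangential operators, with weights `lam` and a multiplier `σ`. -/
def tri (lam : Fin 3 → ℝ) (σ : Mat) (A B T : Triple) : Mat :=
  ∑ k, ∑ l, (σ k l * ((lam k + lam l)⁻¹ : ℝ)) •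
    (A k * (lam l • hermPart (T l) - lam k • hermPart (T k)) * B l)

theorem tri_add (lam : Fin 3 → ℝ) (σ : Mat) (A B T T' : Triple) :
    tri lam σ A B (T + T') = tri lam σ A B T + tri lam σ A B T' := by
  simp only [tri, ← Finset.sum_add_distrib]
  refine Finset.sum_congr rfl fun k _ => Finset.sum_congr rfl fun l _ => ?_
  rw [← smul_add, ← add_mul, ← mul_add]
  simp only [Pi.add_apply, map_add, smul_add]
  congr 3
  abel

theorem tri_smul (lam : Fin 3 → ℝ) (σ : Mat) (A B T : Triple) (r : ℝ) :
    tri lam σ A B (r • T) = r • tri lam σ A B T := by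
  simp only [tri, Finset.smul_sum]
  refine Finset.sum_congr rfl fun k _ => Finset.sum_congr rfl fun l _ => ?_
  have h : lam l • hermPart ((r • T) l) - lam k • hermPart ((r • T) k)
      = r • (lam l • hermPart (T l) - lam k • hermPart (T k)) := by
    rw [Pi.smul_apply, Pi.smul_apply, map_smul, map_smul, smul_comm _ r, smul_comm _ r, smul_sub]
  rw [h, mul_smul_comm, smul_mul_assoc, smul_comm]

/-- Taking adjoints exchanges k and l, which reverses the sign of the difference in the middle. With
A = B the result is skew-Hermitian, as `fundVec` requires. -/
theorem tri_conjTranspose (lam : Fin 3 → ℝ) {σ : Mat} (hσ : σᴴ = σ) {A B : Triple}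
    (hA : ∀ k, (A k)ᴴ = A k) (hB : ∀ k, (B k)ᴴ = B k) (T : Triple) :
    (tri lam σ A B T)ᴴ = -tri lam σ B A T := by
  simp only [tri, Matrix.conjTranspose_sum, ← Finset.sum_neg_distrib]
  rw [Finset.sum_comm]
  refine Finset.sum_congr rfl fun k _ => Finset.sum_congr rfl fun l _ => ?_
  have h : star (σ l k) = σ k l := congrFun₂ hσ k l
  simp only [Matrix.conjTranspose_smul, Matrix.conjTranspose_mul, Matrix.conjTranspose_sub, hA, hB,
    hermPart_isHermitian, star_mul', h, star_trivial]
  rw [← smul_neg, Complex.star_def, Complex.conj_ofReal, add_comm (lam l), ← mul_assoc,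
    ← neg_mul, ← mul_neg, neg_sub]

theorem tri_conj {u : Mat} (hu : u ∈ Matrix.unitaryGroup (Fin 3) ℂ) (lam : Fin 3 → ℝ) (σ : Mat)
    (A B T : Triple) :
    tri lam σ (conjAct u A) (conjAct u B) (conjAct u T) = conj u (tri lam σ A B T) := by
  simp only [tri, map_sum, conj_smul, conj_mul hu, map_sub, map_smul, conjAct_apply, hermPart_conj]

/-- The operator `T ↦ ([B, P k])ₖ`, where `B` is the skew-Hermitian matrix given by `tri`. -/
def tanOp (lam : Fin 3 → ℝ) (σ : Mat) (P : Triple) : Triple →L[ℝ] Triple :=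
  LinearMap.toContinuousLinearMap
    { toFun := fun T k => tri lam σ P P T * P k - P k * tri lam σ P P T
      map_add' := fun T T' => by
        funext k
        simp only [tri_add, add_mul, mul_add, Pi.add_apply]
        abel
      map_smul' := fun r T => by
        funext k
        simp [tri_smul, smul_sub] }

theorem tanOp_apply (lam : Fin 3 → ℝ) (σ : Mat) (P T : Triple) (k : Fin 3) :
    tanOp lam σ P T k = tri lam σ P P T * P k - P k * tri lam σ P P T := rfl

theorem tanOp_conj {u : Mat} (hu : u ∈ Matrix.unitaryGroup (Fin 3) ℂ) (lam : Fin 3 → ℝ) (σ : Mat)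
    (P T : Triple) :
    tanOp lam σ (conjAct u P) (conjAct u T) = conjAct u (tanOp lam σ P T) := by
  funext k
  simp only [tanOp_apply, tri_conj hu, conjAct_apply, map_sub, conj_mul hu]

theorem contDiff_tanOp (lam : Fin 3 → ℝ) (σ : Mat) : ContDiff ℝ ∞ (tanOp lam σ) := by
  rw [contDiff_clm_apply_iff]
  intro T
  rw [contDiff_pi]
  intro k
  simp only [tanOp_apply, tri]
  have h : ∀ k, ContDiff ℝ ∞ (fun P : Triple => P k) := fun k => contDiff_apply ℝ Mat k
  fun_prop

theorem tanOp_baseFlag (lam : Fin 3 → ℝ) (σ : Mat) (T : Triple) :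
    tanOp lam σ baseFlag T = fundVec (tri lam σ baseFlag baseFlag T) := rfl

theorem tanOp_mem (lam : Fin 3 → ℝ) {σ : Mat} (hσ : σᴴ = σ) {P : Triple} (hP : P ∈ flagManifold)
    (T : Triple) : tanOp lam σ P T ∈ tangentSpace flagManifold P := by
  obtain ⟨u, hu, rfl⟩ := hP
  rw [← conjAct_conjAct_conjTranspose hu T, tanOp_conj hu]
  refine conjAct_mem_tangentSpace hu (fundVec_mem_tangentSpace ?_)
  have h := flag_isHermitian baseFlag_mem
  exact tri_conjTranspose lam hσ h h _

/-- For T = `fundVec M` and k ≠ l, both T l and -T k have (k, l) entry M k l. For general T the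
formula takes the mean of these two candidates with weights lam l and lam k, the choice that makes
the projection orthogonal, and multiplies it by σ. -/
theorem tri_baseFlag_apply (lam : Fin 3 → ℝ) (σ : Mat) (T : Triple) (k l : Fin 3) :
    tri lam σ baseFlag baseFlag T k l = σ k l * ((lam k + lam l)⁻¹ : ℝ) *
      (lam l * hermPart (T l) k l - lam k * hermPart (T k) k l) := by
  simp only [tri, Matrix.sum_apply, Matrix.smul_apply, mul_baseFlag_apply, baseFlag_mul_apply]
  simp [Matrix.sub_apply]

/-- `fundVec` ignores the diagonal, and the off-diagonal part of a skew-Hermitian matrix is fixed by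
the three entries where a, b, c stand. -/
theorem fundVec_eq_isoTan {M : Mat} (hM : Mᴴ = -M) :
    fundVec M = isoTan (M 1 0) (M 0 2) (M 2 1) := by
  have h : ∀ i j, M i j = -star (M j i) := fun i j => by
    have := congrFun₂ hM i j
    rw [Matrix.conjTranspose_apply, Matrix.neg_apply] at this
    rw [this, neg_neg]
  funext k
  ext i j
  rw [isoTan, fundVec_apply, fundVec_apply]
  fin_cases k <;> fin_cases i <;> fin_cases j <;> simp [isoVec] <;> first | exact h _ _ | exact neg_eq_iff_eq_neg.2 (h _ _)

theorem tri_baseFlag_conjTranspose (lam : Fin 3 → ℝ) {σ : Mat} (hσ : σᴴ = σ) (T : Triple) :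
    (tri lam σ baseFlag baseFlag T)ᴴ = -tri lam σ baseFlag baseFlag T :=
  tri_conjTranspose lam hσ (flag_isHermitian baseFlag_mem) (flag_isHermitian baseFlag_mem) T

theorem hermPart_of_conjTranspose {X : Mat} (hX : Xᴴ = X) : hermPart X = X := by
  rw [hermPart_apply, hX, ← two_smul ℝ X, smul_smul]; norm_num

theorem hermPart_isoTan (a b c : ℂ) (k : Fin 3) : hermPart (isoTan a b c k) = isoTan a b c k :=
  hermPart_of_conjTranspose ((tangentSpace_flag_equations (isoTan_mem a b c)).1 k)

/-- The weights `lam` define positive coefficients on the three summands of `𝔪`. -/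
def IsWeight (lam : Fin 3 → ℝ) : Prop := 0 < lam 0 + lam 1 ∧ 0 < lam 0 + lam 2 ∧ 0 < lam 1 + lam 2

/-- On a tangent vector the two averaged candidates agree, so the weights cancel and only the factor
σ remains. `IsWeight` provides the nonzero denominators. -/
theorem tanOp_isoTan {lam : Fin 3 → ℝ} (hl : IsWeight lam) {σ : Mat} (hσ : σᴴ = σ) (a b c : ℂ) :
    tanOp lam σ baseFlag (isoTan a b c) = isoTan (σ 1 0 * a) (σ 0 2 * b) (σ 2 1 * c) := by
  rw [tanOp_baseFlag, fundVec_eq_isoTan (tri_baseFlag_conjTranspose lam hσ _)]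
  obtain ⟨h1, h2, h3⟩ := hl
  have e1 : (lam 0 + lam 1 : ℂ) ≠ 0 := by exact_mod_cast h1.ne'
  have e2 : (lam 0 + lam 2 : ℂ) ≠ 0 := by exact_mod_cast h2.ne'
  have e3 : (lam 1 + lam 2 : ℂ) ≠ 0 := by exact_mod_cast h3.ne'
  congr 1
  · rw [tri_baseFlag_apply, hermPart_isoTan, hermPart_isoTan, isoTan_zero, isoTan_one]
    rw [add_comm (lam 1)]
    simp
    field_simp
  · rw [tri_baseFlag_apply, hermPart_isoTan, hermPart_isoTan, isoTan_zero, isoTan_two]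
    simp
    field_simp
    ring
  · rw [tri_baseFlag_apply, hermPart_isoTan, hermPart_isoTan, isoTan_two, isoTan_one]
    rw [add_comm (lam 2)]
    simp
    field_simp

/-- The multiplier of the orthogonal projection onto the tangent space. -/
def oneMul : Mat := Matrix.of fun _ _ => 1

theorem oneMul_conjTranspose : oneMulᴴ = oneMul := by
  ext i j; simp [oneMul]

theorem tanOp_oneMul_of_mem {lam : Fin 3 → ℝ} (hl : IsWeight lam) {P X : Triple}
    (hP : P ∈ flagManifold) (hX : X ∈ tangentSpace flagManifold P) :
    tanOp lam oneMul P X = X := by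
  obtain ⟨u, hu, rfl⟩ := hP
  obtain ⟨a, b, c, rfl⟩ := (mem_tangentSpace_conjAct hu).1 hX
  rw [tanOp_conj hu, tanOp_isoTan hl oneMul_conjTranspose]
  simp [oneMul]

/-! ### The metrics -/

theorem fsMetric_add_left (X X' Y : Mat) : fsMetric (X + X') Y = fsMetric X Y + fsMetric X' Y := by
  simp [fsMetric, Matrix.conjTranspose_add, add_mul, mul_add]

theorem fsMetric_smul_left (r : ℝ) (X Y : Mat) : fsMetric (r • X) Y = r * fsMetric X Y := by
  simp [fsMetric, Matrix.conjTranspose_smul]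
  ring

theorem fsMetric_add_right (X Y Y' : Mat) : fsMetric X (Y + Y') = fsMetric X Y + fsMetric X Y' := by
  simp [fsMetric, mul_add]

theorem fsMetric_smul_right (r : ℝ) (X Y : Mat) : fsMetric X (r • Y) = r * fsMetric X Y := by
  simp [fsMetric]
  ring

/-- A bilinear form on triples which restricts to the invariant metrics of the flag manifold. -/
def gform (lam : Fin 3 → ℝ) : Triple →L[ℝ] Triple →L[ℝ] ℝ :=
  LinearMap.toContinuousBilinearMap
    (LinearMap.mk₂ ℝ (fun X Y => ∑ k, lam k * fsMetric (X k) (Y k))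
      (fun X X' Y => by simp [fsMetric_add_left, mul_add, Finset.sum_add_distrib])
      (fun r X Y => by
        simp only [Pi.smul_apply, fsMetric_smul_left, smul_eq_mul, Finset.mul_sum]
        exact Finset.sum_congr rfl fun k _ => by ring)
      (fun X Y Y' => by simp [fsMetric_add_right, mul_add, Finset.sum_add_distrib])
      (fun r X Y => by
        simp only [Pi.smul_apply, fsMetric_smul_right, smul_eq_mul, Finset.mul_sum]
        exact Finset.sum_congr rfl fun k _ => by ring))

theorem gform_apply (lam : Fin 3 → ℝ) (X Y : Triple) :
    gform lam X Y = ∑ k, lam k * fsMetric (X k) (Y k) := rfl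

theorem gform_comm (lam : Fin 3 → ℝ) (X Y : Triple) : gform lam X Y = gform lam Y X := by
  simp only [gform_apply, fsMetric_comm]

theorem gform_conj {u : Mat} (hu : u ∈ Matrix.unitaryGroup (Fin 3) ℂ) (lam : Fin 3 → ℝ)
    (X Y : Triple) : gform lam (conjAct u X) (conjAct u Y) = gform lam X Y := by
  simp only [gform_apply, conjAct_apply, fsMetric_conj hu]

theorem fsMetric_eq_sum (X Y : Mat) :
    fsMetric X Y = (1 / 2) * ∑ i, ∑ j, (star (X j i) * Y j i).re := by
  simp [fsMetric, Matrix.trace, Matrix.mul_apply]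

/-- The coordinate a occurs only in the components 0 and 1 of `isoTan`, b only in 0 and 2, c only in
1 and 2; hence the pairwise sums. Every positive triple arises this way, although a single lam k may
be zero or negative and `gform` need not be positive on the ambient space. -/
theorem gform_isoTan (lam : Fin 3 → ℝ) (a b c a' b' c' : ℂ) :
    gform lam (isoTan a b c) (isoTan a' b' c')
      = isoForm (lam 0 + lam 1) (lam 0 + lam 2) (lam 1 + lam 2) a b c a' b' c' := by
  rw [gform_apply, Fin.sum_univ_three]
  simp [fsMetric_eq_sum, Fin.sum_univ_three, isoTan_zero, isoTan_one, isoTan_two, isoForm]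
  ring

/-- Hermitian and skew-Hermitian matrices are orthogonal for the real trace form. -/
theorem fsMetric_hermPart {X Y : Mat} (hY : Yᴴ = Y) : fsMetric (hermPart X) Y = fsMetric X Y := by
  have h : fsMetric Xᴴ Y = fsMetric X Y := by
    have := congrArg Complex.re (Matrix.trace_conjTranspose (Xᴴ * Y))
    simp only [Matrix.conjTranspose_mul, Matrix.conjTranspose_conjTranspose, hY] at this
    rw [fsMetric, fsMetric, Matrix.conjTranspose_conjTranspose, Matrix.trace_mul_comm, this]
    simp
  rw [hermPart_apply, fsMetric_smul_left, fsMetric_add_left, h]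
  ring

/-- The factors lam l / (lam k + lam l) in `tri` are chosen for this identity: the norm lam k + lam
l of a summand cancels the denominator and leaves the pairing of T with the tangent vector. -/
theorem gform_tanOp_isoTan {lam : Fin 3 → ℝ} (hl : IsWeight lam) (T : Triple) (a b c : ℂ) :
    gform lam (tanOp lam oneMul baseFlag T) (isoTan a b c) = gform lam T (isoTan a b c) := by
  rw [tanOp_baseFlag, fundVec_eq_isoTan (tri_baseFlag_conjTranspose lam oneMul_conjTranspose _),
    gform_isoTan]
  have hT : gform lam T (isoTan a b c)
      = ∑ k, lam k * fsMetric (hermPart (T k)) (isoTan a b c k) := by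
    rw [gform_apply]
    refine Finset.sum_congr rfl fun k _ => ?_
    rw [fsMetric_hermPart ((tangentSpace_flag_equations (isoTan_mem a b c)).1 k)]
  have hs : ∀ k i j, hermPart (T k) i j = star (hermPart (T k) j i) := fun k i j =>
    (congrFun₂ (hermPart_isHermitian (T k)) i j).symm
  obtain ⟨h1, h2, h3⟩ := hl
  rw [hT, Fin.sum_univ_three]
  simp only [tri_baseFlag_apply, isoForm, fsMetric_eq_sum, Fin.sum_univ_three, isoTan_zero, isoTan_one, isoTan_two, oneMul, fun k => hs k 0 1,
    fun k => hs k 2 0, fun k => hs k 1 2, add_comm (lam 1) (lam 0), add_comm (lam 2) (lam 1)]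
  generalize hermPart (T 0) = H0 at *
  generalize hermPart (T 1) = H1 at *
  generalize hermPart (T 2) = H2 at *
  simp [-Complex.ofReal_inv, -Complex.ofReal_add]
  field_simp
  ring

section

/-! ### Uniqueness of the Levi-Civita connection -/

section Submanifold

variable {V : Type*} [NormedAddCommGroup V] [NormedSpace ℝ V]

/-- The difference of two such connections is symmetric in its arguments by torsion-freeness and
skew for g by compatibility with the metric. No tensoriality is needed, because the difference
applied to X and Y is itself a vector field Z and can serve as test field. -/
theorem IsLeviCivita.unique {S : Set V} (A : AlmostHermitian S)
    {D D' : (V → V) → (V → V) → V → V} (h : IsLeviCivita S A.g D) (h' : IsLeviCivita S A.g D')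
    {X Y : V → V} (hX : IsVectorField S X) (hY : IsVectorField S Y) {p : V} (hp : p ∈ S) :
    D X Y p = D' X Y p := by
  have hZ : IsVectorField S (D X Y - D' X Y) :=
    ⟨(h.vectorField X Y hX hY).1.sub (h'.vectorField X Y hX hY).1, fun q hq =>
      sub_mem ((h.vectorField X Y hX hY).2 q hq) ((h'.vectorField X Y hX hY).2 q hq)⟩
  set Z := D X Y - D' X Y with hZdef
  have mem : ∀ {U W : V → V}, IsVectorField S U → IsVectorField S W →
      D U W p - D' U W p ∈ tangentSpace S p := fun hU hW =>
    sub_mem ((h.vectorField _ _ hU hW).2 p hp) ((h'.vectorField _ _ hU hW).2 p hp)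
  have symm : ∀ U W, IsVectorField S U → IsVectorField S W →
      D U W p - D' U W p = D W U p - D' W U p := by
    intro U W hU hW
    have e := (h.torsion_free U W hU hW p hp).trans (h'.torsion_free U W hU hW p hp).symm
    rw [sub_eq_sub_iff_add_eq_add] at e ⊢
    rw [← sub_eq_zero] at e ⊢
    rw [← e]
    abel
  have skew : ∀ U W Q, IsVectorField S U → IsVectorField S W → IsVectorField S Q →
      A.g p (D U W p - D' U W p) (Q p) = -A.g p (D U Q p - D' U Q p) (W p) := by
    intro U W Q hU hW hQ
    have e := (h.metric U W Q hU hW hQ p hp).symm.trans (h'.metric U W Q hU hW hQ p hp)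
    rw [A.g_symm p hp (W p) (hW.2 p hp) _ ((h.vectorField _ _ hU hQ).2 p hp),
      A.g_symm p hp (W p) (hW.2 p hp) _ ((h'.vectorField _ _ hU hQ).2 p hp)] at e
    simp only [map_sub, sub_apply]
    linarith
  -- With S the difference, g(S(X,Y),Z) = -g(S(Z,X),Y) = g(S(Y,Z),X) = -g(S(X,Y),Z): each cyclic
  -- shift costs one sign and three shifts return to the start.
  have key : A.g p (D X Y p - D' X Y p) (Z p) = 0 := by
    have e1 := skew X Y Z hX hY hZ
    have e2 := skew Z X Y hZ hX hY
    have e3 := skew Y Z X hY hZ hX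
    rw [symm X Z hX hZ] at e1
    rw [symm Z Y hZ hY] at e2
    rw [symm Y X hY hX] at e3
    linarith
  by_contra hne
  exact (A.g_pos p hp _ (mem hX hY) (sub_ne_zero.2 hne)).ne' key

end Submanifold

/-! ### The Levi-Civita connection of the invariant metrics -/

/-- The projection of the derivative in the ambient vector space. -/
def levi (lam : Fin 3 → ℝ) (X Y : Triple → Triple) (P : Triple) : Triple :=
  tanOp lam oneMul P (fderiv ℝ Y P (X P))

theorem IsVectorField.differentiableAt {X : Triple → Triple}
    (hX : IsVectorField flagManifold X) (P : Triple) : DifferentiableAt ℝ X P :=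
  hX.1.differentiable (by simp) P

/-- The projection is orthogonal. -/
theorem gform_tanOp {lam : Fin 3 → ℝ} (hl : IsWeight lam) {P X : Triple} (hP : P ∈ flagManifold)
    (hX : X ∈ tangentSpace flagManifold P) (T : Triple) :
    gform lam (tanOp lam oneMul P T) X = gform lam T X := by
  obtain ⟨u, hu, rfl⟩ := hP
  obtain ⟨a, b, c, rfl⟩ := (mem_tangentSpace_conjAct hu).1 hX
  rw [← conjAct_conjAct_conjTranspose hu T, tanOp_conj hu, gform_conj hu, gform_conj hu,
    gform_tanOp_isoTan hl]

/-- Differentiate the tangency equations of Y along X and subtract the same with X and Y exchanged.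
The terms in which the moving base point was differentiated are symmetric in X, Y and cancel. -/
theorem lieBracket_mem {X Y : Triple → Triple} (hX : IsVectorField flagManifold X)
    (hY : IsVectorField flagManifold Y) {P : Triple} (hP : P ∈ flagManifold) :
    VectorField.lieBracket ℝ X Y P ∈ tangentSpace flagManifold P := by
  have comp : ∀ {Y : Triple → Triple}, IsVectorField flagManifold Y → ∀ k,
      HasFDerivAt (fun Q => Y Q k) ((ContinuousLinearMap.proj k).comp (fderiv ℝ Y P)) P :=
    fun hY k => hasFDerivAt_pi'.1 (hY.differentiableAt P).hasFDerivAt k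
  have hs : ∀ X Y, IsVectorField flagManifold X → IsVectorField flagManifold Y → ∀ k,
      (fderiv ℝ Y P (X P) k)ᴴ = fderiv ℝ Y P (X P) k := by
    intro X Y hX hY k
    have h1 := hermPart.hasFDerivAt.comp P (comp hY k)
    have h := fderiv_eq_of_eqOn h1.differentiableAt (comp hY k).differentiableAt
      (fun Q hQ => hermPart_of_conjTranspose ((tangentSpace_flag_equations (hY.2 Q hQ)).1 k))
      (hX.2 P hP)
    rw [h1.fderiv, (comp hY k).fderiv] at h
    have h2 : hermPart (fderiv ℝ Y P (X P) k) = fderiv ℝ Y P (X P) k := h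
    rw [← h2]
    exact hermPart_isHermitian _
  have he : ∀ X Y, IsVectorField flagManifold X → IsVectorField flagManifold Y → ∀ k l,
      fderiv ℝ Y P (X P) k * P l + Y P k * X P l + (P k * fderiv ℝ Y P (X P) l + X P k * Y P l)
        = if k = l then fderiv ℝ Y P (X P) k else 0 := by
    intro X Y hX hY k l
    have hp : ∀ k, HasFDerivAt (fun Q : Triple => Q k)
        (ContinuousLinearMap.proj k : Triple →L[ℝ] Mat) P := fun k => hasFDerivAt_apply k P
    have h1 := ((comp hY k).mul' (hp l)).add ((hp k).mul' (comp hY l))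
    have h2 : HasFDerivAt (fun Q => if k = l then Y Q k else 0)
        (if k = l then (ContinuousLinearMap.proj k).comp (fderiv ℝ Y P) else 0) P := by
      split_ifs
      · exact comp hY k
      · exact hasFDerivAt_const _ _
    have h := fderiv_eq_of_eqOn h1.differentiableAt h2.differentiableAt
      (fun Q hQ => (tangentSpace_flag_equations (hY.2 Q hQ)).2 k l) (hX.2 P hP)
    rw [h1.fderiv, h2.fderiv] at h
    refine Eq.trans ?_ (h.trans ?_)
    · simp
      abel
    · split_ifs <;> rfl
  rw [mem_tangentSpace_iff_equations hP]
  constructor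
  · intro k
    rw [VectorField.lieBracket, Pi.sub_apply, Matrix.conjTranspose_sub, hs X Y hX hY, hs Y X hY hX]
  · intro k l
    have h1 := he X Y hX hY k l
    have h2 := he Y X hY hX k l
    rw [VectorField.lieBracket]
    simp only [Pi.sub_apply]
    have e : (if k = l then fderiv ℝ Y P (X P) k - fderiv ℝ X P (Y P) k else 0)
        = (if k = l then fderiv ℝ Y P (X P) k else 0)
          - (if k = l then fderiv ℝ X P (Y P) k else 0) := by split_ifs <;> simp
    rw [e, ← h1, ← h2]
    noncomm_ring

/-- A metric which restricts to an invariant one on the flag manifold. -/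
def HasWeight (lam : Fin 3 → ℝ) (g : Triple → Triple →L[ℝ] Triple →L[ℝ] ℝ) : Prop :=
  ∀ P ∈ flagManifold, ∀ X ∈ tangentSpace flagManifold P, ∀ Y ∈ tangentSpace flagManifold P,
    g P X Y = gform lam X Y

/-- The Gauss construction for a submanifold of a space with a constant bilinear form. Positivity
off the submanifold plays no role: it is enough that the projection fixes tangent vectors and is
self-adjoint against them. -/
theorem isLeviCivita_levi {lam : Fin 3 → ℝ} (hl : IsWeight lam)
    {g : Triple → Triple →L[ℝ] Triple →L[ℝ] ℝ} (hgs : ContDiff ℝ ∞ g) (hg : HasWeight lam g) :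
    IsLeviCivita flagManifold g (levi lam) := by
  refine ⟨?_, ?_, ?_, ?_, ?_, ?_, ?_⟩
  · intro X Y hX hY
    refine ⟨?_, fun P hP => tanOp_mem lam oneMul_conjTranspose hP _⟩
    have h1 := hX.1
    have h2 : ContDiff ℝ ∞ (fderiv ℝ Y) := hY.1.fderiv_right (by simp)
    have h3 := contDiff_tanOp lam oneMul
    exact h3.clm_apply (h2.clm_apply h1)
  · intro X X' Y _ _ _ P _
    simp [levi]
  · intro f X Y _ _ _ P _
    simp [levi]
  · intro X Y Y' _ hY hY' P _
    simp [levi, fderiv_add (hY.differentiableAt P) (hY'.differentiableAt P)]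
  · intro f X Y hf hX hY P hP
    have hf' : DifferentiableAt ℝ f P := hf.differentiable (by simp) P
    simp [levi, fderiv_fun_smul hf' (hY.differentiableAt P),
      tanOp_oneMul_of_mem hl hP (hY.2 P hP)]
  · intro X Y hX hY P hP
    rw [levi, levi, ← map_sub]
    exact tanOp_oneMul_of_mem hl hP (lieBracket_mem hX hY hP)
  · intro X Y Z hX hY hZ P hP
    have m : ∀ X Y, levi lam X Y P ∈ tangentSpace flagManifold P := fun X Y =>
      tanOp_mem lam oneMul_conjTranspose hP _
    rw [hg P hP _ (m X Y) _ (hZ.2 P hP), hg P hP _ (hY.2 P hP) _ (m X Z), levi, levi,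
      gform_comm lam (Y P), gform_tanOp hl hP (hZ.2 P hP), gform_tanOp hl hP (hY.2 P hP)]
    have hYd := hY.differentiableAt P
    have hZd := hZ.differentiableAt P
    have hd := ((gform lam).hasFDerivAt_of_bilinear hYd.hasFDerivAt hZd.hasFDerivAt)
    have hgd : DifferentiableAt ℝ g P := hgs.differentiable (by simp) P
    -- The metric agrees with the constant form only along the flag manifold, which suffices since
    -- the derivative is taken in a tangent direction.
    rw [fderiv_eq_of_eqOn (g := fun Q => gform lam (Y Q) (Z Q))
      ((hgd.clm_apply hYd).clm_apply hZd) hd.differentiableAt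
      (fun Q hQ => hg Q hQ _ (hY.2 Q hQ) _ (hZ.2 Q hQ)) (hX.2 P hP), hd.fderiv,
      gform_comm lam _ (Y P)]
    simp [add_comm]

/-! ### The covariant derivative of an invariant almost complex structure -/

/-- The derivative of `tanOp lam σ` at `P` in the direction `X`, applied to `Y`. -/
def dtanOp (lam : Fin 3 → ℝ) (σ : Mat) (P X Y : Triple) : Triple := fun k =>
  ((tri lam σ X P Y + tri lam σ P X Y) * P k - P k * (tri lam σ X P Y + tri lam σ P X Y))
    + (tri lam σ P P Y * X k - X k * tri lam σ P P Y)

theorem dtanOp_conj {u : Mat} (hu : u ∈ Matrix.unitaryGroup (Fin 3) ℂ) (lam : Fin 3 → ℝ) (σ : Mat)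
    (P X Y : Triple) : dtanOp lam σ (conjAct u P) (conjAct u X) (conjAct u Y)
      = conjAct u (dtanOp lam σ P X Y) := by
  funext k
  simp only [dtanOp, tri_conj hu, conjAct_apply, map_sub, map_add, conj_mul hu]

theorem hasDerivAt_line (P X : Triple) : HasDerivAt (fun t : ℝ => P + t • X) X 0 := by
  simpa using ((hasDerivAt_id (0 : ℝ)).smul_const X).const_add P

/-- `tri lam σ P P Y` is quadratic in P; keeping its two slots separate makes the derivative a plain
polarization. -/
theorem hasDerivAt_tri_line (lam : Fin 3 → ℝ) (σ : Mat) (P X Y : Triple) :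
    HasDerivAt (fun t : ℝ => tri lam σ (P + t • X) (P + t • X) Y)
      (tri lam σ X P Y + tri lam σ P X Y) 0 := by
  have hk : ∀ k, HasDerivAt (fun t : ℝ => (P + t • X) k) (X k) 0 :=
    hasDerivAt_pi.1 (hasDerivAt_line P X)
  have h0 : ∀ k, (P + (0 : ℝ) • X) k = P k := fun k => by rw [zero_smul, add_zero]
  simp only [tri, ← Finset.sum_add_distrib]
  refine HasDerivAt.fun_sum fun k _ => HasDerivAt.fun_sum fun l _ => ?_
  rw [← smul_add]
  have h := ((hk k).mul_const (lam l • hermPart (Y l) - lam k • hermPart (Y k))).mul (hk l)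
  rw [h0, h0] at h
  exact h.const_smul (σ k l * ((lam k + lam l)⁻¹ : ℝ))

theorem hasDerivAt_tanOp_line (lam : Fin 3 → ℝ) (σ : Mat) (P X Y : Triple) :
    HasDerivAt (fun t : ℝ => tanOp lam σ (P + t • X) Y) (dtanOp lam σ P X Y) 0 := by
  have hk : ∀ k, HasDerivAt (fun t : ℝ => (P + t • X) k) (X k) 0 :=
    hasDerivAt_pi.1 (hasDerivAt_line P X)
  have ht := hasDerivAt_tri_line lam σ P X Y
  have h0 : P + (0 : ℝ) • X = P := by rw [zero_smul, add_zero]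
  refine hasDerivAt_pi.2 fun k => ?_
  have h := (ht.mul (hk k)).sub ((hk k).mul ht)
  rw [h0] at h
  refine h.congr_deriv ?_
  rw [dtanOp]
  abel

theorem fderiv_tanOp_apply (lam : Fin 3 → ℝ) (σ : Mat) (P X Y : Triple) :
    fderiv ℝ (tanOp lam σ) P X Y = dtanOp lam σ P X Y := by
  have hd : HasFDerivAt (tanOp lam σ) (fderiv ℝ (tanOp lam σ) P) (P + (0 : ℝ) • X) := by
    rw [zero_smul, add_zero]
    exact ((contDiff_tanOp lam σ).differentiable (by simp) P).hasFDerivAt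
  have h1 := ((ContinuousLinearMap.apply ℝ Triple Y).hasFDerivAt.comp_hasDerivAt (0 : ℝ)
    (hd.comp_hasDerivAt (0 : ℝ) (hasDerivAt_line P X)))
  exact h1.unique (hasDerivAt_tanOp_line lam σ P X Y)

/-- `(∇_X J) Y` for the almost complex structure `J = tanOp lam σ`. -/
def nablaJ (lam : Fin 3 → ℝ) (σ : Mat) (P X Y : Triple) : Triple :=
  tanOp lam oneMul P (dtanOp lam σ P X Y)

theorem nablaJ_conj {u : Mat} (hu : u ∈ Matrix.unitaryGroup (Fin 3) ℂ) (lam : Fin 3 → ℝ) (σ : Mat)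
    (P X Y : Triple) : nablaJ lam σ (conjAct u P) (conjAct u X) (conjAct u Y)
      = conjAct u (nablaJ lam σ P X Y) := by
  rw [nablaJ, dtanOp_conj hu, tanOp_conj hu, nablaJ]

end

section

theorem tanOp_baseFlag_eq_isoTan (lam : Fin 3 → ℝ) {σ : Mat} (hσ : σᴴ = σ) (T : Triple) :
    tanOp lam σ baseFlag T = isoTan (tri lam σ baseFlag baseFlag T 1 0)
      (tri lam σ baseFlag baseFlag T 0 2) (tri lam σ baseFlag baseFlag T 2 1) := by
  rw [tanOp_baseFlag, fundVec_eq_isoTan (tri_baseFlag_conjTranspose lam hσ _)]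

/-- `tanOp lam σ` is J composed with the orthogonal projection. Hence J(∇_X Y) can be computed from
the unprojected ambient derivative of Y. -/
theorem tanOp_tanOp_oneMul {lam : Fin 3 → ℝ} (hl : IsWeight lam) {σ : Mat} (hσ : σᴴ = σ)
    {P : Triple} (hP : P ∈ flagManifold) (T : Triple) :
    tanOp lam σ P (tanOp lam oneMul P T) = tanOp lam σ P T := by
  obtain ⟨u, hu, rfl⟩ := hP
  rw [← conjAct_conjAct_conjTranspose hu T, tanOp_conj hu, tanOp_conj hu, tanOp_conj hu,
    tanOp_baseFlag_eq_isoTan lam oneMul_conjTranspose, tanOp_isoTan hl hσ,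
    tanOp_baseFlag_eq_isoTan lam hσ]
  simp only [tri_baseFlag_apply, oneMul, Matrix.of_apply, one_mul, mul_assoc]

/-- A tensor field which restricts to the invariant endomorphism with multiplier `σ`. -/
def HasMultiplier (σ : Mat) (J : Triple → Triple →L[ℝ] Triple) : Prop :=
  ∀ lam, IsWeight lam → ∀ P ∈ flagManifold, ∀ X ∈ tangentSpace flagManifold P,
    J P X = tanOp lam σ P X

variable {lam : Fin 3 → ℝ} {σ : Mat} {A : AlmostHermitian flagManifold}

theorem isVectorField_J (A : AlmostHermitian flagManifold) {Y : Triple → Triple}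
    (hY : IsVectorField flagManifold Y) : IsVectorField flagManifold (fun q => A.J q (Y q)) :=
  ⟨A.smooth_J.clm_apply hY.1, fun p hp => A.J_mem p hp _ (hY.2 p hp)⟩

/-- Along the flag manifold JY is `tanOp lam σ` applied to Y. The product rule gives a term with dY,
which is J(∇_X Y) and cancels, and a term with the derivative of `tanOp`, whose projection is
`nablaJ`. This shows that ∇J is a tensor. -/
theorem IsLeviCivita.nabla_J (hl : IsWeight lam) (hσ : σᴴ = σ) (hg : HasWeight lam A.g)
    (hJ : HasMultiplier σ A.J) {D : (Triple → Triple) → (Triple → Triple) → Triple → Triple}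
    (hD : IsLeviCivita flagManifold A.g D) {X Y : Triple → Triple}
    (hX : IsVectorField flagManifold X) (hY : IsVectorField flagManifold Y) {P : Triple}
    (hP : P ∈ flagManifold) :
    D X (fun q => A.J q (Y q)) P - A.J P (D X Y P) = nablaJ lam σ P (X P) (Y P) := by
  have hD' := isLeviCivita_levi hl A.smooth_g hg
  rw [hD.unique A hD' hX (isVectorField_J A hY) hP, hD.unique A hD' hX hY hP,
    hJ lam hl P hP _ ((hD'.vectorField X Y hX hY).2 P hP), levi, levi,
    tanOp_tanOp_oneMul hl hσ hP]
  have hYd := hY.differentiableAt P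
  have hT : DifferentiableAt ℝ (tanOp lam σ) P :=
    (contDiff_tanOp lam σ).differentiable (by simp) P
  have h1 := hT.hasFDerivAt.clm_apply hYd.hasFDerivAt
  rw [fderiv_eq_of_eqOn (g := fun Q => tanOp lam σ Q (Y Q))
    ((isVectorField_J A hY).differentiableAt P) h1.differentiableAt
    (fun Q hQ => hJ lam hl Q hQ _ (hY.2 Q hQ)) (hX.2 P hP), h1.fderiv]
  simp only [add_apply, ContinuousLinearMap.comp_apply,
    ContinuousLinearMap.flip_apply, map_add, fderiv_tanOp_apply]
  rw [tanOp_oneMul_of_mem hl hP (tanOp_mem lam hσ hP _), nablaJ]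
  abel

/-- Every tangent vector extends to a vector field. -/
theorem isVectorField_tanOp (T : Triple) :
    IsVectorField flagManifold (fun P => tanOp (fun _ => 1) oneMul P T) :=
  ⟨(contDiff_tanOp _ _).clm_apply contDiff_const,
    fun _ hP => tanOp_mem _ oneMul_conjTranspose hP T⟩

theorem isWeight_one : IsWeight (fun _ => 1) := by
  refine ⟨?_, ?_, ?_⟩ <;> norm_num

/-- Since ∇J is tensorial and equivariant, the values at the standard flag decide. Every tangent
vector there is the value of a projected constant field. -/
theorem isNearlyKaehler_iff (hl : IsWeight lam) (hσ : σᴴ = σ) (hg : HasWeight lam A.g)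
    (hJ : HasMultiplier σ A.J) : A.IsNearlyKaehler ↔
      ∀ a b c, nablaJ lam σ baseFlag (isoTan a b c) (isoTan a b c) = 0 := by
  constructor
  · rintro ⟨D, hD, h⟩ a b c
    have hX := isVectorField_tanOp (isoTan a b c)
    have h1 := h _ hX baseFlag baseFlag_mem
    rw [hD.nabla_J hl hσ hg hJ hX hX baseFlag_mem] at h1
    rwa [tanOp_oneMul_of_mem isWeight_one baseFlag_mem (isoTan_mem a b c)] at h1
  · intro h
    refine ⟨levi lam, isLeviCivita_levi hl A.smooth_g hg, fun X hX P hP => ?_⟩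
    rw [(isLeviCivita_levi hl A.smooth_g hg).nabla_J hl hσ hg hJ hX hX hP]
    have hXP := hX.2 P hP
    obtain ⟨u, hu, rfl⟩ := hP
    obtain ⟨a, b, c, e⟩ := (mem_tangentSpace_conjAct hu).1 hXP
    rw [e, nablaJ_conj hu, h, ← conjActLin_apply, map_zero]

theorem isKaehler_iff (hl : IsWeight lam) (hσ : σᴴ = σ) (hg : HasWeight lam A.g)
    (hJ : HasMultiplier σ A.J) : A.IsKaehler ↔
      ∀ a b c a' b' c', nablaJ lam σ baseFlag (isoTan a b c) (isoTan a' b' c') = 0 := by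
  constructor
  · rintro ⟨D, hD, h⟩ a b c a' b' c'
    have hX := isVectorField_tanOp (isoTan a b c)
    have hY := isVectorField_tanOp (isoTan a' b' c')
    have h1 := h _ _ hX hY baseFlag baseFlag_mem
    rw [hD.nabla_J hl hσ hg hJ hX hY baseFlag_mem] at h1
    rwa [tanOp_oneMul_of_mem isWeight_one baseFlag_mem (isoTan_mem a b c),
      tanOp_oneMul_of_mem isWeight_one baseFlag_mem (isoTan_mem a' b' c')] at h1
  · intro h
    refine ⟨levi lam, isLeviCivita_levi hl A.smooth_g hg, fun X Y hX hY P hP => ?_⟩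
    rw [(isLeviCivita_levi hl A.smooth_g hg).nabla_J hl hσ hg hJ hX hY hP]
    have hXP := hX.2 P hP
    have hYP := hY.2 P hP
    obtain ⟨u, hu, rfl⟩ := hP
    obtain ⟨a, b, c, e⟩ := (mem_tangentSpace_conjAct hu).1 hXP
    obtain ⟨a', b', c', e'⟩ := (mem_tangentSpace_conjAct hu).1 hYP
    rw [e, e', nablaJ_conj hu, h, ← conjActLin_apply, map_zero]

/-! ### The entries of ∇J at the standard flag -/

theorem sum_fin_three {M : Type*} [AddCommMonoid M] {k l m : Fin 3} (hkl : k ≠ l) (hkm : k ≠ m)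
    (hlm : l ≠ m) (f : Fin 3 → M) : ∑ i, f i = f k + f l + f m := by
  have h : (Finset.univ : Finset (Fin 3)) = {k, l, m} := by
    revert k l m; decide
  rw [h, Finset.sum_insert (by simp [hkl, hkm]), Finset.sum_pair hlm, add_assoc]

theorem IsWeight.ne_zero (hl : IsWeight lam) {k l : Fin 3} (h : k ≠ l) :
    (lam k + lam l : ℂ) ≠ 0 := by
  obtain ⟨h1, h2, h3⟩ := hl
  have : lam k + lam l ≠ 0 := by
    fin_cases k <;> fin_cases l <;> simp at h ⊢ <;> linarith
  exact_mod_cast this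

/-- In the sum over the first index i, the term i = l is a zero difference. The term i = m gives σ m
l, its weights cancelling, and i = k gives -σ k l * lam l / (lam k + lam l). Both carry M k m * N m
l, the only path from k to l through the third index. -/
theorem tri_fundVec_right (hl : IsWeight lam) (σ : Mat) {M N : Mat} (hN : Nᴴ = -N)
    (hM0 : ∀ i, M i i = 0) (hN0 : ∀ i, N i i = 0)
    {k l m : Fin 3} (hkl : k ≠ l) (hkm : k ≠ m) (hlm : l ≠ m) :
    tri lam σ (fundVec M) baseFlag (fundVec N) k l
      = M k m * N m l * (σ m l - σ k l * lam l * (lam k + lam l : ℂ)⁻¹) := by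
  have e1 := hl.ne_zero hkl
  have e2 := hl.ne_zero hlm.symm
  have hY := (tangentSpace_flag_equations (fundVec_mem_tangentSpace hN)).1
  have h : tri lam σ (fundVec M) baseFlag (fundVec N) k l =
      ∑ i, (σ i l * ((lam i + lam l)⁻¹ : ℝ)) *
        ∑ j, fundVec M i k j * (lam l * fundVec N l j l - lam i * fundVec N i j l) := by
    simp only [tri, Matrix.sum_apply, Matrix.smul_apply, mul_baseFlag_apply,
      hermPart_of_conjTranspose (hY _)]
    simp [Matrix.mul_apply, Matrix.sub_apply]
  rw [h]
  simp only [sum_fin_three hkl hkm hlm, fundVec_apply, hM0, hN0, hkl, hkm, hlm, hkl.symm, hkm.symm,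
    hlm.symm, if_true, if_false]
  push_cast
  field_simp
  ring

theorem tri_fundVec (hl : IsWeight lam) (σ : Mat) {N : Mat} (hN : Nᴴ = -N) {k l : Fin 3}
    (hkl : k ≠ l) : tri lam σ baseFlag baseFlag (fundVec N) k l = σ k l * N k l := by
  have e1 := hl.ne_zero hkl
  have hY := (tangentSpace_flag_equations (fundVec_mem_tangentSpace hN)).1
  rw [tri_baseFlag_apply, hermPart_of_conjTranspose (hY _), hermPart_of_conjTranspose (hY _),
    fundVec_apply, fundVec_apply]
  simp only [hkl, hkl.symm, if_true, if_false]
  push_cast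
  field_simp
  ring

/-- The numerator vanishes for k = l, so the inverse of 2 lam k is harmless even when lam k = 0. -/
theorem tri_baseFlag_self (lam : Fin 3 → ℝ) (σ : Mat) (T : Triple) (k : Fin 3) :
    tri lam σ baseFlag baseFlag T k k = 0 := by
  rw [tri_baseFlag_apply, sub_self, mul_zero]

theorem dtanOp_conjTranspose (hσ : σᴴ = σ) {M : Mat} (hM : Mᴴ = -M) (T : Triple) (k : Fin 3) :
    (dtanOp lam σ baseFlag (fundVec M) T k)ᴴ = dtanOp lam σ baseFlag (fundVec M) T k := by
  have h0 := flag_isHermitian baseFlag_mem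
  have hX := (tangentSpace_flag_equations (fundVec_mem_tangentSpace hM)).1
  have e1 := tri_conjTranspose lam hσ h0 hX T
  have e2 := tri_conjTranspose lam hσ hX h0 T
  have e3 := tri_conjTranspose lam hσ h0 h0 T
  simp only [dtanOp, Matrix.conjTranspose_add, Matrix.conjTranspose_sub,
    Matrix.conjTranspose_mul, e1, e2, e3, h0, hX]
  noncomm_ring

/-- Reduces the derivative in the second slot of `tri` to the one in the first slot, with the
indices exchanged. -/
theorem tri_skew (hσ : σᴴ = σ) {M : Mat} (hM : Mᴴ = -M) (T : Triple) (k l : Fin 3) :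
    tri lam σ baseFlag (fundVec M) T k l = -star (tri lam σ (fundVec M) baseFlag T l k) := by
  have h0 := flag_isHermitian baseFlag_mem
  have hX := (tangentSpace_flag_equations (fundVec_mem_tangentSpace hM)).1
  have e1 := tri_conjTranspose lam hσ hX h0 T
  rw [← Matrix.conjTranspose_apply, e1, Matrix.neg_apply, neg_neg]

/-- The entries of the covariant derivative of an invariant almost complex structure. -/
theorem tri_dtanOp (hl : IsWeight lam) (hσ : σᴴ = σ) {M N : Mat} (hM : Mᴴ = -M) (hN : Nᴴ = -N)
    (hM0 : ∀ i, M i i = 0) (hN0 : ∀ i, N i i = 0)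
    {k l m : Fin 3} (hkl : k ≠ l) (hkm : k ≠ m) (hlm : l ≠ m) :
    tri lam oneMul baseFlag baseFlag (dtanOp lam σ baseFlag (fundVec M) (fundVec N)) k l
      = (lam k + lam l : ℂ)⁻¹ * (lam l * (σ m l - σ k l) * (M k m * N m l)
        + lam k * (σ k l - σ k m) * (N k m * M m l)) := by
  have e1 := hl.ne_zero hkl
  have skew : ∀ {M : Mat}, Mᴴ = -M → ∀ i j, (starRingEnd ℂ) (M i j) = -M j i :=
    fun h i j => congrFun₂ h j i
  have hs : ∀ i j, (starRingEnd ℂ) (σ i j) = σ j i := fun i j => congrFun₂ hσ j i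
  have hB : (tri lam σ (fundVec M) baseFlag (fundVec N)
      + tri lam σ baseFlag (fundVec M) (fundVec N)) k l
      = M k m * N m l * (σ m l - σ k l * lam l * (lam k + lam l : ℂ)⁻¹)
        - N k m * M m l * (σ k m - σ k l * lam k * (lam k + lam l : ℂ)⁻¹) := by
    rw [Matrix.add_apply, tri_skew hσ hM, tri_fundVec_right hl σ hN hM0 hN0 hkl hkm hlm,
      tri_fundVec_right hl σ hN hM0 hN0 hkl.symm hlm hkm, Complex.star_def]
    simp only [map_mul, map_sub, map_inv₀, map_add, Complex.conj_ofReal, skew hM, skew hN, hs]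
    rw [add_comm (lam l : ℂ)]
    ring
  rw [tri_baseFlag_apply, hermPart_of_conjTranspose (dtanOp_conjTranspose hσ hM _ _),
    hermPart_of_conjTranspose (dtanOp_conjTranspose hσ hM _ _)]
  simp only [dtanOp, Matrix.add_apply _ _ k l, Matrix.sub_apply _ _ k l, mul_baseFlag_apply,
    baseFlag_mul_apply]
  rw [← Matrix.add_apply]
  simp only [hkl, hkl.symm, if_true, if_false, hB, Matrix.mul_apply, sum_fin_three hkl hkm hlm,
    tri_fundVec hl σ hN hkm, tri_fundVec hl σ hN hlm.symm, tri_fundVec hl σ hN hkl,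
    tri_baseFlag_self, fundVec_apply, hM0, hkm.symm, hlm.symm, oneMul, Matrix.of_apply]
  push_cast
  field_simp
  ring

theorem isoVec_diag (a b c : ℂ) (i : Fin 3) : isoVec a b c i i = 0 := by
  fin_cases i <;> rfl

/-- The coordinates a, b, c sit at the entries (1,0), (0,2), (2,1); each instance of `tri_dtanOp`
uses the remaining index as m, so each coordinate of ∇J pairs the other two coordinates of the
arguments. -/
theorem nablaJ_isoTan (hl : IsWeight lam) (hσ : σᴴ = σ) (a b c a' b' c' : ℂ) :
    nablaJ lam σ baseFlag (isoTan a b c) (isoTan a' b' c') = isoTan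
      ((lam 1 + lam 0 : ℂ)⁻¹ * (lam 0 * (σ 2 0 - σ 1 0) * (star c * star b')
        + lam 1 * (σ 1 0 - σ 1 2) * (star c' * star b)))
      ((lam 0 + lam 2 : ℂ)⁻¹ * (lam 2 * (σ 1 2 - σ 0 2) * (star a * star c')
        + lam 0 * (σ 0 2 - σ 0 1) * (star a' * star c)))
      ((lam 2 + lam 1 : ℂ)⁻¹ * (lam 1 * (σ 0 1 - σ 2 1) * (star b * star a')
        + lam 2 * (σ 2 1 - σ 2 0) * (star b' * star a))) := by
  have h : ∀ {k l m : Fin 3}, _ := fun {k l m} => tri_dtanOp (k := k) (l := l) (m := m) hl hσ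
    (isoVec_conjTranspose a b c) (isoVec_conjTranspose a' b' c') (isoVec_diag a b c)
    (isoVec_diag a' b' c')
  rw [nablaJ, tanOp_baseFlag_eq_isoTan lam oneMul_conjTranspose]
  simp only [isoTan]
  rw [h (m := 2) (by decide) (by decide) (by decide), h (m := 1) (by decide) (by decide) (by decide),
    h (m := 0) (by decide) (by decide) (by decide)]
  simp [isoVec]

end

section

/-! ### Nearly Kähler invariant structures -/

/-- The multiplier of `⟨a, b, c⟩ ↦ ⟨i e₀ a, i e₁ b, i e₂ c⟩`. -/
def jMul (e : Fin 3 → ℝ) : Mat :=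
  Complex.I • !![0, -(e 0 : ℂ), e 1; e 0, 0, -(e 2 : ℂ); -(e 1 : ℂ), e 2, 0]

theorem jMul_conjTranspose (e : Fin 3 → ℝ) : (jMul e)ᴴ = jMul e := by
  ext i j
  fin_cases i <;> fin_cases j <;> simp [jMul]

theorem isoTan_eq_zero {a b c : ℂ} : isoTan a b c = 0 ↔ a = 0 ∧ b = 0 ∧ c = 0 := by
  constructor
  · intro h
    have h0 := congrFun h 0
    have h1 := congrFun h 1
    rw [isoTan_zero] at h0
    rw [isoTan_one] at h1
    refine ⟨congrFun₂ h0 1 0, ?_, congrFun₂ h1 2 1⟩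
    simpa using congrFun₂ h0 0 2
  · rintro ⟨rfl, rfl, rfl⟩
    refine triple_ext ?_ ?_ ?_
    · rw [isoTan_zero]; ext i j; fin_cases i <;> fin_cases j <;> simp
    · rw [isoTan_one]; ext i j; fin_cases i <;> fin_cases j <;> simp
    · rw [isoTan_two]; ext i j; fin_cases i <;> fin_cases j <;> simp

variable {lam : Fin 3 → ℝ} {e : Fin 3 → ℝ} {A : AlmostHermitian flagManifold}

/-- The entries (1,0), (0,2), (2,1) of `jMul e` are i times a sign and the transposed entries are
the negatives, so each difference of multipliers becomes ±i times a sum of two signs. The factor of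
lam k is the sum of the signs on the two summands containing the index k. -/
theorem nablaJ_jMul (hl : IsWeight lam) (e : Fin 3 → ℝ) (a b c a' b' c' : ℂ) :
    nablaJ lam (jMul e) baseFlag (isoTan a b c) (isoTan a' b' c') = isoTan
      ((lam 1 + lam 0 : ℂ)⁻¹ * (Complex.I * (((lam 1 * (e 0 + e 2) : ℝ) : ℂ) * (star c' * star b)
        - ((lam 0 * (e 0 + e 1) : ℝ) : ℂ) * (star c * star b'))))
      ((lam 0 + lam 2 : ℂ)⁻¹ * (Complex.I * (((lam 0 * (e 0 + e 1) : ℝ) : ℂ) * (star a' * star c)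
        - ((lam 2 * (e 1 + e 2) : ℝ) : ℂ) * (star a * star c'))))
      ((lam 2 + lam 1 : ℂ)⁻¹ * (Complex.I * (((lam 2 * (e 1 + e 2) : ℝ) : ℂ) * (star b' * star a)
        - ((lam 1 * (e 0 + e 2) : ℝ) : ℂ) * (star b * star a')))) := by
  rw [nablaJ_isoTan hl (jMul_conjTranspose e)]
  congr 1 <;> simp [jMul] <;> ring_nf <;> simp

/-- For equal arguments the two products in each coordinate coincide, leaving a difference of two of
the κ; the vector (1, 1, 1) detects these differences. -/
theorem isNearlyKaehler_jMul_iff (hl : IsWeight lam) (hg : HasWeight lam A.g)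
    (hJ : HasMultiplier (jMul e) A.J) : A.IsNearlyKaehler ↔
      lam 0 * (e 0 + e 1) = lam 1 * (e 0 + e 2) ∧ lam 2 * (e 1 + e 2) = lam 0 * (e 0 + e 1) := by
  rw [isNearlyKaehler_iff hl (jMul_conjTranspose e) hg hJ]
  simp only [nablaJ_jMul hl, isoTan_eq_zero]
  constructor
  · intro h
    obtain ⟨h1, h2, -⟩ := h 1 1 1
    have e1 := hl.ne_zero (k := 1) (l := 0) (by decide)
    have e2 := hl.ne_zero (k := 0) (l := 2) (by decide)
    simp only [star_one, mul_one, mul_eq_zero, inv_eq_zero, e1, e2, Complex.I_ne_zero,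
      false_or, sub_eq_zero] at h1 h2
    exact ⟨by exact_mod_cast h1.symm, by exact_mod_cast h2.symm⟩
  · rintro ⟨h1, h2⟩ a b c
    rw [h2, ← h1]
    refine ⟨?_, ?_, ?_⟩ <;> ring

theorem isKaehler_jMul_iff (hl : IsWeight lam) (hg : HasWeight lam A.g)
    (hJ : HasMultiplier (jMul e) A.J) : A.IsKaehler ↔
      lam 0 * (e 0 + e 1) = 0 ∧ lam 1 * (e 0 + e 2) = 0 ∧ lam 2 * (e 1 + e 2) = 0 := by
  rw [isKaehler_iff hl (jMul_conjTranspose e) hg hJ]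
  simp only [nablaJ_jMul hl, isoTan_eq_zero]
  constructor
  · intro h
    -- Pairs of vectors from different summands isolate one κ each, in the order κ₁, κ₀, κ₂.
    obtain ⟨h1, -, -⟩ := h 0 1 0 0 0 1
    obtain ⟨-, h2, -⟩ := h 0 0 1 1 0 0
    obtain ⟨-, -, h3⟩ := h 1 0 0 0 1 0
    have e1 := hl.ne_zero (k := 1) (l := 0) (by decide)
    have e2 := hl.ne_zero (k := 0) (l := 2) (by decide)
    have e3 := hl.ne_zero (k := 2) (l := 1) (by decide)
    simp only [star_one, mul_one, star_zero, mul_zero, sub_zero, mul_eq_zero, inv_eq_zero, e1, e2,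
      e3, Complex.I_ne_zero, false_or, Complex.ofReal_eq_zero] at h1 h2 h3
    exact ⟨mul_eq_zero.2 h2, mul_eq_zero.2 h1, mul_eq_zero.2 h3⟩
  · rintro ⟨h1, h2, h3⟩ a b c a' b' c'
    rw [h1, h2, h3]
    refine ⟨?_, ?_, ?_⟩ <;> simp

/-! ### The homogeneous nearly Kähler structure -/

theorem isWeight_half : IsWeight (fun _ => 1 / 2) := by
  refine ⟨?_, ?_, ?_⟩ <;> norm_num

/-- Weights affect only the extension of an endomorphism off the tangent space; this is what lets
`HasMultiplier` demand equality for all weights at once. -/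
theorem tanOp_weight {lam lam' : Fin 3 → ℝ} (hl : IsWeight lam) (hl' : IsWeight lam') {σ : Mat}
    (hσ : σᴴ = σ) {P X : Triple} (hP : P ∈ flagManifold) (hX : X ∈ tangentSpace flagManifold P) :
    tanOp lam σ P X = tanOp lam' σ P X := by
  obtain ⟨u, hu, rfl⟩ := hP
  obtain ⟨a, b, c, rfl⟩ := (mem_tangentSpace_conjAct hu).1 hX
  rw [tanOp_conj hu, tanOp_conj hu, tanOp_isoTan hl hσ, tanOp_isoTan hl' hσ]

theorem tanOp_jMul_isoTan (hl : IsWeight lam) (e : Fin 3 → ℝ) (a b c : ℂ) :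
    tanOp lam (jMul e) baseFlag (isoTan a b c)
      = isoTan (Complex.I * e 0 * a) (Complex.I * e 1 * b) (Complex.I * e 2 * c) := by
  rw [tanOp_isoTan hl (jMul_conjTranspose e)]
  simp [jMul]

theorem isoTan_neg (a b c : ℂ) : -isoTan a b c = isoTan (-a) (-b) (-c) := by
  have h : isoVec (-a) (-b) (-c) = -isoVec a b c := by
    ext i j; fin_cases i <;> fin_cases j <;> simp [isoVec]
  rw [isoTan, isoTan, h]
  exact (fundVecLin.map_neg _).symm

theorem isoForm_pos {r s t : ℝ} (hr : 0 < r) (hs : 0 < s) (ht : 0 < t) {a b c : ℂ}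
    (h : ¬ (a = 0 ∧ b = 0 ∧ c = 0)) : 0 < isoForm r s t a b c a b c := by
  have hn : ∀ z : ℂ, (z * star z).re = Complex.normSq z := fun z => by
    rw [Complex.star_def, Complex.mul_conj]; simp
  rw [isoForm, hn, hn, hn]
  have ha := Complex.normSq_nonneg a
  have hb := Complex.normSq_nonneg b
  have hc := Complex.normSq_nonneg c
  by_contra hle
  push Not at hle
  refine h ⟨?_, ?_, ?_⟩ <;> rw [← Complex.normSq_eq_zero] <;> nlinarith [mul_nonneg hr.le ha, mul_nonneg hs.le hb, mul_nonneg ht.le hc]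

/-- The nearly Kähler structure of the flag manifold. -/
def flagNK : AlmostHermitian flagManifold where
  g := fun _ => gform (fun _ => 1 / 2)
  J := tanOp (fun _ => 1 / 2) (jMul fun _ => 1)
  smooth_g := contDiff_const
  smooth_J := contDiff_tanOp _ _
  g_symm := fun _ _ _ _ _ _ => gform_comm _ _ _
  g_pos := by
    rintro P ⟨u, hu, rfl⟩ X hX h0
    obtain ⟨a, b, c, rfl⟩ := (mem_tangentSpace_conjAct hu).1 hX
    rw [gform_conj hu, gform_isoTan]
    refine isoForm_pos (by norm_num) (by norm_num) (by norm_num) fun h => h0 ?_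
    rw [isoTan_eq_zero.2 h, ← conjActLin_apply, map_zero]
  J_mem := fun P hP X _ => tanOp_mem _ (jMul_conjTranspose _) hP X
  J_sq := by
    rintro P ⟨u, hu, rfl⟩ X hX
    obtain ⟨a, b, c, rfl⟩ := (mem_tangentSpace_conjAct hu).1 hX
    rw [tanOp_conj hu, tanOp_conj hu, tanOp_jMul_isoTan isWeight_half,
      tanOp_jMul_isoTan isWeight_half, ← conjActLin_apply, ← conjActLin_apply, ← map_neg,
      isoTan_neg]
    congr 2 <;> simp [← mul_assoc]
  compat := by
    rintro P ⟨u, hu, rfl⟩ X hX Y hY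
    obtain ⟨a, b, c, rfl⟩ := (mem_tangentSpace_conjAct hu).1 hX
    obtain ⟨a', b', c', rfl⟩ := (mem_tangentSpace_conjAct hu).1 hY
    rw [tanOp_conj hu, tanOp_conj hu, tanOp_jMul_isoTan isWeight_half,
      tanOp_jMul_isoTan isWeight_half, gform_conj hu, gform_conj hu, gform_isoTan, gform_isoTan]
    simp [isoForm]

theorem flagNK_g (P : Triple) : flagNK.g P = gform (fun _ => 1 / 2) := rfl

theorem flagNK_J (P : Triple) : flagNK.J P = tanOp (fun _ => 1 / 2) (jMul fun _ => 1) P := rfl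

theorem flagNK_hasWeight : HasWeight (fun _ => 1 / 2) flagNK.g := fun _ _ _ _ _ _ => rfl

theorem flagNK_hasMultiplier : HasMultiplier (jMul fun _ => 1) flagNK.J := fun _ hl _ hP _ hX =>
  tanOp_weight isWeight_half hl (jMul_conjTranspose _) hP hX

theorem flagNK_isInvariant : IsInvariant flagNK := fun _ hu _ _ _ _ =>
  ⟨fun _ _ => gform_conj hu _ _ _, tanOp_conj hu _ _ _ _⟩

theorem flagNK_isStrictlyNearlyKaehler : flagNK.IsStrictlyNearlyKaehler := by
  rw [AlmostHermitian.IsStrictlyNearlyKaehler,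
    isNearlyKaehler_jMul_iff isWeight_half flagNK_hasWeight flagNK_hasMultiplier,
    isKaehler_jMul_iff isWeight_half flagNK_hasWeight flagNK_hasMultiplier]
  norm_num

/-! ### Invariant structures -/

/-- The isotropy torus acts on the three summands by characters whose product is 1. -/
theorem conj_isoVec_diagonal (d : Fin 3 → ℂ) (a b c : ℂ) :
    conj (Matrix.diagonal d) (isoVec a b c)
      = isoVec (d 1 * star (d 0) * a) (d 0 * star (d 2) * b) (d 2 * star (d 1) * c) := by
  rw [conj_apply, Matrix.diagonal_conjTranspose]
  ext i j
  rw [Matrix.mul_diagonal, Matrix.diagonal_mul]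
  fin_cases i <;> fin_cases j <;> simp [isoVec] <;> ring

theorem diagonal_mem_unitaryGroup {d : Fin 3 → ℂ} (hd : ∀ i, d i * star (d i) = 1) :
    Matrix.diagonal d ∈ Matrix.unitaryGroup (Fin 3) ℂ := by
  rw [Matrix.mem_unitaryGroup_iff, Matrix.star_eq_conjTranspose, Matrix.diagonal_conjTranspose,
    Matrix.diagonal_mul_diagonal, ← Matrix.diagonal_one]
  congr 1
  exact funext hd

theorem conjAct_diagonal_baseFlag {d : Fin 3 → ℂ} (hd : ∀ i, d i * star (d i) = 1) :
    conjAct (Matrix.diagonal d) baseFlag = baseFlag := by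
  funext k
  rw [conjAct_apply, conj_apply, Matrix.diagonal_conjTranspose]
  ext i j
  rw [Matrix.mul_diagonal, Matrix.diagonal_mul]
  simp only [baseFlag, Matrix.single_apply]
  split_ifs with h
  · obtain ⟨rfl, rfl⟩ := h
    rw [mul_one]; exact hd k
  · simp

theorem conjAct_diagonal_isoTan {d : Fin 3 → ℂ} (hd : ∀ i, d i * star (d i) = 1) (a b c : ℂ) :
    conjAct (Matrix.diagonal d) (isoTan a b c)
      = isoTan (d 1 * star (d 0) * a) (d 0 * star (d 2) * b) (d 2 * star (d 1) * c) := by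
  rw [isoTan, isoTan, ← conj_isoVec_diagonal]
  funext k
  have h := congrFun (conjAct_diagonal_baseFlag hd) k
  have hu := diagonal_mem_unitaryGroup hd
  rw [conjAct_apply] at h ⊢
  rw [fundVec, map_sub, conj_mul hu, conj_mul hu, h, fundVec]

theorem isoTan_add (a b c a' b' c' : ℂ) :
    isoTan a b c + isoTan a' b' c' = isoTan (a + a') (b + b') (c + c') := by
  have h : isoVec (a + a') (b + b') (c + c') = isoVec a b c + isoVec a' b' c' := by
    ext i j; fin_cases i <;> fin_cases j <;> simp [isoVec] <;> ring
  rw [isoTan, isoTan, isoTan, h]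
  exact (fundVecLin.map_add _ _).symm

theorem isoTan_smul (r : ℝ) (a b c : ℂ) : r • isoTan a b c = isoTan (r * a) (r * b) (r * c) := by
  have h : isoVec (r * a) (r * b) (r * c) = r • isoVec a b c := by
    ext i j; fin_cases i <;> fin_cases j <;> simp [isoVec]
  rw [isoTan, isoTan, h]
  exact (fundVecLin.map_smul _ _).symm

end

/-! ### Invariant structures through the characters of the isotropy torus -/

section

/-- The parametrization of the tangent space at the standard flag by `ℂ³`. -/
def isoT : (Fin 3 → ℂ) →ₗ[ℝ] Triple where
  toFun v := isoTan (v 0) (v 1) (v 2)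
  map_add' v w := (isoTan_add _ _ _ _ _ _).symm
  map_smul' r v := by
    rw [RingHom.id_apply, isoTan_smul]
    simp

theorem isoT_mem (v : Fin 3 → ℂ) : isoT v ∈ tangentSpace flagManifold baseFlag := isoTan_mem _ _ _

theorem isoT_injective : Function.Injective isoT := by
  rw [← LinearMap.ker_eq_bot, LinearMap.ker_eq_bot']
  intro v hv
  obtain ⟨h0, h1, h2⟩ := isoTan_eq_zero.1 hv
  funext k
  fin_cases k
  exacts [h0, h1, h2]

theorem exists_isoT {X : Triple} (hX : X ∈ tangentSpace flagManifold baseFlag) :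
    ∃ v, X = isoT v := by
  obtain ⟨a, b, c, rfl⟩ := mem_tangentSpace_baseFlag.1 hX
  exact ⟨![a, b, c], rfl⟩

theorem isoT_eq_sum (v : Fin 3 → ℂ) : isoT v = ∑ k, isoT (Pi.single k (v k)) := by
  rw [← map_sum, Finset.univ_sum_single]

/-- The characters of the diagonal torus on `𝔪`. -/
def torusWeight (d : Fin 3 → ℂ) : Fin 3 → ℂ :=
  ![d 1 * star (d 0), d 0 * star (d 2), d 2 * star (d 1)]

theorem conjAct_diagonal_isoT {d : Fin 3 → ℂ} (hd : ∀ i, d i * star (d i) = 1) (v : Fin 3 → ℂ) :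
    conjAct (Matrix.diagonal d) (isoT v) = isoT (torusWeight d * v) :=
  conjAct_diagonal_isoTan hd _ _ _

/-- Since the three characters multiply to 1, signs can be reversed only in pairs. Such an element
separates one summand from the other two. -/
theorem exists_torus_neg (k : Fin 3) : ∃ d : Fin 3 → ℂ, (∀ i, d i * star (d i) = 1) ∧
    torusWeight d k = 1 ∧ ∀ j, j ≠ k → torusWeight d j = -1 := by
  fin_cases k
  · exact ⟨![1, 1, -1], by simp [Fin.forall_fin_succ], by simp [torusWeight],
      by simp [torusWeight, Fin.forall_fin_succ]⟩
  · exact ⟨![1, -1, 1], by simp [Fin.forall_fin_succ], by simp [torusWeight],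
      by simp [torusWeight, Fin.forall_fin_succ]⟩
  · exact ⟨![-1, 1, 1], by simp [Fin.forall_fin_succ], by simp [torusWeight],
      by simp [torusWeight, Fin.forall_fin_succ]⟩

theorem exists_torus_I (k : Fin 3) : ∃ d : Fin 3 → ℂ, (∀ i, d i * star (d i) = 1) ∧
    torusWeight d k = Complex.I := by
  fin_cases k
  · exact ⟨![1, Complex.I, 1], by simp [Fin.forall_fin_succ], by simp [torusWeight]⟩
  · exact ⟨![Complex.I, 1, 1], by simp [Fin.forall_fin_succ], by simp [torusWeight]⟩
  · exact ⟨![1, 1, Complex.I], by simp [Fin.forall_fin_succ], by simp [torusWeight]⟩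

theorem torusWeight_mul_single (d : Fin 3 → ℂ) (k : Fin 3) (z : ℂ) :
    torusWeight d * Pi.single k z = Pi.single k (torusWeight d k * z) := by
  funext j
  rcases eq_or_ne j k with rfl | h
  · simp
  · simp [h]

variable {A : AlmostHermitian flagManifold}

theorem IsInvariant.g_torus (hA : IsInvariant A) {d : Fin 3 → ℂ} (hd : ∀ i, d i * star (d i) = 1)
    (v w : Fin 3 → ℂ) : A.g baseFlag (isoT (torusWeight d * v)) (isoT (torusWeight d * w))
      = A.g baseFlag (isoT v) (isoT w) := by
  have h := (hA _ (diagonal_mem_unitaryGroup hd) baseFlag baseFlag_mem _ (isoT_mem v)).1 _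
    (isoT_mem w)
  rwa [conjAct_diagonal_baseFlag hd, conjAct_diagonal_isoT hd, conjAct_diagonal_isoT hd] at h

theorem IsInvariant.J_torus (hA : IsInvariant A) {d : Fin 3 → ℂ} (hd : ∀ i, d i * star (d i) = 1)
    (v : Fin 3 → ℂ) : A.J baseFlag (isoT (torusWeight d * v))
      = conjAct (Matrix.diagonal d) (A.J baseFlag (isoT v)) := by
  have h := (hA _ (diagonal_mem_unitaryGroup hd) baseFlag baseFlag_mem _ (isoT_mem v)).2
  rwa [conjAct_diagonal_baseFlag hd, conjAct_diagonal_isoT hd] at h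

/-- A torus element acting by 1 on summand k and by -1 on summand l makes the pairing equal to its
negative. -/
theorem IsInvariant.g_single_of_ne (hA : IsInvariant A) {k l : Fin 3} (h : k ≠ l) (z w : ℂ) :
    A.g baseFlag (isoT (Pi.single k z)) (isoT (Pi.single l w)) = 0 := by
  obtain ⟨d, hd, hw, hw'⟩ := exists_torus_neg k
  have e := hA.g_torus hd (Pi.single k z) (Pi.single l w)
  rw [torusWeight_mul_single, torusWeight_mul_single, hw, hw' l h.symm, one_mul,
    neg_one_mul, Pi.single_neg, map_neg, map_neg] at e
  linarith

/-- Some torus element acts on the summand as multiplication by i. A scalar product on ℂ preserved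
by i has 1 and i orthogonal and of equal length, so it is a multiple of the standard one. -/
theorem IsInvariant.exists_g_single (hA : IsInvariant A) (k : Fin 3) : ∃ r : ℝ, 0 < r ∧
    ∀ z w, A.g baseFlag (isoT (Pi.single k z)) (isoT (Pi.single k w)) = r * (z * star w).re := by
  obtain ⟨d, hd, hw⟩ := exists_torus_I k
  let φ : ℂ →ₗ[ℝ] Triple := isoT.comp (LinearMap.single ℝ (fun _ => ℂ) k)
  have hφ : ∀ z, φ z = isoT (Pi.single k z) := fun z => rfl
  have inv : ∀ z w, A.g baseFlag (φ (Complex.I * z)) (φ (Complex.I * w))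
      = A.g baseFlag (φ z) (φ w) := by
    intro z w
    have e := hA.g_torus hd (Pi.single k z) (Pi.single k w)
    rwa [torusWeight_mul_single, torusWeight_mul_single, hw] at e
  have symm : ∀ z w, A.g baseFlag (φ z) (φ w) = A.g baseFlag (φ w) (φ z) := fun z w =>
    A.g_symm _ baseFlag_mem _ (isoT_mem _) _ (isoT_mem _)
  have hI : A.g baseFlag (φ Complex.I) (φ Complex.I) = A.g baseFlag (φ 1) (φ 1) := by
    simpa using inv 1 1
  have h0 : A.g baseFlag (φ 1) (φ Complex.I) = 0 := by
    have e := inv 1 Complex.I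
    rw [mul_one, Complex.I_mul_I, map_neg, map_neg, symm] at e
    linarith
  have h0' : A.g baseFlag (φ Complex.I) (φ 1) = 0 := by rw [symm, h0]
  have hz : ∀ z : ℂ, φ z = z.re • φ 1 + z.im • φ Complex.I := by
    intro z
    rw [← map_smul, ← map_smul, ← map_add]
    congr 1
    simp
  refine ⟨A.g baseFlag (φ 1) (φ 1), A.g_pos _ baseFlag_mem _ (isoT_mem _) fun h => ?_, ?_⟩
  · have := isoT_injective (h.trans (map_zero isoT).symm)
    have h1 := congrFun this k
    simp at h1
  · intro z w
    rw [← hφ, ← hφ, hz z, hz w]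
    simp only [map_add, map_smul, add_apply, smul_apply, smul_eq_mul, hI, h0, h0']
    simp
    ring

theorem IsInvariant.exists_weights (hA : IsInvariant A) : ∃ r : Fin 3 → ℝ, (∀ k, 0 < r k) ∧
    ∀ v w, A.g baseFlag (isoT v) (isoT w) = ∑ k, r k * (v k * star (w k)).re := by
  choose r hr h using hA.exists_g_single
  refine ⟨r, hr, fun v w => ?_⟩
  rw [isoT_eq_sum v, isoT_eq_sum w, map_sum (A.g baseFlag), sum_apply]
  refine Finset.sum_congr rfl fun k _ => ?_
  rw [map_sum, Finset.sum_eq_single k, h]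
  · intro l _ hl
    exact hA.g_single_of_ne hl.symm _ _
  · simp

/-- J commutes with the element fixing summand k and negating the others, so it preserves that
summand. There it commutes with i, so it is multiplication by a complex number, whose square is -1.
-/
theorem IsInvariant.exists_J_single (hA : IsInvariant A) (k : Fin 3) : ∃ e : ℝ, (e = 1 ∨ e = -1) ∧
    ∀ z, A.J baseFlag (isoT (Pi.single k z)) = isoT (Pi.single k (Complex.I * e * z)) := by
  have h1 : ∀ z, ∃ w, A.J baseFlag (isoT (Pi.single k z)) = isoT (Pi.single k w) := by
    intro z
    obtain ⟨d, hd, hw, hw'⟩ := exists_torus_neg k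
    obtain ⟨v, hv⟩ := exists_isoT (A.J_mem _ baseFlag_mem _ (isoT_mem (Pi.single k z)))
    have e := hA.J_torus hd (Pi.single k z)
    rw [torusWeight_mul_single, hw, one_mul, hv, conjAct_diagonal_isoT hd] at e
    have e' := isoT_injective e
    refine ⟨v k, hv.trans (congrArg isoT ?_)⟩
    funext j
    rcases eq_or_ne j k with rfl | hj
    · simp
    · have := congrFun e' j
      rw [Pi.mul_apply, hw' j hj, neg_one_mul] at this
      rw [Pi.single_eq_of_ne hj]
      exact self_eq_neg.1 this
  choose p hp using h1
  have inj : ∀ {z w : ℂ}, isoT (Pi.single k z) = isoT (Pi.single k w) → z = w := fun h =>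
    Pi.single_injective k (isoT_injective h)
  have hadd : ∀ z w, p (z + w) = p z + p w := by
    intro z w
    apply inj
    rw [← hp, Pi.single_add, map_add, map_add, hp, hp, Pi.single_add, map_add]
  have hsmul : ∀ (r : ℝ) z, p (r * z) = r * p z := by
    intro r z
    apply inj
    have e : ∀ z : ℂ, isoT (Pi.single k ((r : ℂ) * z)) = r • isoT (Pi.single k z) := by
      intro z
      rw [← map_smul, ← Pi.single_smul]
      rfl
    rw [← hp, e, map_smul, hp, e]
  have hI : ∀ z, p (Complex.I * z) = Complex.I * p z := by
    intro z
    obtain ⟨d, hd, hw⟩ := exists_torus_I k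
    have e := hA.J_torus hd (Pi.single k z)
    rw [torusWeight_mul_single, hw, hp, hp, conjAct_diagonal_isoT hd, torusWeight_mul_single,
      hw] at e
    exact inj e
  have hlin : ∀ z, p z = p 1 * z := by
    intro z
    have hz : z = z.re * 1 + z.im * (Complex.I * 1) := by
      rw [mul_one, mul_one, Complex.re_add_im]
    conv_lhs => rw [hz, hadd, hsmul, hsmul, hI]
    conv_rhs => rw [hz]
    ring
  have hsq : p 1 * p 1 = -1 := by
    rw [← hlin]
    apply inj
    have e := A.J_sq _ baseFlag_mem _ (isoT_mem (Pi.single k 1))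
    rw [hp, hp, ← map_neg, ← Pi.single_neg] at e
    exact e
  have hfac : (p 1 - Complex.I) * (p 1 + Complex.I) = 0 := by
    linear_combination hsq - Complex.I_mul_I
  rcases mul_eq_zero.1 hfac with h | h
  · refine ⟨1, Or.inl rfl, fun z => ?_⟩
    rw [hp, hlin, sub_eq_zero.1 h]; simp
  · refine ⟨-1, Or.inr rfl, fun z => ?_⟩
    rw [hp, hlin, eq_neg_of_add_eq_zero_left h]; simp

theorem IsInvariant.exists_signs (hA : IsInvariant A) : ∃ e : Fin 3 → ℝ,
    (∀ k, e k = 1 ∨ e k = -1) ∧ HasMultiplier (jMul e) A.J := by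
  choose e he h using hA.exists_J_single
  refine ⟨e, he, ?_⟩
  rintro lam hl P ⟨u, hu, rfl⟩ X hX
  obtain ⟨a, b, c, rfl⟩ := (mem_tangentSpace_conjAct hu).1 hX
  rw [(hA u hu baseFlag baseFlag_mem _ (isoTan_mem a b c)).2, tanOp_conj hu, tanOp_jMul_isoTan hl]
  congr 1
  have h1 := isoT_eq_sum ![a, b, c]
  have h2 := isoT_eq_sum ![Complex.I * e 0 * a, Complex.I * e 1 * b, Complex.I * e 2 * c]
  change A.J baseFlag (isoT ![a, b, c]) = isoT ![_, _, _]
  rw [h1, h2, map_sum]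
  refine Finset.sum_congr rfl fun k _ => ?_
  rw [h]
  fin_cases k <;> rfl

/-- The weights solve lam 0 + lam 1 = r, lam 0 + lam 2 = s, lam 1 + lam 2 = t; invariance carries
the formula to all flags. -/
theorem IsInvariant.hasWeight (hA : IsInvariant A) {r s t : ℝ}
    (h : ∀ a b c a' b' c', A.g baseFlag (isoTan a b c) (isoTan a' b' c')
      = isoForm r s t a b c a' b' c') :
    HasWeight ![(r + s - t) / 2, (r + t - s) / 2, (s + t - r) / 2] A.g := by
  rintro P ⟨u, hu, rfl⟩ X hX Y hY
  obtain ⟨a, b, c, rfl⟩ := (mem_tangentSpace_conjAct hu).1 hX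
  obtain ⟨a', b', c', rfl⟩ := (mem_tangentSpace_conjAct hu).1 hY
  rw [(hA u hu baseFlag baseFlag_mem _ (isoTan_mem a b c)).1 _ (isoTan_mem a' b' c'), h,
    gform_conj hu, gform_isoTan]
  simp
  congr 1 <;> ring

theorem IsInvariant.exists_isoForm (hA : IsInvariant A) : ∃ r s t : ℝ, 0 < r ∧ 0 < s ∧ 0 < t ∧
    ∀ a b c a' b' c', A.g baseFlag (isoTan a b c) (isoTan a' b' c')
      = isoForm r s t a b c a' b' c' := by
  obtain ⟨r, hr, h⟩ := hA.exists_weights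
  refine ⟨r 0, r 1, r 2, hr 0, hr 1, hr 2, fun a b c a' b' c' => ?_⟩
  refine (h ![a, b, c] ![a', b', c']).trans ?_
  rw [Fin.sum_univ_three]
  rfl

/-- An invariant strictly nearly Kähler structure is proportional to the standard one. -/
theorem IsInvariant.proportionalUpToSign (hA : IsInvariant A) (hn : A.IsStrictlyNearlyKaehler) :
    A.ProportionalUpToSign flagNK := by
  obtain ⟨r, s, t, hr, hs, ht, hg⟩ := hA.exists_isoForm
  obtain ⟨e, he, hJ⟩ := hA.exists_signs
  have hw := hA.hasWeight hg
  set lam : Fin 3 → ℝ := ![(r + s - t) / 2, (r + t - s) / 2, (s + t - r) / 2] with hlam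
  have l0 : lam 0 = (r + s - t) / 2 := rfl
  have l1 : lam 1 = (r + t - s) / 2 := rfl
  have l2 : lam 2 = (s + t - r) / 2 := rfl
  have hl : IsWeight lam := ⟨by linarith, by linarith, by linarith⟩
  rw [AlmostHermitian.IsStrictlyNearlyKaehler, isNearlyKaehler_jMul_iff hl hw hJ,
    isKaehler_jMul_iff hl hw hJ] at hn
  obtain ⟨⟨n1, n2⟩, n3⟩ := hn
  -- If the signs differ, two of the κ contain a sum of opposite signs and vanish. The nearly Kähler
  -- equations then kill the third, contradicting that the structure is not Kähler.
  have hee : (e 0 = 1 ∧ e 1 = 1 ∧ e 2 = 1) ∨ (e 0 = -1 ∧ e 1 = -1 ∧ e 2 = -1) := by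
    rcases he 0 with h0 | h0 <;> rcases he 1 with h1 | h1 <;> rcases he 2 with h2 | h2 <;>
      rw [h0, h1, h2] at n1 n2 n3 <;> first
      | exact Or.inl ⟨h0, h1, h2⟩
      | exact Or.inr ⟨h0, h1, h2⟩
      | exact absurd ⟨by linarith, by linarith, by linarith⟩ n3
  have hrst : lam 0 = lam 1 ∧ lam 2 = lam 0 := by
    rcases hee with ⟨h0, h1, h2⟩ | ⟨h0, h1, h2⟩ <;> rw [h0, h1, h2] at n1 n2 <;>
      exact ⟨by linarith, by linarith⟩
  refine ⟨⟨r, hr, fun P hP X hX Y hY => ?_⟩, ?_⟩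
  · rw [hw P hP X hX Y hY, flagNK_g, gform_apply, gform_apply, Finset.mul_sum]
    refine Finset.sum_congr rfl fun k _ => ?_
    have : lam k = r * (1 / 2) := by fin_cases k <;> simp only [Fin.zero_eta, Fin.mk_one,
      Fin.reduceFinMk] <;> linarith
    rw [this, mul_assoc]
  · have key : ∀ c : ℝ, e = (fun _ => c) → ∀ P ∈ flagManifold,
        ∀ X ∈ tangentSpace flagManifold P, A.J P X = c • flagNK.J P X := by
      rintro c rfl P hP X hX
      rw [hJ _ isWeight_half P hP X hX, flagNK_J]
      obtain ⟨u, hu, rfl⟩ := hP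
      obtain ⟨x, y, z, rfl⟩ := (mem_tangentSpace_conjAct hu).1 hX
      rw [tanOp_conj hu, tanOp_conj hu, tanOp_jMul_isoTan isWeight_half,
        tanOp_jMul_isoTan isWeight_half, ← conjActLin_apply, ← conjActLin_apply, ← map_smul,
        isoTan_smul]
      congr 2 <;> push_cast <;> ring
    have hc : ∀ c : ℝ, e 0 = c ∧ e 1 = c ∧ e 2 = c → e = fun _ => c := by
      rintro c ⟨h0, h1, h2⟩
      funext k
      fin_cases k
      exacts [h0, h1, h2]
    rcases hee with h | h
    · exact Or.inl fun P hP X hX => by rw [key 1 (hc 1 h) P hP X hX, one_smul]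
    · exact Or.inr fun P hP X hX => by rw [key (-1) (hc (-1) h) P hP X hX, neg_one_smul]

/-! ### Naturally reductive metrics -/

theorem isoPart_bracket (a b c a' b' c' : ℂ) :
    isoPart (isoVec a b c * isoVec a' b' c' - isoVec a' b' c' * isoVec a b c)
      = isoVec (star c * star b' - star c' * star b) (star a * star c' - star a' * star c)
        (star b * star a' - star b' * star a) := by
  ext i j
  fin_cases i <;> fin_cases j <;>
    simp [isoPart, isoVec, Matrix.diagonal] <;> ring

theorem isNaturallyReductive_iff {r s t : ℝ}
    (h : ∀ a b c a' b' c', metricOnIso A (isoVec a b c) (isoVec a' b' c')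
      = isoForm r s t a b c a' b' c') : IsNaturallyReductive A ↔ r = s ∧ s = t := by
  constructor
  · intro hN
    -- Unit vectors from three different summands: the first choice compares r with s, the second s
    -- with t.
    have e1 := hN _ ⟨0, 0, 1, rfl⟩ _ ⟨1, 0, 0, rfl⟩ _ ⟨0, 1, 0, rfl⟩
    have e2 := hN _ ⟨1, 0, 0, rfl⟩ _ ⟨0, 1, 0, rfl⟩ _ ⟨0, 0, 1, rfl⟩
    rw [isoPart_bracket, isoPart_bracket, h, h] at e1 e2
    simp [isoForm] at e1 e2
    constructor <;> linarith
  · rintro ⟨rfl, rfl⟩ _ ⟨a, b, c, rfl⟩ _ ⟨a', b', c', rfl⟩ _ ⟨a'', b'', c'', rfl⟩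
    rw [isoPart_bracket, isoPart_bracket, h, h]
    simp [isoForm]
    ring

end

/-! ### The derivative of the twistor map -/

theorem twistorMap_snd_apply (a : Fin 3) (P : Triple) (Y : Mat) :
    (twistorMap a P).2 Y = Complex.I • ((P (a + 1) - P (a + 2)) * hermPart Y * P a
      - P a * hermPart Y * (P (a + 1) - P (a + 2))) := by
  simp only [twistorMap, ContinuousLinearMap.comp_apply, add_apply, sub_apply,
    ContinuousLinearMap.mulLeftRight_apply, smul_mul_assoc, mul_sub, sub_mul, smul_sub]
  abel

/-- The derivative of the complex structure `twistorMap a P` in the direction `X`, applied to a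
Hermitian matrix `H`. -/
def dtwistor (a : Fin 3) (P X : Triple) (H : Mat) : Mat :=
  Complex.I • ((X (a + 1) - X (a + 2)) * H * P a + (P (a + 1) - P (a + 2)) * H * X a
    - (X a * H * (P (a + 1) - P (a + 2)) + P a * H * (X (a + 1) - X (a + 2))))

theorem differentiable_twistorMap (a : Fin 3) : Differentiable ℝ (twistorMap a) := by
  have h : ∀ k, ContDiff ℝ ∞ (fun P : Triple => P k) := fun k => contDiff_apply ℝ Mat k
  have h2 : ContDiff ℝ ∞ (twistorMap a) := by
    unfold twistorMap
    fun_prop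
  exact h2.differentiable (by simp)

theorem fderiv_twistorMap_fst (a : Fin 3) (P X : Triple) :
    (fderiv ℝ (twistorMap a) P X).1 = X a := by
  have h1 := (differentiable_twistorMap a P).hasFDerivAt.fst
  have h2 : HasFDerivAt (fun Q : Triple => (twistorMap a Q).1)
    (ContinuousLinearMap.proj a : Triple →L[ℝ] Mat) P := hasFDerivAt_apply a P
  exact congrArg (fun L : Triple →L[ℝ] Mat => L X) (h1.unique h2)

theorem hasDerivAt_twistorMap_snd (a : Fin 3) (P X : Triple) (Y : Mat) :
    HasDerivAt (fun t : ℝ => (twistorMap a (P + t • X)).2 Y) (dtwistor a P X (hermPart Y)) 0 := by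
  have hk : ∀ k, HasDerivAt (fun t : ℝ => (P + t • X) k) (X k) 0 :=
    hasDerivAt_pi.1 (hasDerivAt_line P X)
  have h0 : ∀ k, (P + (0 : ℝ) • X) k = P k := fun k => by rw [zero_smul, add_zero]
  have hs := (hk (a + 1)).sub (hk (a + 2))
  have h1 := (hs.mul_const (hermPart Y)).mul (hk a)
  have h2 := ((hk a).mul_const (hermPart Y)).mul hs
  simp only [Pi.sub_apply, h0] at h1 h2
  simp only [twistorMap_snd_apply]
  exact (h1.sub h2).const_smul Complex.I

theorem fderiv_twistorMap_snd (a : Fin 3) (P X : Triple) (Y : Mat) :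
    (fderiv ℝ (twistorMap a) P X).2 Y = dtwistor a P X (hermPart Y) := by
  have hd : HasFDerivAt (twistorMap a) (fderiv ℝ (twistorMap a) P) (P + (0 : ℝ) • X) := by
    rw [zero_smul, add_zero]
    exact (differentiable_twistorMap a P).hasFDerivAt
  have h1 : HasDerivAt (fun t : ℝ => (twistorMap a (P + t • X)).2)
      (fderiv ℝ (twistorMap a) P X).2 0 := by
    have hs := hd.snd
    exact HasFDerivAt.comp_hasDerivAt (0 : ℝ) hs (hasDerivAt_line P X)
  have h2 : HasDerivAt (fun t : ℝ => (twistorMap a (P + t • X)).2 Y)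
      ((fderiv ℝ (twistorMap a) P X).2 Y) 0 :=
    (ContinuousLinearMap.apply ℝ Mat Y).hasFDerivAt.comp_hasDerivAt (0 : ℝ) h1
  exact h2.unique (hasDerivAt_twistorMap_snd a P X Y)

theorem tanProj_conj {u : Mat} (hu : u ∈ Matrix.unitaryGroup (Fin 3) ℂ) (P X : Mat) :
    tanProj (conj u P) (conj u X) = conj u (tanProj P X) := by
  simp only [tanProj_apply, hermPart_conj, map_sub, map_add, map_smul, conj_mul hu]

theorem dtwistor_conj {u : Mat} (hu : u ∈ Matrix.unitaryGroup (Fin 3) ℂ) (a : Fin 3)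
    (P X : Triple) (H : Mat) : dtwistor a (conjAct u P) (conjAct u X) (conj u H)
      = conj u (dtwistor a P X H) := by
  simp only [dtwistor, conjAct_apply, conj_smul, map_sub, map_add, conj_mul hu]

/-- The projection keeps row a and column a of the Hermitian part except their common entry, that is
Hom(ℓ, ℓ^⊥) and its adjoint. -/
theorem tanProj_baseFlag_apply (a : Fin 3) (X : Mat) (k l : Fin 3) :
    tanProj (baseFlag a) X k l
      = if k = a then (if l = a then 0 else hermPart X k l)
        else (if l = a then hermPart X k l else 0) := by
  rw [tanProj_apply, Matrix.sub_apply, Matrix.add_apply, Matrix.smul_apply]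
  simp only [mul_baseFlag_apply, baseFlag_mul_apply]
  split_ifs with h1 h2 h2
  · rw [h1, h2, two_smul]; abel
  · rw [h1]; simp
  · rw [h2]; simp
  · simp

/-- The matrix which defines the vertical part of the image of `X` in the twistor space. -/
def vertMat (a : Fin 3) (P X : Triple) : Mat :=
  (2 * Complex.I) • (P (a + 2) * X (a + 1) * P (a + 1) + P (a + 1) * X (a + 1) * P (a + 2))

theorem vertMat_conj {u : Mat} (hu : u ∈ Matrix.unitaryGroup (Fin 3) ℂ) (a : Fin 3)
    (P X : Triple) : vertMat a (conjAct u P) (conjAct u X) = conj u (vertMat a P X) := by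
  simp only [vertMat, conjAct_apply, conj_smul, map_add, conj_mul hu]

theorem vertMat_isoTan_apply (a : Fin 3) (x y z : ℂ) : vertMat a baseFlag (isoTan x y z) =
    (2 * Complex.I) • ![!![0, 0, 0; 0, 0, star z; 0, z, 0], !![0, 0, y; 0, 0, 0; star y, 0, 0],
      !![0, star x, 0; x, 0, 0; 0, 0, 0]] a := by
  rw [vertMat]
  congr 1
  ext k l
  rw [Matrix.add_apply, mul_baseFlag_apply, baseFlag_mul_apply, mul_baseFlag_apply,
    baseFlag_mul_apply]
  fin_cases a <;> fin_cases k <;> fin_cases l <;>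
    simp [isoTan_zero, isoTan_one, isoTan_two]

/-- In the derivative of H ↦ i(KHP - PHK), the terms containing the derivative of P map into blocks
that the tangential projection removes. What remains is i times the derivative of K, compressed to
ℓ^⊥. There X (a+1) + X (a+2) = -X a compresses to zero, so X (a+1) - X (a+2) becomes 2 X (a+1): this
is the 2i in `vertMat`. -/
theorem vertPart_twistorMap_baseFlag (a : Fin 3) (x y z : ℂ) (H : Mat) (hH : Hᴴ = H) :
    tanProj (baseFlag a) (dtwistor a baseFlag (isoTan x y z) (tanProj (baseFlag a) H))
      = vertMat a baseFlag (isoTan x y z) * H * baseFlag a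
        - baseFlag a * H * vertMat a baseFlag (isoTan x y z) := by
  have hP := flag_mem_projectivePlane baseFlag_mem a
  set Z := dtwistor a baseFlag (isoTan x y z) (tanProj (baseFlag a) H) with hZ
  have hZh : hermPart Z = Z := by
    have h1 := (tangentSpace_flag_equations (isoTan_mem x y z)).1
    have h2 := ((mem_tangentSpace_projectivePlane hP _).1 (tanProj_mem hP H)).1
    have h0 := flag_isHermitian baseFlag_mem
    apply hermPart_of_conjTranspose
    simp only [hZ, dtwistor, Matrix.conjTranspose_smul, Matrix.conjTranspose_sub,
      Matrix.conjTranspose_add, Matrix.conjTranspose_mul, h1, h2, h0, Complex.star_def,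
      Complex.conj_I, neg_smul, ← smul_neg]
    congr 1
    noncomm_ring
  have hT : ∀ k l, tanProj (baseFlag a) H k l = if k = a then (if l = a then 0 else H k l)
        else (if l = a then H k l else 0) := by
    intro k l
    rw [tanProj_baseFlag_apply, hermPart_of_conjTranspose hH]
  ext k l
  rw [tanProj_baseFlag_apply, hZh, hZ, vertMat_isoTan_apply, dtwistor]
  simp only [Matrix.smul_apply, Matrix.add_apply, Matrix.sub_apply, Matrix.mul_apply, Fin.sum_univ_three, sub_mul, mul_sub, hT]
  fin_cases a <;> fin_cases k <;> fin_cases l <;>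
    simp [isoTan_zero, isoTan_one, isoTan_two, baseFlag] <;> ring

theorem vertPart_twistorMap (a : Fin 3) {P X : Triple} (hP : P ∈ flagManifold)
    (hX : X ∈ tangentSpace flagManifold P) (Y : Mat) :
    vertPart (twistorMap a P) (fderiv ℝ (twistorMap a) P X) Y
      = vertMat a P X * hermPart Y * P a - P a * hermPart Y * vertMat a P X := by
  have hPa := flag_mem_projectivePlane hP a
  have h1 : ∀ Z, tanProj (P a) Z = tanProj (P a) (hermPart Z) := fun Z => by
    rw [tanProj_apply, tanProj_apply, hermPart_of_conjTranspose (hermPart_isHermitian Z)]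
  have h2 : ∀ Z, hermPart (tanProj (P a) Z) = tanProj (P a) Z := fun Z =>
    hermPart_of_conjTranspose ((mem_tangentSpace_projectivePlane hPa _).1 (tanProj_mem hPa Z)).1
  have h3 : vertPart (twistorMap a P) (fderiv ℝ (twistorMap a) P X) Y
      = tanProj (P a) (dtwistor a P X (tanProj (P a) (hermPart Y))) := by
    rw [← h1 Y, ← h2 Y, ← fderiv_twistorMap_snd]
    rfl
  rw [h3]
  obtain ⟨u, hu, rfl⟩ := hP
  obtain ⟨x, y, z, rfl⟩ := (mem_tangentSpace_conjAct hu).1 hX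
  have h4 : hermPart Y = conj u (hermPart (conj uᴴ Y)) := by
    rw [← hermPart_conj, conj_apply, conj_apply, Matrix.conjTranspose_conjTranspose]
    congr 1
    calc Y = (u * uᴴ) * Y * (u * uᴴ) := by rw [unitary_mul_star hu, one_mul, mul_one]
      _ = _ := by noncomm_ring
  rw [h4, conjAct_apply, tanProj_conj hu, dtwistor_conj hu, tanProj_conj hu, vertMat_conj hu,
    vertPart_twistorMap_baseFlag a x y z _ (hermPart_isHermitian _)]
  simp only [map_sub, conj_mul hu]

/-! ### Traces of real-linear endomorphisms -/

theorem trace_mat (φ : Mat →ₗ[ℝ] Mat) : LinearMap.trace ℝ Mat φ =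
    ∑ i, ∑ j, ((φ (Matrix.single i j 1) i j).re + (φ (Matrix.single i j Complex.I) i j).im) := by
  rw [LinearMap.trace_eq_matrix_trace ℝ
    (Complex.basisOneI.smulTower (Matrix.stdBasis ℂ (Fin 3) (Fin 3)))]
  simp only [Matrix.trace, Matrix.diag_apply, LinearMap.toMatrix_apply,
    Module.Basis.smulTower_repr, Module.Basis.smulTower_apply]
  rw [Fintype.sum_prod_type_right, Fintype.sum_prod_type]
  refine Finset.sum_congr rfl fun i _ => Finset.sum_congr rfl fun j _ => ?_
  rw [Fin.sum_univ_two]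
  simp [Matrix.stdBasis_eq_single]
  rfl

section

/-- `hermPart` is half the identity plus half the adjoint. The adjoint half is antilinear, so its
contributions on E and iE cancel; the identity half contributes Re of the product of the traces. -/
theorem trace_hermPart_sandwich {φ : Mat →ₗ[ℝ] Mat} {A B C : Mat}
    (h : ∀ Y, φ Y = A * hermPart Y * B + B * hermPart Y * C) :
    LinearMap.trace ℝ Mat φ = (A.trace * B.trace).re + (B.trace * C.trace).re := by
  have key : ∀ A B : Mat, ∀ i j,
      ((A * hermPart (Matrix.single i j 1) * B) i j).re
        + ((A * hermPart (Matrix.single i j Complex.I) * B) i j).im = (A i i * B j j).re := by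
    intro A B i j
    have e : ∀ (c : ℂ) (k l : Fin 3), (A * Matrix.single k l c * B) i j = A i k * c * B l j := by
      intro c k l
      simp [Matrix.mul_apply, Matrix.single_apply, ite_and]
    rw [hermPart_apply, hermPart_apply, Matrix.conjTranspose_single, Matrix.conjTranspose_single]
    simp only [mul_smul_comm, smul_mul_assoc, mul_add, add_mul, Matrix.smul_apply,
      Matrix.add_apply, e]
    simp
    ring
  have tr : ∀ A B : Mat, (A.trace * B.trace).re = ∑ i, ∑ j, (A i i * B j j).re := by
    intro A B
    simp only [Matrix.trace, Matrix.diag_apply, Finset.sum_mul_sum, Complex.re_sum]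
  rw [trace_mat, tr, tr, ← Finset.sum_add_distrib]
  refine Finset.sum_congr rfl fun i _ => ?_
  rw [← Finset.sum_add_distrib]
  refine Finset.sum_congr rfl fun j _ => ?_
  rw [h, h, Matrix.add_apply, Matrix.add_apply, ← key, ← key, Complex.add_re, Complex.add_im]
  ring

/-! ### The pullback of the twistor metrics -/

theorem vertMat_mul {P : Triple} (hP : P ∈ flagManifold) (a : Fin 3) (X : Triple) :
    vertMat a P X * P a = 0 ∧ P a * vertMat a P X = 0 := by
  have h : ∀ k l, k ≠ l → P k * P l = 0 := fun k l h => by rw [flag_mul hP, if_neg h]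
  have e1 : a + 1 ≠ a := by simp
  have e2 : a + 2 ≠ a := by simp
  simp only [vertMat, smul_mul_assoc, mul_smul_comm, add_mul, mul_add]
  simp only [mul_assoc, h _ _ e1, h _ _ e2]
  simp only [← mul_assoc, h _ _ e1.symm, h _ _ e2.symm]
  simp

theorem vertMat_conjTranspose {P X : Triple} (hP : P ∈ flagManifold)
    (hX : X ∈ tangentSpace flagManifold P) (a : Fin 3) :
    (vertMat a P X)ᴴ = -vertMat a P X := by
  have h := (tangentSpace_flag_equations hX).1
  simp only [vertMat, Matrix.conjTranspose_smul, Matrix.conjTranspose_add,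
    Matrix.conjTranspose_mul, h, flag_isHermitian hP]
  rw [add_comm, ← neg_smul]
  congr 1
  · simp
  · simp only [mul_assoc]

theorem hermPart_vertical {P X : Triple} (hP : P ∈ flagManifold)
    (hX : X ∈ tangentSpace flagManifold P) (a : Fin 3) (Y : Mat) :
    hermPart (vertMat a P X * hermPart Y * P a - P a * hermPart Y * vertMat a P X)
      = vertMat a P X * hermPart Y * P a - P a * hermPart Y * vertMat a P X := by
  apply hermPart_of_conjTranspose
  simp only [Matrix.conjTranspose_sub, Matrix.conjTranspose_mul, vertMat_conjTranspose hP hX,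
    hermPart_isHermitian, flag_isHermitian hP]
  noncomm_ring

/-- Because L and L' annihilate the line, the mixed terms drop and a product of two vertical
endomorphisms again has the shape whose trace is known. -/
theorem sandwich_comp {R : Type*} [Ring R] {L L' P : R} (h1 : L * P = 0) (h2 : P * L = 0)
    (h3 : L' * P = 0) (h4 : P * L' = 0) (hP : P * P = P) (H : R) :
    L * (L' * H * P - P * H * L') * P - P * (L' * H * P - P * H * L') * L
      = L * L' * H * P + P * H * (L' * L) := by
  calc _ = L * L' * H * (P * P) - (L * P) * H * (L' * P) - (P * L') * H * (P * L)
        + (P * P) * H * (L' * L) := by noncomm_ring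
    _ = _ := by rw [h1, h2, h3, h4, hP]; simp

/-- Both terms of the trace formula give Re tr(L L'), as P a has trace 1; this turns 1/16 into 1/8.
-/
theorem twistorMetric_twistorMap (t : ℝ) (a : Fin 3) {P X Y : Triple} (hP : P ∈ flagManifold)
    (hX : X ∈ tangentSpace flagManifold P) (hY : Y ∈ tangentSpace flagManifold P) :
    twistorMetric t (twistorMap a P) (fderiv ℝ (twistorMap a) P X) (fderiv ℝ (twistorMap a) P Y)
      = fsMetric (X a) (Y a) - t / 8 * (vertMat a P X * vertMat a P Y).trace.re := by
  rw [twistorMetric, fderiv_twistorMap_fst, fderiv_twistorMap_fst,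
    trace_hermPart_sandwich (A := vertMat a P X * vertMat a P Y) (B := P a)
      (C := vertMat a P Y * vertMat a P X), flag_trace hP, Matrix.trace_mul_comm (vertMat a P Y)]
  · simp
    ring
  · intro Z
    rw [ContinuousLinearMap.coe_coe, ContinuousLinearMap.comp_apply,
      vertPart_twistorMap a hP hY, vertPart_twistorMap a hP hX, hermPart_vertical hP hY]
    obtain ⟨h1, h2⟩ := vertMat_mul hP a X
    obtain ⟨h3, h4⟩ := vertMat_mul hP a Y
    exact sandwich_comp h1 h2 h3 h4 (by rw [flag_mul hP, if_pos rfl]) _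

/-- The weights of the pullback of the twistor metrics. -/
def twistorWeight (a : Fin 3) (t : ℝ) : Fin 3 → ℝ := fun k => if k = a then 1 - t / 2 else t / 2

theorem isWeight_twistorWeight (a : Fin 3) {t : ℝ} (ht : 0 < t) : IsWeight (twistorWeight a t) := by
  fin_cases a <;> refine ⟨?_, ?_, ?_⟩ <;> simp [twistorWeight] <;> linarith

/-- The horizontal term gives weight 1 on the two summands visible in X a. On the third, `vertMat`
is 2i times a Hermitian matrix with two conjugate entries, so tr(L L') has real part -8 Re(z z̄')
and the factor -t/8 leaves weight t. -/
theorem twistorMetric_eq_gform (t : ℝ) (a : Fin 3) {P X Y : Triple} (hP : P ∈ flagManifold)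
    (hX : X ∈ tangentSpace flagManifold P) (hY : Y ∈ tangentSpace flagManifold P) :
    twistorMetric t (twistorMap a P) (fderiv ℝ (twistorMap a) P X) (fderiv ℝ (twistorMap a) P Y)
      = gform (twistorWeight a t) X Y := by
  rw [twistorMetric_twistorMap t a hP hX hY]
  obtain ⟨u, hu, rfl⟩ := hP
  obtain ⟨x, y, z, rfl⟩ := (mem_tangentSpace_conjAct hu).1 hX
  obtain ⟨x', y', z', rfl⟩ := (mem_tangentSpace_conjAct hu).1 hY
  rw [gform_conj hu, vertMat_conj hu, vertMat_conj hu, ← conj_mul hu, trace_conj hu,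
    conjAct_apply, conjAct_apply, fsMetric_conj hu, gform_isoTan, vertMat_isoTan_apply,
    vertMat_isoTan_apply, fsMetric_eq_sum]
  fin_cases a <;>
    simp [Fin.sum_univ_three, isoTan_zero, isoTan_one, isoTan_two, isoForm, twistorWeight,
      Matrix.trace] <;> ring

/-! ### The almost complex structure of the twistor space -/

theorem twistorMap_snd_conj {u : Mat} (hu : u ∈ Matrix.unitaryGroup (Fin 3) ℂ) (a : Fin 3)
    (P : Triple) (Y : Mat) :
    (twistorMap a (conjAct u P)).2 (conj u Y) = conj u ((twistorMap a P).2 Y) := by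
  simp only [twistorMap_snd_apply, conjAct_apply, hermPart_conj, conj_smul, map_sub, conj_mul hu]

/-- Multiplying a, b, c by i multiplies Hom(u_a, u_{a+1}) by i. In Hom(u_a, u_{a+2}) the coordinate
appears conjugated and is multiplied by -i, which is the definition of j; the cyclic placement of a,
b, c makes this hold for every index. -/
theorem flagNK_J_horizontal (a : Fin 3) {P X : Triple} (hP : P ∈ flagManifold)
    (hX : X ∈ tangentSpace flagManifold P) : flagNK.J P X a = (twistorMap a P).2 (X a) := by
  obtain ⟨u, hu, rfl⟩ := hP
  obtain ⟨x, y, z, rfl⟩ := (mem_tangentSpace_conjAct hu).1 hX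
  rw [flagNK_J, tanOp_conj hu, tanOp_jMul_isoTan isWeight_half, conjAct_apply, conjAct_apply,
    twistorMap_snd_conj hu, twistorMap_snd_apply, hermPart_isoTan]
  congr 1
  ext k l
  rw [Matrix.smul_apply, Matrix.sub_apply, sub_mul, sub_mul, Matrix.sub_apply, mul_sub,
    Matrix.sub_apply]
  simp only [mul_baseFlag_apply, baseFlag_mul_apply]
  fin_cases a <;> fin_cases k <;> fin_cases l <;> simp [isoTan_zero, isoTan_one, isoTan_two]

/-- L exchanges the two eigenlines of K, so it anticommutes with K and -iKL = iLK. Both forms are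
needed, since L stands on the left in one vertical term and on the right in the other. -/
theorem vertMat_flagNK_J (a : Fin 3) {P X : Triple} (hP : P ∈ flagManifold)
    (hX : X ∈ tangentSpace flagManifold P) :
    vertMat a P (flagNK.J P X) = -(Complex.I • ((P (a + 1) - P (a + 2)) * vertMat a P X)) ∧
    vertMat a P (flagNK.J P X) = Complex.I • (vertMat a P X * (P (a + 1) - P (a + 2))) := by
  obtain ⟨u, hu, rfl⟩ := hP
  obtain ⟨x, y, z, rfl⟩ := (mem_tangentSpace_conjAct hu).1 hX
  rw [flagNK_J, tanOp_conj hu, tanOp_jMul_isoTan isWeight_half, vertMat_conj hu, vertMat_conj hu,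
    conjAct_apply, conjAct_apply, ← map_sub, ← conj_mul hu, ← conj_mul hu, ← conj_smul,
    ← conj_smul, ← map_neg]
  constructor <;> congr 1 <;> ext k l <;> rw [vertMat_isoTan_apply, vertMat_isoTan_apply]
  · simp only [sub_mul, Matrix.neg_apply, Matrix.smul_apply, Matrix.sub_apply, baseFlag_mul_apply]
    fin_cases a <;> fin_cases k <;> fin_cases l <;> simp <;> ring_nf
  · simp only [mul_sub, Matrix.smul_apply, Matrix.sub_apply, mul_baseFlag_apply]
    fin_cases a <;> fin_cases k <;> fin_cases l <;> simp <;> ring_nf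

theorem flagNK_isTwistorJMinus (a : Fin 3) {P X : Triple} (hP : P ∈ flagManifold)
    (hX : X ∈ tangentSpace flagManifold P) :
    IsTwistorJMinus (twistorMap a P) (fderiv ℝ (twistorMap a) P X)
      (fderiv ℝ (twistorMap a) P (flagNK.J P X)) := by
  constructor
  · rw [fderiv_twistorMap_fst, fderiv_twistorMap_fst, flagNK_J_horizontal a hP hX]
  · ext1 Y
    rw [vertPart_twistorMap a hP (flagNK.J_mem P hP X hX), neg_apply,
      ContinuousLinearMap.comp_apply, vertPart_twistorMap a hP hX, twistorMap_snd_apply,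
      hermPart_vertical hP hX]
    obtain ⟨h1, h2⟩ := vertMat_flagNK_J a hP hX
    have h3 : ∀ k, k ≠ a → P k * P a = 0 ∧ P a * P k = 0 := fun k h =>
      ⟨by rw [flag_mul hP, if_neg h], by rw [flag_mul hP, if_neg h.symm]⟩
    have e1 := h3 (a + 1) (by simp)
    have e2 := h3 (a + 2) (by simp)
    have hK : (P (a + 1) - P (a + 2)) * P a = 0 ∧ P a * (P (a + 1) - P (a + 2)) = 0 := by
      rw [sub_mul, mul_sub, e1.1, e1.2, e2.1, e2.2, sub_self]
      exact ⟨rfl, rfl⟩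
    have hPP : P a * P a = P a := by rw [flag_mul hP, if_pos rfl]
    obtain ⟨h4, h5⟩ := vertMat_mul hP a X
    -- The left occurrence takes the form -iKL and the right one iLK, to match -j ∘ A term by term.
    nth_rw 1 [h1]
    rw [h2]
    generalize P (a + 1) - P (a + 2) = K at *
    generalize vertMat a P X = L at *
    generalize hermPart Y = H at *
    have e : K * (L * H * P a - P a * H * L) * P a - P a * (L * H * P a - P a * H * L) * K
        = K * L * H * P a + P a * H * (L * K) := by
      calc _ = K * L * H * (P a * P a) - (K * P a) * H * (L * P a) - (P a * L) * H * (P a * K)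
          + (P a * P a) * H * (L * K) := by noncomm_ring
        _ = _ := by rw [hK.1, hK.2, h4, h5, hPP]; simp
    rw [e]
    simp only [neg_mul, smul_mul_assoc, mul_smul_comm, smul_add]
    abel

/-! ### Uniqueness of the pulled back structures -/

/-- Hermitian matrices span all matrices over ℂ, so D Y Q = 0 for every Y; matrix units Y then reach
each entry of D beside a nonzero entry of Q. -/
theorem eq_zero_of_mul_hermPart_mul {D Q : Mat} (hQ : Q ≠ 0)
    (h : ∀ Y, D * hermPart Y * Q = 0) : D = 0 := by
  have h1 : ∀ Y, D * Y * Q = 0 := by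
    intro Y
    have e : Y = hermPart Y - Complex.I • hermPart (Complex.I • Y) := by
      rw [hermPart_apply, hermPart_apply]
      ext i j
      simp
      ring_nf
      simp
      ring
    rw [e, mul_sub, sub_mul, h, mul_smul_comm, smul_mul_assoc, h, smul_zero, sub_zero]
  obtain ⟨i, j, hij⟩ : ∃ i j, Q i j ≠ 0 := by
    by_contra hne
    push Not at hne
    exact hQ (Matrix.ext hne)
  ext k l
  have e := congrFun₂ (h1 (Matrix.single l i 1)) k j
  rw [mul_assoc, Matrix.mul_apply, Finset.sum_eq_single l] at e
  · simpa [hij] using e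
  · intro m _ hm
    simp [hm]
  · simp

theorem flag_ne_zero {P : Triple} (hP : P ∈ flagManifold) (k : Fin 3) : P k ≠ 0 := fun h => by
  have := flag_trace hP k
  rw [h] at this
  simp at this

/-- A tangent vector of the flag manifold is determined by its image in the twistor space. -/
theorem eq_of_twistor_eq (a : Fin 3) {P X Y : Triple} (hP : P ∈ flagManifold)
    (hX : X ∈ tangentSpace flagManifold P) (hY : Y ∈ tangentSpace flagManifold P)
    (h1 : X a = Y a) (h2 : vertPart (twistorMap a P) (fderiv ℝ (twistorMap a) P X)
      = vertPart (twistorMap a P) (fderiv ℝ (twistorMap a) P Y)) : X = Y := by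
  have hV : vertMat a P X = vertMat a P Y := by
    rw [← sub_eq_zero]
    refine eq_zero_of_mul_hermPart_mul (flag_ne_zero hP a) fun Z => ?_
    -- Multiplication by P a on the right kills the second vertical term and isolates the difference
    -- of the two matrices.
    have e := congrArg (fun L : Mat →L[ℝ] Mat => L Z * P a) h2
    simp only [vertPart_twistorMap a hP hX, vertPart_twistorMap a hP hY, sub_mul] at e
    simpa only [mul_assoc, (vertMat_mul hP a X).1, (vertMat_mul hP a Y).1, mul_zero, sub_zero,
      flag_mul hP, if_true, sub_mul, sub_eq_zero] using e
  obtain ⟨u, hu, rfl⟩ := hP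
  obtain ⟨x, y, z, rfl⟩ := (mem_tangentSpace_conjAct hu).1 hX
  obtain ⟨x', y', z', rfl⟩ := (mem_tangentSpace_conjAct hu).1 hY
  have inj : Function.Injective (conj u) := fun S T h => by
    have e := congrArg (conj uᴴ) h
    have e' : ∀ S, conj uᴴ (conj u S) = S := fun S =>
      congrFun (conjAct_conjTranspose_conjAct hu (fun _ => S)) 0
    rwa [e', e'] at e
  rw [vertMat_conj hu, vertMat_conj hu] at hV
  have h3 := inj hV
  have h4 := inj h1
  rw [vertMat_isoTan_apply, vertMat_isoTan_apply] at h3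
  have h5 := smul_right_injective Mat (r := 2 * Complex.I) (by simp) h3
  have e : x = x' ∧ y = y' ∧ z = z' := by
    fin_cases a
    · have h6 : isoTan x y z 0 = isoTan x' y' z' 0 := h4
      rw [isoTan_zero, isoTan_zero] at h6
      exact ⟨congrFun₂ h6 1 0, neg_injective (congrFun₂ h6 0 2), congrFun₂ h5 2 1⟩
    · have h6 : isoTan x y z 1 = isoTan x' y' z' 1 := h4
      rw [isoTan_one, isoTan_one] at h6
      exact ⟨neg_injective (congrFun₂ h6 1 0), congrFun₂ h5 0 2, congrFun₂ h6 2 1⟩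
    · have h6 : isoTan x y z 2 = isoTan x' y' z' 2 := h4
      rw [isoTan_two, isoTan_two] at h6
      exact ⟨congrFun₂ h5 1 0, congrFun₂ h6 0 2, neg_injective (congrFun₂ h6 2 1)⟩
  rw [e.1, e.2.1, e.2.2]

theorem twistorWeight_one (a : Fin 3) : twistorWeight a 1 = fun _ => 1 / 2 := by
  funext k
  simp only [twistorWeight]
  split_ifs <;> norm_num

theorem flagNK_isTwistorStructure (a : Fin 3) : IsTwistorStructure a 1 flagNK := by
  refine fun P hP X hX => ⟨fun Y hY => ?_, flagNK_isTwistorJMinus a hP hX⟩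
  rw [twistorMetric_eq_gform 1 a hP hX hY, twistorWeight_one]
  rfl

variable {A : AlmostHermitian flagManifold} {a : Fin 3} {t : ℝ}

theorem IsTwistorStructure.hasWeight (h : IsTwistorStructure a t A) :
    HasWeight (twistorWeight a t) A.g := fun P hP X hX Y hY => by
  rw [(h P hP X hX).1 Y hY, twistorMetric_eq_gform t a hP hX hY]

/-- J₋ does not involve t, and a tangent vector is determined by its horizontal and vertical parts.
-/
theorem IsTwistorStructure.J_eq (h : IsTwistorStructure a t A) {P X : Triple}
    (hP : P ∈ flagManifold) (hX : X ∈ tangentSpace flagManifold P) : A.J P X = flagNK.J P X := by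
  obtain ⟨h1, h2⟩ := (h P hP X hX).2
  obtain ⟨h3, h4⟩ := flagNK_isTwistorJMinus a hP hX
  refine eq_of_twistor_eq a hP (A.J_mem P hP X hX) (flagNK.J_mem P hP X hX) ?_ (h2.trans h4.symm)
  have h5 := h1.trans h3.symm
  rwa [fderiv_twistorMap_fst, fderiv_twistorMap_fst] at h5

theorem IsTwistorStructure.same (h : IsTwistorStructure a 1 A) : A.Same flagNK :=
  fun P hP X hX => ⟨fun Y hY => by
    rw [h.hasWeight P hP X hX Y hY, twistorWeight_one]; rfl, h.J_eq hP hX⟩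

/-- All signs are 1, so the criterion asks for constant weights: 1 - t/2 = t/2. -/
theorem IsTwistorStructure.isNearlyKaehler_iff (ht : 0 < t) (h : IsTwistorStructure a t A) :
    A.IsNearlyKaehler ↔ t = 1 := by
  have hJ : HasMultiplier (jMul fun _ => 1) A.J := fun lam hl P hP X hX =>
    (h.J_eq hP hX).trans (flagNK_hasMultiplier lam hl P hP X hX)
  rw [isNearlyKaehler_jMul_iff (isWeight_twistorWeight a ht) h.hasWeight hJ]
  constructor
  · rintro ⟨h1, h2⟩
    fin_cases a <;> simp [twistorWeight] at h1 h2 <;> linarith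
  · rintro rfl
    rw [twistorWeight_one]
    norm_num

end

/-! ### Projections of rank one -/

-- A nonzero column of Q, normalized, spans its range. The projection R = n⁻¹ Q E Q onto that column
-- lies below Q and has the same trace, so Q - R is an orthogonal projection of trace zero and
-- vanishes.
open scoped ComplexOrder in
theorem exists_vector_of_mem_projectivePlane {Q : Mat} (hQ : Q ∈ projectivePlane) :
    ∃ v : Fin 3 → ℂ, star v ⬝ᵥ v = 1 ∧ Q = Matrix.vecMulVec v (star v) := by
  obtain ⟨h1, h2, h3⟩ := hQ
  obtain ⟨j, hj⟩ : ∃ j, Q j j ≠ 0 := by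
    by_contra hne
    push Not at hne
    exact zero_ne_one ((Finset.sum_eq_zero fun i _ => hne i).symm.trans h3)
  have hherm : ∀ i k, star (Q k i) = Q i k := fun i k => congrFun₂ h1 i k
  -- Since Q = Q*Q, the diagonal entry is the squared norm of column j.
  have hnn : Q j j = ((∑ k, Complex.normSq (Q k j) : ℝ) : ℂ) := by
    conv_lhs => rw [← h2]
    rw [Matrix.mul_apply]
    push_cast
    refine Finset.sum_congr rfl fun k _ => ?_
    rw [← hherm j k, Complex.star_def, Complex.normSq_eq_conj_mul_self]
  set n : ℝ := ∑ k, Complex.normSq (Q k j) with hn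
  have hn0 : n ≠ 0 := fun h => hj (by rw [hnn, h, Complex.ofReal_zero])
  have hnpos : 0 < n := lt_of_le_of_ne
    (Finset.sum_nonneg fun k _ => Complex.normSq_nonneg _) (Ne.symm hn0)
  have hnc : (n : ℂ) ≠ 0 := by exact_mod_cast hn0
  set E : Mat := Matrix.single j j 1 with hE
  have hEQE : E * Q * E = (n : ℂ) • E := by
    rw [hE, Matrix.single_mul_mul_single, hnn]
    ext i k; simp [Matrix.single_apply]
  set R : Mat := (n : ℂ)⁻¹ • (Q * E * Q) with hR
  have hQR : Q * R = R := by rw [hR, mul_smul_comm, ← mul_assoc, ← mul_assoc, h2]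
  have hRQ : R * Q = R := by rw [hR, smul_mul_assoc, mul_assoc, h2]
  have hRR : R * R = R := by
    have : (Q * E * Q) * (Q * E * Q) = (n : ℂ) • (Q * E * Q) := by
      calc _ = Q * (E * (Q * Q) * E) * Q := by noncomm_ring
        _ = _ := by rw [h2, hEQE, mul_smul_comm, smul_mul_assoc]
    rw [hR, smul_mul_assoc, mul_smul_comm, this, smul_smul, smul_smul]
    congr 1
    field_simp
  have hRh : Rᴴ = R := by
    simp [hR, Matrix.conjTranspose_smul, Matrix.conjTranspose_mul, h1, hE, mul_assoc]
  have hRt : R.trace = 1 := by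
    rw [hR, Matrix.trace_smul, Matrix.trace_mul_comm, ← mul_assoc, h2, hE,
      Matrix.trace_mul_single, hnn]
    simp [hnc]
  have hD : Q - R = 0 := by
    rw [← Matrix.trace_conjTranspose_mul_self_eq_zero_iff, Matrix.conjTranspose_sub, h1, hRh,
      sub_mul, mul_sub, mul_sub, h2, hQR, hRQ, hRR, sub_self, sub_zero, Matrix.trace_sub, h3, hRt,
      sub_self]
  have hsq : ((Real.sqrt n : ℝ) : ℂ) * (Real.sqrt n : ℝ) = n := by
    exact_mod_cast Real.mul_self_sqrt hnpos.le
  have hs0 : ((Real.sqrt n : ℝ) : ℂ) ≠ 0 := by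
    exact_mod_cast (Real.sqrt_pos.2 hnpos).ne'
  refine ⟨fun i => ((Real.sqrt n : ℝ) : ℂ)⁻¹ * Q i j, ?_, ?_⟩
  · have : ∀ i, star (((Real.sqrt n : ℝ) : ℂ)⁻¹ * Q i j) * (((Real.sqrt n : ℝ) : ℂ)⁻¹ * Q i j)
        = (n : ℂ)⁻¹ * (Complex.normSq (Q i j) : ℝ) := by
      intro i
      rw [Complex.normSq_eq_conj_mul_self, ← hsq]
      simp
      field_simp
    simp only [dotProduct, Pi.star_apply, this, ← Finset.mul_sum]
    rw [← Complex.ofReal_sum, ← hn, inv_mul_cancel₀ hnc]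
  · refine (sub_eq_zero.1 hD).trans ?_
    ext i k
    rw [hR, Matrix.smul_apply, Matrix.vecMulVec_apply, Matrix.mul_apply,
      Finset.sum_eq_single j]
    · rw [← hsq]
      simp [hE, ← hherm j k]
      field_simp
    · intro b _ hb
      simp [hE, hb]
    · simp

/-- The unitary matrix with given orthonormal columns. -/
theorem exists_unitary_of_orthonormal {v : Fin 3 → Fin 3 → ℂ}
    (hv : ∀ k l, star (v k) ⬝ᵥ v l = if k = l then 1 else 0) :
    ∃ u ∈ Matrix.unitaryGroup (Fin 3) ℂ,
      ∀ k, conj u (baseFlag k) = Matrix.vecMulVec (v k) (star (v k)) := by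
  refine ⟨Matrix.of fun i k => v k i, ?_, fun k => ?_⟩
  · rw [Matrix.mem_unitaryGroup_iff']
    ext k l
    rw [Matrix.one_apply, ← hv k l]
    rfl
  · ext i j
    rw [conj_apply, Matrix.mul_apply, Finset.sum_eq_single k]
    · rw [mul_baseFlag_apply, if_pos rfl]; rfl
    · intro b _ hb
      rw [mul_baseFlag_apply, if_neg hb, zero_mul]
    · simp

/-- Write T k = vₖ vₖ* with unit vectors. Evaluating T k * T l = 0 between vₖ and vₗ gives their
orthogonality, so they are the columns of a unitary matrix. -/
theorem mem_flagManifold_of_projections {T : Triple} (h : ∀ k, T k ∈ projectivePlane)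
    (h' : ∀ k l, k ≠ l → T k * T l = 0) : T ∈ flagManifold := by
  choose v hv hT using fun k => exists_vector_of_mem_projectivePlane (h k)
  obtain ⟨u, hu, hk⟩ := exists_unitary_of_orthonormal (v := v) fun k l => by
    split_ifs with hkl
    · rw [← hkl, hv]
    · have e := h' k l hkl
      rw [hT k, hT l, Matrix.vecMulVec_mul_vecMulVec] at e
      have e2 := congrArg (fun M : Mat => star (v k) ⬝ᵥ (M *ᵥ (v l))) e
      simpa [Matrix.smul_vecMulVec, Matrix.smul_mulVec, Matrix.vecMulVec_mulVec, hv] using e2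
  exact ⟨u, hu, funext fun k => by rw [conjAct_apply, hk, hT k]⟩

theorem exists_unitary_of_mem_projectivePlane {Q : Mat} (hQ : Q ∈ projectivePlane) (a : Fin 3) :
    ∃ u ∈ Matrix.unitaryGroup (Fin 3) ℂ, Q = conj u (baseFlag a) := by
  obtain ⟨v, hv, hQv⟩ := exists_vector_of_mem_projectivePlane hQ
  have hin : ∀ x y : EuclideanSpace ℂ (Fin 3), inner ℂ x y = star x.ofLp ⬝ᵥ y.ofLp := fun x y => by
    rw [EuclideanSpace.inner_eq_star_dotProduct, dotProduct_comm]
  have hor : Orthonormal ℂ (({a} : Set (Fin 3)).domRestrict fun _ => WithLp.toLp 2 v) := by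
    rw [orthonormal_iff_ite]
    intro i j
    rw [if_pos (Subsingleton.elim i j)]
    exact (hin _ _).trans hv
  obtain ⟨b, hb⟩ := hor.exists_orthonormalBasis_extension_of_card_eq (by simp)
  obtain ⟨u, hu, hk⟩ := exists_unitary_of_orthonormal (v := fun k => (b k).ofLp) fun k l => by
    rw [← hin, orthonormal_iff_ite.1 b.orthonormal]
  refine ⟨u, hu, ?_⟩
  rw [hk, hb a rfl, hQv]

/-! ### Injectivity of the twistor map -/

theorem flag_sum_cyclic {P : Triple} (hP : P ∈ flagManifold) (a : Fin 3) :
    P (a + 1) + P (a + 2) = 1 - P a := by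
  rw [← flag_sum hP]
  fin_cases a <;> simp <;> abel

theorem flag_diff_mul {P : Triple} (hP : P ∈ flagManifold) (a : Fin 3) :
    (P (a + 1) - P (a + 2)) * P a = 0 ∧ P a * (P (a + 1) - P (a + 2)) = 0 := by
  have h : ∀ k, k ≠ a → P k * P a = 0 ∧ P a * P k = 0 := fun k h =>
    ⟨by rw [flag_mul hP, if_neg h], by rw [flag_mul hP, if_neg h.symm]⟩
  have e1 := h (a + 1) (by simp)
  have e2 := h (a + 2) (by simp)
  rw [sub_mul, mul_sub, e1.1, e1.2, e2.1, e2.2, sub_self]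
  exact ⟨rfl, rfl⟩

theorem fin_three_cyclic (a k : Fin 3) : k = a ∨ k = a + 1 ∨ k = a + 2 := by
  revert a k; decide

/-- The twistor determines P a and, by evaluating j on Hermitian matrices, the difference K of the
other two projections; their sum is 1 - P a. -/
theorem twistorMap_injOn (a : Fin 3) : Set.InjOn (twistorMap a) flagManifold := by
  intro P hP P' hP' h
  have ha : P a = P' a := congrArg Prod.fst h
  have hK : P (a + 1) - P (a + 2) = P' (a + 1) - P' (a + 2) := by
    rw [← sub_eq_zero]
    refine eq_zero_of_mul_hermPart_mul (flag_ne_zero hP a) fun Y => ?_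
    have e := congrArg (fun z : Mat × (Mat →L[ℝ] Mat) => z.2 Y * P a) h
    simp only [twistorMap_snd_apply, smul_mul_assoc] at e
    have e' := smul_right_injective Mat (r := Complex.I) (by simp) e
    have h1 := (flag_diff_mul hP a).1
    have h2 := (flag_diff_mul hP' a).1
    have h3 : P a * P a = P a := by rw [flag_mul hP, if_pos rfl]
    rw [← ha] at h2 e'
    have key : ∀ K H : Mat, K * P a = 0 → (K * H * P a - P a * H * K) * P a = K * H * P a := by
      intro K H h
      rw [sub_mul, mul_assoc _ (P a) (P a), h3, mul_assoc _ K, h, mul_zero, sub_zero]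
    rw [key _ _ h1, key _ _ h2] at e'
    rw [sub_mul, sub_mul, sub_eq_zero]
    exact e'
  have hs : P (a + 1) + P (a + 2) = P' (a + 1) + P' (a + 2) := by
    rw [flag_sum_cyclic hP, flag_sum_cyclic hP', ha]
  have h1 : P (a + 1) = P' (a + 1) := by
    have e := congrArg₂ (· + ·) hs hK
    have e2 : (2 : ℝ) • P (a + 1) = (2 : ℝ) • P' (a + 1) := by
      rw [two_smul, two_smul]
      refine Eq.trans ?_ (e.trans ?_) <;> abel
    exact smul_right_injective Mat (r := (2 : ℝ)) two_ne_zero e2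
  have h2 : P (a + 2) = P' (a + 2) := by
    rw [h1] at hs
    exact add_left_cancel hs
  funext k
  rcases fin_three_cyclic a k with rfl | rfl | rfl
  exacts [ha, h1, h2]

/-! ### Linear algebra in `ℂ²` -/

/-- The Euclidean scalar product of `ℂ²`. -/
def planeInner (x y : ℂ × ℂ) : ℝ := (star x.1 * y.1 + star x.2 * y.2).re

/-- The Kähler form of `ℂ²`. -/
def planeForm (x y : ℂ × ℂ) : ℝ := planeInner (Complex.I • x) y

/-- The volume form of `ℂ²`. -/
def planeVolume (x₁ x₂ x₃ x₄ : ℂ × ℂ) : ℝ :=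
  planeForm x₁ x₂ * planeForm x₃ x₄ - planeForm x₁ x₃ * planeForm x₂ x₄
    + planeForm x₁ x₄ * planeForm x₂ x₃

/-- The complex structure `(v, w) ↦ (i v, -i w)`. -/
def planeTwist (x : ℂ × ℂ) : ℂ × ℂ := (Complex.I * x.1, -(Complex.I * x.2))

theorem planeVolume_twist (x y : ℂ × ℂ) : planeVolume x (planeTwist x) y (planeTwist y)
    = -Complex.normSq (x.1 * star y.2 - y.1 * star x.2) := by
  simp [planeVolume, planeForm, planeInner, planeTwist, Complex.normSq_apply]
  ring

/-- After conjugating the second coordinate, `planeTwist` is multiplication by i and the volume is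
minus the squared modulus of a complex determinant. If that determinant vanishes, the two vectors
are complex dependent and the four real vectors are dependent. -/
theorem planeVolume_twist_neg {x y : ℂ × ℂ}
    (h : LinearIndependent ℝ ![x, planeTwist x, y, planeTwist y]) :
    planeVolume x (planeTwist x) y (planeTwist y) < 0 := by
  rw [planeVolume_twist, neg_lt_zero, Complex.normSq_pos]
  intro h0
  rw [Fintype.linearIndependent_iff] at h
  have h1 : x.1 * star y.2 = y.1 * star x.2 := sub_eq_zero.1 h0
  have h2 : star x.1 * y.2 = star y.1 * x.2 := by
    have := congrArg star h1
    simpa [mul_comm] using this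
  -- ζ is the Hermitian product and n the squared norm in the conjugated coordinates. Dependence
  -- gives ζ x = n y there, a real relation between x, its twist and y whose third coefficient is
  -- -n.
  set ζ : ℂ := star x.1 * y.1 + x.2 * star y.2 with hζ
  set n : ℝ := Complex.normSq x.1 + Complex.normSq x.2 with hn
  have hnc : (n : ℂ) = star x.1 * x.1 + star x.2 * x.2 := by
    rw [hn, Complex.ofReal_add, Complex.normSq_eq_conj_mul_self, Complex.normSq_eq_conj_mul_self]
    rfl
  have e1 : ζ * x.1 = n * y.1 := by
    rw [hnc, hζ]; linear_combination x.2 * h1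
  have e2 : star ζ * x.2 = n * y.2 := by
    rw [hnc, hζ, star_add, star_mul', star_mul', star_star, star_star]
    linear_combination -x.1 * h2
  have e3 : ζ = ζ.re + ζ.im * Complex.I := (Complex.re_add_im ζ).symm
  have e4 : star ζ = ζ.re - ζ.im * Complex.I := by
    apply Complex.ext <;> simp
  have hc := h ![ζ.re, ζ.im, -n, 0] (by
    rw [Fin.sum_univ_four]
    refine Prod.ext ?_ ?_
    · simp [planeTwist]
      rw [e3] at e1
      linear_combination e1
    · simp [planeTwist]
      rw [e4] at e2
      linear_combination e2) 2
  have hn0 : n = 0 := by simpa using hc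
  have hx1 : Complex.normSq x.1 = 0 := by
    have a1 := Complex.normSq_nonneg x.1
    have a2 := Complex.normSq_nonneg x.2
    linarith
  have hx2 : Complex.normSq x.2 = 0 := by
    have a1 := Complex.normSq_nonneg x.1
    linarith
  have hx : x = 0 := Prod.ext (Complex.normSq_eq_zero.1 hx1) (Complex.normSq_eq_zero.1 hx2)
  have := h ![1, 0, 0, 0] (by rw [Fin.sum_univ_four]; simp [hx]) 0
  simp at this

/-- The six numbers are the upper entries, up to sign, of a skew-symmetric 4 × 4 matrix with square
-1. Such a matrix is self-dual or anti-self-dual: comparing row norms gives m² = p², and the sign of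
m decides unless p = 0, when r or q decides. -/
theorem self_dual_or_anti_self_dual {p q r s t m : ℝ} (h1 : p ^ 2 + q ^ 2 + r ^ 2 = 1)
    (h2 : q * s + r * t = 0) (h3 : p * s = r * m) (h4 : p * t = -(q * m))
    (h5 : p ^ 2 + s ^ 2 + t ^ 2 = 1) (h6 : q ^ 2 + s ^ 2 + m ^ 2 = 1)
    (h7 : r ^ 2 + t ^ 2 + m ^ 2 = 1) :
    (s = r ∧ t = -q ∧ m = p) ∨ (s = -r ∧ t = q ∧ m = -p) := by
  have hm : m ^ 2 = p ^ 2 := by linarith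
  rcases eq_or_ne p 0 with rfl | hp
  · have hm0 : m = 0 := by simpa using hm
    subst hm0
    have hs : s ^ 2 = r ^ 2 := by linarith
    have ht : t ^ 2 = q ^ 2 := by linarith
    rcases eq_or_ne r 0 with rfl | hr
    · have hs0 : s = 0 := by simpa using hs
      rcases sq_eq_sq_iff_eq_or_eq_neg.1 ht with h | h
      · exact Or.inr ⟨by simpa using hs0, h, by simp⟩
      · exact Or.inl ⟨hs0, h, rfl⟩
    · rcases sq_eq_sq_iff_eq_or_eq_neg.1 hs with h | h
      · refine Or.inl ⟨h, mul_left_cancel₀ hr ?_, rfl⟩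
        rw [h] at h2; linarith
      · refine Or.inr ⟨h, mul_left_cancel₀ hr ?_, by simp⟩
        rw [h] at h2; linarith
  · rcases sq_eq_sq_iff_eq_or_eq_neg.1 hm with h | h
    · refine Or.inl ⟨mul_left_cancel₀ hp ?_, mul_left_cancel₀ hp ?_, h⟩
      · rw [h3, h]; ring
      · rw [h4, h]; ring
    · refine Or.inr ⟨mul_left_cancel₀ hp ?_, mul_left_cancel₀ hp ?_, h⟩
      · rw [h3, h]; ring
      · rw [h4, h]; ring

/-- The four vectors are (1,0), (0,1) and their images under a structure of the
orientation-preserving branch. This test basis and the next one together cover all p, q, r. -/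
theorem linearIndependent_of_sq_add_sq_ne_zero (p q r : ℝ) (h : p ^ 2 + r ^ 2 ≠ 0) :
    LinearIndependent ℝ ![((1, 0) : ℂ × ℂ), (⟨0, p⟩, ⟨q, r⟩), (0, 1), (⟨-q, -r⟩, ⟨0, p⟩)] := by
  rw [Fintype.linearIndependent_iff]
  intro c hc
  rw [Fin.sum_univ_four] at hc
  simp [Prod.ext_iff, Complex.ext_iff] at hc
  obtain ⟨⟨h1, h2⟩, h3, h4⟩ := hc
  have c1 : c 1 = 0 := mul_left_cancel₀ h (by linear_combination p * h2 + r * h4)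
  have c3 : c 3 = 0 := mul_left_cancel₀ h (by linear_combination -r * h2 + p * h4)
  simp only [c1, c3, zero_mul, neg_zero, zero_add, add_zero] at h1 h3
  intro i
  fin_cases i
  · exact h1
  · exact c1
  · exact h3
  · exact c3

theorem linearIndependent_of_sq_add_sq_ne_zero' (p q r : ℝ) (h : p ^ 2 + q ^ 2 ≠ 0) :
    LinearIndependent ℝ
      ![((1, 0) : ℂ × ℂ), (⟨0, p⟩, ⟨q, r⟩), (0, Complex.I), (⟨-r, q⟩, ⟨-p, 0⟩)] := by
  rw [Fintype.linearIndependent_iff]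
  intro c hc
  rw [Fin.sum_univ_four] at hc
  simp [Prod.ext_iff, Complex.ext_iff] at hc
  obtain ⟨⟨h1, h2⟩, h3, h4⟩ := hc
  have c1 : c 1 = 0 := mul_left_cancel₀ h (by linear_combination p * h2 + q * h3)
  have c3 : c 3 = 0 := mul_left_cancel₀ h (by linear_combination q * h2 - p * h3)
  simp only [c1, c3, zero_mul, neg_zero, zero_add, add_zero] at h1 h4
  intro i
  fin_cases i
  · exact h1
  · exact c1
  · exact h4
  · exact c3

theorem apply_eq_sum_basis (J : ℂ × ℂ →ₗ[ℝ] ℂ × ℂ) (v w : ℂ) : J (v, w) = v.re • J (1, 0)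
    + v.im • J (Complex.I, 0) + w.re • J (0, 1) + w.im • J (0, Complex.I) := by
  rw [← map_smul, ← map_smul, ← map_smul, ← map_smul, ← map_add, ← map_add, ← map_add]
  congr 1
  refine Prod.ext ?_ ?_ <;> simp

/-- The orthogonal complex structures of `ℂ²` in coordinates: either they reverse or they preserve
the orientation. -/
theorem exists_coordinates (J : ℂ × ℂ →ₗ[ℝ] ℂ × ℂ) (hsq : ∀ x, J (J x) = -x)
    (hisom : ∀ x y, planeInner (J x) (J y) = planeInner x y) :
    ∃ p q r : ℝ, p ^ 2 + q ^ 2 + r ^ 2 = 1 ∧ J (1, 0) = (⟨0, p⟩, ⟨q, r⟩) ∧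
      ((J (Complex.I, 0) = (⟨-p, 0⟩, ⟨r, -q⟩) ∧ J (0, 1) = (⟨-q, -r⟩, ⟨0, p⟩) ∧
          J (0, Complex.I) = (⟨-r, q⟩, ⟨-p, 0⟩)) ∨
        (J (Complex.I, 0) = (⟨-p, 0⟩, ⟨-r, q⟩) ∧ J (0, 1) = (⟨-q, r⟩, ⟨0, -p⟩) ∧
          J (0, Complex.I) = (⟨-r, -q⟩, ⟨p, 0⟩))) := by
  have hskew : ∀ x y, planeInner (J x) y = -planeInner x (J y) := by
    intro x y
    rw [← hisom x, hsq]
    simp [planeInner]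
    ring
  have hc : ∀ x y, planeInner x y = x.1.re * y.1.re + x.1.im * y.1.im + x.2.re * y.2.re
      + x.2.im * y.2.im := by
    intro x y; simp [planeInner]; ring
  -- Skewness on the real basis reduces the sixteen entries of J to six.
  have hS := fun x y => (hc (J x) y).symm.trans ((hskew x y).trans (congrArg Neg.neg (hc x (J y))))
  have s11 := hS (1, 0) (1, 0)
  have s12 := hS (1, 0) (Complex.I, 0)
  have s13 := hS (1, 0) (0, 1)
  have s14 := hS (1, 0) (0, Complex.I)
  have s22 := hS (Complex.I, 0) (Complex.I, 0)
  have s23 := hS (Complex.I, 0) (0, 1)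
  have s24 := hS (Complex.I, 0) (0, Complex.I)
  have s33 := hS (0, 1) (0, 1)
  have s34 := hS (0, 1) (0, Complex.I)
  have s44 := hS (0, Complex.I) (0, Complex.I)
  simp only [Complex.one_re, Complex.one_im, Complex.I_re, Complex.I_im, Complex.zero_re,
    Complex.zero_im, mul_one, mul_zero, one_mul, zero_mul, add_zero, zero_add] at s11 s12 s13 s14 s22 s23 s24 s33 s34 s44
  obtain ⟨p, hp⟩ : ∃ p, p = (J (1, 0)).1.im := ⟨_, rfl⟩
  obtain ⟨q, hq⟩ : ∃ q, q = (J (1, 0)).2.re := ⟨_, rfl⟩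
  obtain ⟨r, hr⟩ : ∃ r, r = (J (1, 0)).2.im := ⟨_, rfl⟩
  obtain ⟨s, hs⟩ : ∃ s, s = (J (Complex.I, 0)).2.re := ⟨_, rfl⟩
  obtain ⟨t, ht⟩ : ∃ t, t = (J (Complex.I, 0)).2.im := ⟨_, rfl⟩
  obtain ⟨m, hm⟩ : ∃ m, m = (J (0, 1)).2.im := ⟨_, rfl⟩
  have j1 : J (1, 0) = (⟨0, p⟩, ⟨q, r⟩) :=
    Prod.ext (Complex.ext (by simp only; linarith) hp.symm) (Complex.ext hq.symm hr.symm)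
  have j2 : J (Complex.I, 0) = (⟨-p, 0⟩, ⟨s, t⟩) :=
    Prod.ext (Complex.ext (by simp only; linarith) (by simp only; linarith))
      (Complex.ext hs.symm ht.symm)
  have j3 : J (0, 1) = (⟨-q, -s⟩, ⟨0, m⟩) :=
    Prod.ext (Complex.ext (by simp only; linarith) (by simp only; linarith))
      (Complex.ext (by simp only; linarith) hm.symm)
  have j4 : J (0, Complex.I) = (⟨-r, -t⟩, ⟨-m, 0⟩) :=
    Prod.ext (Complex.ext (by simp only; linarith) (by simp only; linarith))
      (Complex.ext (by simp only; linarith) (by simp only; linarith))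
  have q1 := hsq (1, 0)
  have q2 := hsq (Complex.I, 0)
  have q3 := hsq (0, 1)
  have q4 := hsq (0, Complex.I)
  rw [j1, apply_eq_sum_basis, j1, j2, j3, j4] at q1
  rw [j2, apply_eq_sum_basis, j1, j2, j3, j4] at q2
  rw [j3, apply_eq_sum_basis, j1, j2, j3, j4] at q3
  rw [j4, apply_eq_sum_basis, j1, j2, j3, j4] at q4
  simp only [Prod.ext_iff, Complex.ext_iff] at q1 q2 q3 q4
  simp at q1 q2 q3 q4
  obtain ⟨⟨q11, q12⟩, q13, q14⟩ := q1
  refine ⟨p, q, r, by linarith, j1, ?_⟩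
  rcases self_dual_or_anti_self_dual (p := p) (q := q) (r := r) (s := s) (t := t) (m := m)
    (by linarith) (by linarith) (by linarith) (by linarith) (by linarith) (by linarith)
    (by linarith) with ⟨e1, e2, e3⟩ | ⟨e1, e2, e3⟩
  · exact Or.inl ⟨by rw [j2, e1, e2], by rw [j3, e1, e3], by rw [j4, e2, e3, neg_neg]⟩
  · exact Or.inr ⟨by rw [j2, e1, e2], by rw [j3, e1, e3, neg_neg], by rw [j4, e2, e3, neg_neg]⟩

/-- An orthogonal complex structure of `ℂ²` which reverses the orientation is complex linear,
with trace zero. -/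
theorem exists_of_orientation_reversing (J : ℂ × ℂ →ₗ[ℝ] ℂ × ℂ) (hsq : ∀ x, J (J x) = -x)
    (hisom : ∀ x y, planeInner (J x) (J y) = planeInner x y)
    (hor : ∀ x y, LinearIndependent ℝ ![x, J x, y, J y] → planeVolume x (J x) y (J y) < 0) :
    ∃ (p : ℝ) (β : ℂ), (p : ℂ) * p + star β * β = 1 ∧
      ∀ v w, J (v, w) = (Complex.I * p * v - star β * w, β * v - Complex.I * p * w) := by
  obtain ⟨p, q, r, h, j1, ⟨-, j3, j4⟩ | ⟨j2, j3, j4⟩⟩ := exists_coordinates J hsq hisom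
  · exfalso
    have o3 := hor (1, 0) (0, 1)
    have o4 := hor (1, 0) (0, Complex.I)
    have hv3 : planeVolume (1, 0) (⟨0, p⟩, ⟨q, r⟩) (0, 1) (⟨-q, -r⟩, ⟨0, p⟩) = p ^ 2 + r ^ 2 := by
      simp [planeVolume, planeForm, planeInner]; ring
    have hv4 : planeVolume (1, 0) (⟨0, p⟩, ⟨q, r⟩) (0, Complex.I) (⟨-r, q⟩, ⟨-p, 0⟩)
        = p ^ 2 + q ^ 2 := by
      simp [planeVolume, planeForm, planeInner]; ring
    rw [j1, j3, hv3] at o3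
    rw [j1, j4, hv4] at o4
    -- In this branch the volume is nonnegative on both test bases. As p² + q² + r² = 1, one of them
    -- is independent, contradicting orientation reversal.
    rcases eq_or_ne (p ^ 2 + r ^ 2) 0 with h0 | h0
    · have h1 : p ^ 2 + q ^ 2 ≠ 0 := fun h => by nlinarith
      exact absurd (o4 (linearIndependent_of_sq_add_sq_ne_zero' _ _ _ h1)) (add_nonneg (sq_nonneg p) (sq_nonneg q)).not_gt
    · exact absurd (o3 (linearIndependent_of_sq_add_sq_ne_zero _ _ _ h0)) (add_nonneg (sq_nonneg p) (sq_nonneg r)).not_gt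
  · refine ⟨p, ⟨q, r⟩, ?_, fun v w => ?_⟩
    · apply Complex.ext <;> simp <;> linarith
    · rw [apply_eq_sum_basis, j1, j2, j3, j4]
      refine Prod.ext ?_ ?_ <;> apply Complex.ext <;> simp <;> ring

section

/-! ### Surjectivity of the twistor map -/

/-- The identification of `ℂ²` with the tangent space of the projective plane at a coordinate
line. -/
def planeTan (a : Fin 3) : ℂ × ℂ →ₗ[ℝ] Mat where
  toFun x := Matrix.of fun i j =>
    if j = a then (if i = a then 0 else if i = a + 1 then x.1 else x.2)
    else (if i = a then (if j = a + 1 then star x.1 else star x.2) else 0)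
  map_add' x y := by
    ext i j
    simp only [Matrix.of_apply, Matrix.add_apply]
    split_ifs <;> simp
  map_smul' r x := by
    ext i j
    simp only [Matrix.of_apply, Matrix.smul_apply]
    split_ifs <;> simp

theorem planeTan_apply (a : Fin 3) (x : ℂ × ℂ) (i j : Fin 3) : planeTan a x i j =
    if j = a then (if i = a then 0 else if i = a + 1 then x.1 else x.2)
    else (if i = a then (if j = a + 1 then star x.1 else star x.2) else 0) := rfl

theorem planeTan_conjTranspose (a : Fin 3) (x : ℂ × ℂ) : (planeTan a x)ᴴ = planeTan a x := by
  ext i j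
  rw [Matrix.conjTranspose_apply, planeTan_apply, planeTan_apply]
  split_ifs <;> simp

theorem planeTan_injective (a : Fin 3) : Function.Injective (planeTan a) := by
  intro x y h
  have h1 := congrFun₂ h (a + 1) a
  have h2 := congrFun₂ h (a + 2) a
  simp only [planeTan_apply] at h1 h2
  refine Prod.ext ?_ ?_
  · simpa using h1
  · simpa using h2

theorem fsMetric_planeTan (a : Fin 3) (x y : ℂ × ℂ) :
    fsMetric (planeTan a x) (planeTan a y) = planeInner x y := by
  rw [fsMetric_eq_sum]
  fin_cases a <;> simp [Fin.sum_univ_three, planeTan_apply, planeInner] <;> ring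

theorem fsComplex_planeTan (a : Fin 3) (x : ℂ × ℂ) :
    fsComplex (baseFlag a) (planeTan a x) = planeTan a (Complex.I • x) := by
  ext i j
  rw [fsComplex, Matrix.smul_apply, Matrix.sub_apply, mul_baseFlag_apply, baseFlag_mul_apply]
  simp only [planeTan_apply]
  split_ifs <;> simp

theorem exists_tanProj_baseFlag (a : Fin 3) (X : Mat) :
    ∃ x, tanProj (baseFlag a) X = planeTan a x := by
  refine ⟨(hermPart X (a + 1) a, hermPart X (a + 2) a), ?_⟩
  have h : ∀ i j, hermPart X i j = star (hermPart X j i) := fun i j =>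
    (congrFun₂ (hermPart_isHermitian X) i j).symm
  have h' : ∀ i j, star (hermPart X j i) = hermPart X i j := fun i j => (h i j).symm
  ext i j
  rw [tanProj_baseFlag_apply, planeTan_apply]
  fin_cases a <;> fin_cases i <;> fin_cases j <;> simp only [h'] <;> rfl

theorem tanProj_planeTan (a : Fin 3) (x : ℂ × ℂ) :
    tanProj (baseFlag a) (planeTan a x) = planeTan a x := by
  ext i j
  rw [tanProj_baseFlag_apply, hermPart_of_conjTranspose (planeTan_conjTranspose a x)]
  simp only [planeTan_apply]
  split_ifs <;> rfl

/-- The identification of `ℂ²` with the tangent space of the projective plane at the line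
`ℂ u_a`. -/
def planeTanAt (u : Mat) (a : Fin 3) : ℂ × ℂ →ₗ[ℝ] Mat := conj u ∘ₗ planeTan a

theorem planeTanAt_apply (u : Mat) (a : Fin 3) (x : ℂ × ℂ) :
    planeTanAt u a x = conj u (planeTan a x) := rfl

variable {u : Mat}

theorem conj_injective (hu : u ∈ Matrix.unitaryGroup (Fin 3) ℂ) : Function.Injective (conj u) := by
  intro X Y h
  have e := congrArg (fun Z => uᴴ * Z * u) h
  simp only [conj_apply, mul_assoc, unitary_star_mul hu, mul_one] at e
  simpa only [← mul_assoc, unitary_star_mul hu, one_mul] using e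

theorem conj_surjective (hu : u ∈ Matrix.unitaryGroup (Fin 3) ℂ) (X : Mat) : ∃ Y, X = conj u Y := by
  refine ⟨uᴴ * X * u, ?_⟩
  simp only [conj_apply, mul_assoc, unitary_mul_star hu, mul_one]
  rw [← mul_assoc, unitary_mul_star hu, one_mul]

theorem planeTanAt_injective (hu : u ∈ Matrix.unitaryGroup (Fin 3) ℂ) (a : Fin 3) :
    Function.Injective (planeTanAt u a) := (conj_injective hu).comp (planeTan_injective a)

theorem conj_baseFlag_mem (hu : u ∈ Matrix.unitaryGroup (Fin 3) ℂ) (a : Fin 3) :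
    conj u (baseFlag a) ∈ projectivePlane :=
  flag_mem_projectivePlane (conjAct_baseFlag_mem hu) a

theorem exists_tanProj_conj (hu : u ∈ Matrix.unitaryGroup (Fin 3) ℂ) (a : Fin 3) (X : Mat) :
    ∃ x, tanProj (conj u (baseFlag a)) X = planeTanAt u a x := by
  obtain ⟨Y, rfl⟩ := conj_surjective hu X
  obtain ⟨x, hx⟩ := exists_tanProj_baseFlag a Y
  exact ⟨x, by rw [tanProj_conj hu, hx, planeTanAt_apply]⟩

theorem mem_tangentSpace_conj_baseFlag (hu : u ∈ Matrix.unitaryGroup (Fin 3) ℂ) {a : Fin 3}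
    {X : Mat} : X ∈ tangentSpace projectivePlane (conj u (baseFlag a)) ↔
      ∃ x, X = planeTanAt u a x := by
  constructor
  · intro hX
    rw [← tanProj_of_mem (conj_baseFlag_mem hu a) hX]
    exact exists_tanProj_conj hu a X
  · rintro ⟨x, rfl⟩
    rw [planeTanAt_apply, ← tanProj_planeTan, ← tanProj_conj hu]
    exact tanProj_mem (conj_baseFlag_mem hu a) _

theorem fsMetric_planeTanAt (hu : u ∈ Matrix.unitaryGroup (Fin 3) ℂ) (a : Fin 3) (x y : ℂ × ℂ) :
    fsMetric (planeTanAt u a x) (planeTanAt u a y) = planeInner x y := by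
  rw [planeTanAt_apply, planeTanAt_apply, fsMetric_conj hu, fsMetric_planeTan]

theorem fsForm_planeTanAt (hu : u ∈ Matrix.unitaryGroup (Fin 3) ℂ) (a : Fin 3) (x y : ℂ × ℂ) :
    fsForm (conj u (baseFlag a)) (planeTanAt u a x) (planeTanAt u a y) = planeForm x y := by
  have h : fsComplex (conj u (baseFlag a)) (planeTanAt u a x) = planeTanAt u a (Complex.I • x) := by
    rw [planeTanAt_apply, planeTanAt_apply, ← fsComplex_planeTan, fsComplex, fsComplex, conj_smul,
      map_sub, conj_mul hu, conj_mul hu]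
  rw [fsForm, h, fsMetric_planeTanAt hu, planeForm]

theorem fsVolume_planeTanAt (hu : u ∈ Matrix.unitaryGroup (Fin 3) ℂ) (a : Fin 3)
    (x₁ x₂ x₃ x₄ : ℂ × ℂ) : fsVolume (conj u (baseFlag a)) (planeTanAt u a x₁) (planeTanAt u a x₂)
      (planeTanAt u a x₃) (planeTanAt u a x₄) = planeVolume x₁ x₂ x₃ x₄ := by
  simp only [fsVolume, planeVolume, fsForm_planeTanAt hu]

theorem linearIndependent_planeTanAt (hu : u ∈ Matrix.unitaryGroup (Fin 3) ℂ) (a : Fin 3)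
    {x₁ x₂ x₃ x₄ : ℂ × ℂ} : LinearIndependent ℝ ![planeTanAt u a x₁, planeTanAt u a x₂,
      planeTanAt u a x₃, planeTanAt u a x₄] ↔ LinearIndependent ℝ ![x₁, x₂, x₃, x₄] := by
  have h : planeTanAt u a ∘ ![x₁, x₂, x₃, x₄] = ![planeTanAt u a x₁, planeTanAt u a x₂,
      planeTanAt u a x₃, planeTanAt u a x₄] := by
    funext i
    fin_cases i <;> rfl
  rw [← h]
  exact LinearMap.linearIndependent_iff _ (LinearMap.ker_eq_bot.2 (planeTanAt_injective hu a))

/-- A trace-free Hermitian endomorphism of the orthogonal complement of a coordinate line,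
extended by zero. -/
def planeMat (a : Fin 3) (p : ℝ) (β : ℂ) : Mat := Matrix.of fun i j =>
  if i = a then 0 else if j = a then 0
  else if i = a + 1 then (if j = a + 1 then (p : ℂ) else Complex.I * star β)
  else (if j = a + 1 then -(Complex.I * β) else -(p : ℂ))

theorem planeMat_apply (a : Fin 3) (p : ℝ) (β : ℂ) (i j : Fin 3) : planeMat a p β i j =
    if i = a then 0 else if j = a then 0
    else if i = a + 1 then (if j = a + 1 then (p : ℂ) else Complex.I * star β)
    else (if j = a + 1 then -(Complex.I * β) else -(p : ℂ)) := rfl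

theorem planeMat_conjTranspose (a : Fin 3) (p : ℝ) (β : ℂ) :
    (planeMat a p β)ᴴ = planeMat a p β := by
  ext i j
  rw [Matrix.conjTranspose_apply, planeMat_apply, planeMat_apply]
  split_ifs <;> simp

theorem planeMat_mul_baseFlag (a : Fin 3) (p : ℝ) (β : ℂ) : planeMat a p β * baseFlag a = 0 := by
  ext i j
  rw [mul_baseFlag_apply]
  split_ifs
  · simp [planeMat_apply]
  · rfl

theorem baseFlag_mul_planeMat (a : Fin 3) (p : ℝ) (β : ℂ) : baseFlag a * planeMat a p β = 0 := by
  ext i j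
  rw [baseFlag_mul_apply]
  split_ifs
  · simp [planeMat_apply]
  · rfl

theorem planeMat_trace (a : Fin 3) (p : ℝ) (β : ℂ) : (planeMat a p β).trace = 0 := by
  fin_cases a <;> simp [Matrix.trace, Fin.sum_univ_three, planeMat_apply]

/-- The unit norm condition on (p, β), the equation of a 2-sphere, makes this trace-free Hermitian
matrix an involution of the complement. -/
theorem planeMat_mul_self (a : Fin 3) {p : ℝ} {β : ℂ} (h : (p : ℂ) * p + star β * β = 1) :
    planeMat a p β * planeMat a p β = 1 - baseFlag a := by
  rw [Complex.star_def] at h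
  ext i j
  rw [Matrix.mul_apply, Fin.sum_univ_three, Matrix.sub_apply]
  fin_cases a <;> fin_cases i <;> fin_cases j <;> simp [planeMat_apply, baseFlag] <;>
    first
    | linear_combination h - β * (starRingEnd ℂ) β * Complex.I_mul_I
    | ring

theorem planeMat_one_zero (a : Fin 3) : planeMat a 1 0 = baseFlag (a + 1) - baseFlag (a + 2) := by
  ext i j
  fin_cases a <;> fin_cases i <;> fin_cases j <;> simp [planeMat_apply, baseFlag]

/-- `planeMat` is built so that i times it is the complex linear normal form found in
`exists_of_orientation_reversing`. -/
theorem twistor_planeTan (a : Fin 3) (p : ℝ) (β : ℂ) (x : ℂ × ℂ) :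
    Complex.I • (planeMat a p β * planeTan a x * baseFlag a
      - baseFlag a * planeTan a x * planeMat a p β)
    = planeTan a (Complex.I * p * x.1 - star β * x.2, β * x.1 - Complex.I * p * x.2) := by
  ext i j
  rw [Matrix.smul_apply, Matrix.sub_apply, mul_baseFlag_apply, mul_assoc, baseFlag_mul_apply,
    Matrix.mul_apply, Matrix.mul_apply, Fin.sum_univ_three, Fin.sum_univ_three]
  fin_cases a <;> fin_cases i <;> fin_cases j <;> simp [planeMat_apply, planeTan_apply] <;>
    first
    | linear_combination (starRingEnd ℂ) β * x.2 * Complex.I_mul_I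
    | linear_combination β * (starRingEnd ℂ) x.2 * Complex.I_mul_I
    | linear_combination -β * x.1 * Complex.I_mul_I
    | linear_combination -(starRingEnd ℂ) β * (starRingEnd ℂ) x.1 * Complex.I_mul_I

/-- The twistor of a flag which contains the coordinate line `a`. -/
theorem twistorMap_snd_planeTanAt (hu : u ∈ Matrix.unitaryGroup (Fin 3) ℂ) {a : Fin 3}
    {T : Triple} {p : ℝ} {β : ℂ} (h0 : T a = baseFlag a)
    (h : T (a + 1) - T (a + 2) = planeMat a p β) (x : ℂ × ℂ) :
    (twistorMap a (conjAct u T)).2 (planeTanAt u a x)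
      = planeTanAt u a (Complex.I * p * x.1 - star β * x.2, β * x.1 - Complex.I * p * x.2) := by
  rw [planeTanAt_apply, planeTanAt_apply, twistorMap_snd_conj hu, twistorMap_snd_apply, h0, h,
    hermPart_of_conjTranspose (planeTan_conjTranspose a x), twistor_planeTan]

theorem twistorMap_snd_tanProj (a : Fin 3) {P : Triple} (hP : P ∈ flagManifold) (X : Mat) :
    (twistorMap a P).2 (tanProj (P a) X) = (twistorMap a P).2 X := by
  obtain ⟨h1, h2⟩ := flag_diff_mul hP a
  have h3 : P a * P a = P a := by rw [flag_mul hP, if_pos rfl]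
  have h4 : hermPart (tanProj (P a) X) = tanProj (P a) X := hermPart_of_conjTranspose
    ((mem_tangentSpace_projectivePlane (flag_mem_projectivePlane hP a) _).1
      (tanProj_mem (flag_mem_projectivePlane hP a) X)).1
  rw [twistorMap_snd_apply, twistorMap_snd_apply, h4, tanProj_apply]
  set K := P (a + 1) - P (a + 2)
  set H := hermPart X
  have e1 : K * (P a * H + H * P a - (2 : ℝ) • (P a * H * P a)) * P a = K * H * P a := by
    simp only [mul_add, mul_sub, mul_smul_comm, ← mul_assoc, h1, zero_mul, smul_zero, sub_zero,
      zero_add]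
    rw [mul_assoc, h3]
  have e2 : P a * (P a * H + H * P a - (2 : ℝ) • (P a * H * P a)) * K = P a * H * K := by
    simp only [add_mul, sub_mul, mul_add, mul_sub, smul_mul_assoc, mul_smul_comm, mul_assoc, h2,
      mul_zero, smul_zero, sub_zero, add_zero]
    rw [← mul_assoc (P a) (P a), h3]
  rw [e1, e2]

/-- In the unitary frame of the flag, j is `planeTwist`, so all conditions are checked in ℂ². -/
theorem twistorMap_mapsTo (a : Fin 3) : Set.MapsTo (twistorMap a) flagManifold twistorSpace := by
  rintro P ⟨u, hu, rfl⟩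
  have hj : ∀ x, (twistorMap a (conjAct u baseFlag)).2 (planeTanAt u a x)
      = planeTanAt u a (planeTwist x) := by
    intro x
    rw [twistorMap_snd_planeTanAt hu rfl (planeMat_one_zero a).symm]
    simp [planeTwist]
  have ht := @mem_tangentSpace_conj_baseFlag u hu a
  refine ⟨conj_baseFlag_mem hu a, twistorMap_snd_tanProj a (conjAct_baseFlag_mem hu),
    fun X hX => ?_, fun X hX => ?_, fun X hX Y hY => ?_, fun X hX Y hY h => ?_⟩
  · obtain ⟨x, rfl⟩ := ht.1 hX
    exact ht.2 ⟨_, hj x⟩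
  · obtain ⟨x, rfl⟩ := ht.1 hX
    rw [hj, hj, ← map_neg]
    congr 1
    simp [planeTwist, ← mul_assoc, Prod.ext_iff]
  · obtain ⟨x, rfl⟩ := ht.1 hX
    obtain ⟨y, rfl⟩ := ht.1 hY
    rw [hj, hj, fsMetric_planeTanAt hu, fsMetric_planeTanAt hu]
    simp [planeInner, planeTwist]
  · obtain ⟨x, rfl⟩ := ht.1 hX
    obtain ⟨y, rfl⟩ := ht.1 hY
    rw [hj, hj] at h ⊢
    exact (fsVolume_planeTanAt hu a _ _ _ _).trans_lt
      (planeVolume_twist_neg ((linearIndependent_planeTanAt hu a).1 h))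

/-- The flag with line `a` the coordinate line, whose two other lines are the eigenspaces of an
involution of the orthogonal complement. -/
theorem exists_flag_of_planeMat (a : Fin 3) {p : ℝ} {β : ℂ} (h : (p : ℂ) * p + star β * β = 1) :
    ∃ T ∈ flagManifold, T a = baseFlag a ∧ T (a + 1) - T (a + 2) = planeMat a p β := by
  set E := baseFlag a with hE
  set K := planeMat a p β with hK
  have hKE : K * E = 0 := planeMat_mul_baseFlag a p β
  have hEK : E * K = 0 := baseFlag_mul_planeMat a p β
  have hKK : K * K = 1 - E := planeMat_mul_self a h
  have hEE : E * E = E := by rw [hE, baseFlag_mul, if_pos rfl]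
  have hEm : E ∈ projectivePlane := flag_mem_projectivePlane baseFlag_mem a
  -- For ε = 1 and ε = -1 this is the spectral projection of K on ℓ^⊥ for the eigenvalue ε.
  set R : ℝ → Mat := fun ε => (1 / 2 : ℝ) • (1 - E + ε • K) with hR
  have hRE : ∀ ε, R ε * E = 0 := fun ε => by
    simp only [hR, smul_mul_assoc, add_mul, sub_mul, one_mul, hEE, hKE, sub_self, smul_zero,
      add_zero]
  have hER : ∀ ε, E * R ε = 0 := fun ε => by
    simp only [hR, mul_smul_comm, mul_add, mul_sub, mul_one, hEE, hEK, sub_self, smul_zero,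
      add_zero]
  have hRR : ∀ ε δ, R ε * R δ = (1 / 4 : ℝ) • ((1 + ε * δ) • (1 - E) + (ε + δ) • K) := by
    intro ε δ
    simp only [hR, mul_smul_comm, smul_mul_assoc, add_mul, mul_add, sub_mul, mul_sub, one_mul,
      mul_one, hEE, hEK, hKE, hKK, smul_zero, sub_zero, smul_smul]
    module
  have hRm : ∀ ε : ℝ, ε * ε = 1 → R ε ∈ projectivePlane := by
    intro ε hε
    refine ⟨?_, ?_, ?_⟩
    · simp [hR, hEm.1, hK, planeMat_conjTranspose]
    · rw [hRR, hε]
      simp only [hR]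
      module
    · simp [hR, Matrix.trace_smul, hEm.2.2, hK, planeMat_trace]
      norm_num
  refine ⟨fun k => if k = a then E else if k = a + 1 then R 1 else R (-1),
    mem_flagManifold_of_projections (fun k => ?_) (fun k l hkl => ?_), ?_, ?_⟩
  · split_ifs
    · exact hEm
    · exact hRm 1 (by norm_num)
    · exact hRm (-1) (by norm_num)
  · have h1 : R 1 * R (-1) = 0 := by rw [hRR]; simp
    have h2 : R (-1) * R 1 = 0 := by rw [hRR]; simp
    have h3 : ∀ m, m ≠ a → m ≠ a + 1 → m = a + 2 := fun m hm hm' =>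
      ((fin_three_cyclic a m).resolve_left hm).resolve_left hm'
    split_ifs with k0 l0 l1 k1 l0 l1 l0 l1
    · exact absurd (k0.trans l0.symm) hkl
    · exact hER 1
    · exact hER (-1)
    · exact hRE 1
    · exact absurd (k1.trans l1.symm) hkl
    · exact h1
    · exact hRE (-1)
    · exact h2
    · exact absurd ((h3 k k0 k1).trans (h3 l l0 l1).symm) hkl
  · simp
  · simp [hR]
    module

theorem twistorMap_surjOn (a : Fin 3) : Set.SurjOn (twistorMap a) flagManifold twistorSpace := by
  rintro ⟨Q, j⟩ ⟨hQ, hj1, hj2, hj3, hj4, hj5⟩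
  obtain ⟨u, hu, rfl⟩ := exists_unitary_of_mem_projectivePlane hQ a
  dsimp only at hj1 hj2 hj3 hj4 hj5
  have ht := @mem_tangentSpace_conj_baseFlag u hu a
  have hmem : ∀ x, planeTanAt u a x ∈ tangentSpace projectivePlane (conj u (baseFlag a)) :=
    fun x => ht.2 ⟨x, rfl⟩
  have hinj := planeTanAt_injective hu a
  -- Carry j to ℂ² through the frame u; it inherits linearity from injectivity of `planeTanAt u a`,
  -- and then the normal form applies.
  choose f hf using fun x => ht.1 (hj2 _ (hmem x))
  let J : ℂ × ℂ →ₗ[ℝ] ℂ × ℂ :=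
    { toFun := f
      map_add' := fun x y => hinj (by rw [← hf, map_add, map_add, map_add, ← hf, ← hf])
      map_smul' := fun r x => hinj (by rw [← hf, map_smul, map_smul, map_smul, ← hf]; rfl) }
  have hJ : ∀ x, j (planeTanAt u a x) = planeTanAt u a (J x) := hf
  obtain ⟨p, β, hpβ, hform⟩ := exists_of_orientation_reversing J
    (fun x => hinj (by rw [← hJ, ← hJ, hj3 _ (hmem x), map_neg]))
    (fun x y => by
      rw [← fsMetric_planeTanAt hu a, ← hJ, ← hJ, hj4 _ (hmem x) _ (hmem y),
        fsMetric_planeTanAt hu])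
    (fun x y h => by
      have h' := hj5 _ (hmem x) _ (hmem y)
      rw [hJ, hJ, fsVolume_planeTanAt hu, linearIndependent_planeTanAt hu] at h'
      exact h' h)
  obtain ⟨T, hT, hT0, hT1⟩ := exists_flag_of_planeMat a hpβ
  have hP := conjAct_mem_flagManifold hu hT
  have hPa : conjAct u T a = conj u (baseFlag a) := by rw [conjAct_apply, hT0]
  refine ⟨conjAct u T, hP, Prod.ext hPa (ContinuousLinearMap.ext fun Y => ?_)⟩
  obtain ⟨x, hx⟩ := exists_tanProj_conj hu a Y
  rw [← twistorMap_snd_tanProj a hP, hPa, ← hj1, hx, twistorMap_snd_planeTanAt hu hT0 hT1, hJ,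
    ← hform]

theorem twistorMap_bijOn (a : Fin 3) : Set.BijOn (twistorMap a) flagManifold twistorSpace :=
  ⟨twistorMap_mapsTo a, twistorMap_injOn a, twistorMap_surjOn a⟩

end

end NearlyKaehler

end

/-! ### The theorem, with `flagNK` as the common structure -/

open NearlyKaehler in
theorem mainTheorem6 :
    (∀ a : Fin 3, Set.BijOn (twistorMap a) flagManifold twistorSpace) ∧
    ∃ N : AlmostHermitian flagManifold,
      IsInvariant N ∧ N.IsStrictlyNearlyKaehler ∧
      (∀ a : Fin 3, IsTwistorStructure a 1 N ∧
        (∀ A : AlmostHermitian flagManifold, IsTwistorStructure a 1 A → A.Same N) ∧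
        (∀ t : ℝ, 0 < t → ∀ A : AlmostHermitian flagManifold, IsTwistorStructure a t A →
          (A.IsNearlyKaehler ↔ t = 1))) ∧
      (∀ A : AlmostHermitian flagManifold, IsInvariant A → A.IsStrictlyNearlyKaehler →
        A.ProportionalUpToSign N) ∧
      (∀ A : AlmostHermitian flagManifold, IsInvariant A →
        ∃ r s t : ℝ, 0 < r ∧ 0 < s ∧ 0 < t ∧
          (∀ a b c a' b' c' : ℂ, metricOnIso A (isoVec a b c) (isoVec a' b' c')
            = isoForm r s t a b c a' b' c') ∧
          (IsNaturallyReductive A ↔ r = s ∧ s = t)) ∧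
      IsNaturallyReductive N ∧
      (∀ a b c a' b' c' : ℂ, metricOnIso N (isoVec a b c) (isoVec a' b' c')
        = isoForm 1 1 1 a b c a' b' c') ∧
      (∀ a b c : ℂ, N.J baseFlag (fundVec (isoVec a b c))
        = fundVec (isoVec (Complex.I * a) (Complex.I * b) (Complex.I * c))) := by
  have hg : ∀ a b c a' b' c' : ℂ, metricOnIso flagNK (isoVec a b c) (isoVec a' b' c')
      = isoForm 1 1 1 a b c a' b' c' := fun a b c a' b' c' => by
    refine (gform_isoTan (fun _ => 1 / 2) a b c a' b' c').trans ?_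
    norm_num
  refine ⟨twistorMap_bijOn, flagNK, flagNK_isInvariant, flagNK_isStrictlyNearlyKaehler,
    fun a => ⟨flagNK_isTwistorStructure a, fun A h => h.same,
      fun t ht A h => h.isNearlyKaehler_iff ht⟩,
    fun A hA hn => hA.proportionalUpToSign hn, fun A hA => ?_,
    (isNaturallyReductive_iff hg).2 ⟨rfl, rfl⟩, hg, fun a b c => ?_⟩
  · obtain ⟨r, s, t, hr, hs, ht, h⟩ := hA.exists_isoForm
    exact ⟨r, s, t, hr, hs, ht, h, isNaturallyReductive_iff h⟩
  · refine (tanOp_jMul_isoTan isWeight_half (fun _ => 1) a b c).trans ?_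
    simp only [Complex.ofReal_one, mul_one]
    rfl
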